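/- **Setting.** Let $P=(x_1,\dots,x_n)$ be points of $\mathbb R^d$ and let $k(x,y)=e^{-\|x-y\|^2}$ be the Gaussian kernel; put $w_i(x)=k(x,x_i)$. For a random hash function $h\sim\nu$ on $\mathbb R^d$ let $p(x,y)=\mathbb P_{h\sim\nu}[h(x)=h(y)]$, $p_i(x)=p(x,x_i)$ and $H(x)=\{i: h(x_i)=h(x)\}$. Let $I(x)$ be a uniformly random element of $H(x)$, or $\perp$ if $H(x)=\emptyset$, with $w_\perp=0$ and $p_\perp=1$. The *hashing-based estimator* (HBE) given by $\nu$ is $$Z_h(x)=\frac{w_{I(x)}}{p_{I(x)}}\cdot\frac{|H(x)|}{n}.$$ For $\beta\in(0,1]$ and $M\ge 1$ it is *$(\beta,M)$-scale free* (for $n$ points and diameter $R$) if $M^{-1}w_i(x)^\beta\le p_i(x)\le M\,w_i(x)^\beta$ for all $i$, all $P$ of size $n$ and all queries $x$ with $\mathrm{diam}(P\cup\{x\})\le R$. It has *complexity* $T$ if, on a real RAM (unit-cost real arithmetic, floor, $\sqrt{\cdot}$, $\exp$, $\log$, comparisons, indirect addressing, and independent uniform and Gaussian samples), almost surely, (a)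 a preprocessing program, given $n,d,R,\beta$ and $P$, draws $h$ and builds a data structure in time at most $T\cdot n$ and space at most $T\cdot n$, and (b) a query program answers every query $x$ with $\mathrm{diam}(P\cup\{x\})\le R$ in time at most $T$ by returning $I(x)$ together with the number $w_{I(x)}|H(x)|/n$, which divided by the collision probability $p_{I(x)}$ (regarded as known) is $Z_h(x)$. **Theorem (Gaussian kernel).** There are an absolute constant $C>0$ and fixed preprocessing and query programs such that for all integers $n\ge 3$, $d\ge 1$ and all real $R>0$, $\beta\in(0,1]$ there is a distribution $\nu$ of hash functions on $\mathbb R^d$ (depending on $n,d,R,\beta$ but not on $P$) whose HBE for the Gaussian kernel is $$\bigl(\beta,\ e^{C R^{4/3}\log\log n}\bigr)\text{-scale free}$$ and is implemented by these programs with complexity $$T=d\cdot e^{C\max(R,1)^{4/3}\log\log n}.$$ -/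

import Mathlib

open MeasureTheory ProbabilityTheory

noncomputable section

/-- Points of `ℝ^d` with the Euclidean norm. -/
abbrev Pt (d : ℕ) : Type := EuclideanSpace ℝ (Fin d)

/-- A source of randomness: one stream of uniform samples and one stream of Gaussian samples. -/
abbrev Tape : Type := (ℕ → ℝ) × (ℕ → ℝ)

/-- The law of a tape: all samples are independent, those of the first stream are uniform on
`[0,1]`, those of the second one are standard normal. -/
def tapeMeasure : Measure Tape :=
  (Measure.infinitePi (fun _ : ℕ => (volume : Measure ℝ).restrict (Set.Icc 0 1))).prod
    (Measure.infinitePi (fun _ : ℕ => gaussianReal 0 1))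

namespace RealRAM

/-! ### A real RAM

The memory consists of cells `0, 1, 2, …`, each holding a real number. There is a read-only input
array and a tape of random samples. Every basic instruction and every test costs one step. -/

inductive UnOp : Type
  | floor | sqrt | exp | log

inductive BinOp : Type
  | add | sub | mul | div

/-- Basic instructions; all `ℕ`-arguments are addresses of memory cells. -/
inductive Instr : Type
  /-- `mem[a] := z` -/
  | const (a : ℕ) (z : ℤ)
  /-- `mem[a] := f (mem[b])` -/
  | unary (f : UnOp) (a b : ℕ)
  /-- `mem[a] := f (mem[b], mem[c])` -/
  | binary (f : BinOp) (a b c : ℕ)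
  /-- `mem[a] := mem[⌊mem[b]⌋]` -/
  | load (a b : ℕ)
  /-- `mem[⌊mem[a]⌋] := mem[b]` -/
  | store (a b : ℕ)
  /-- `mem[a] := input[⌊mem[b]⌋]` -/
  | input (a b : ℕ)
  /-- `mem[a] :=` a fresh uniform sample from `[0,1]` -/
  | uniform (a : ℕ)
  /-- `mem[a] :=` a fresh standard normal sample -/
  | gauss (a : ℕ)

/-- Programs. -/
inductive Prog : Type
  | skip
  | basic (i : Instr)
  | seq (p q : Prog)
  /-- `if mem[a] ≤ mem[b] then p else q` -/
  | ifLE (a b : ℕ) (p q : Prog)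
  /-- `while mem[a] < mem[b] do p` -/
  | whileLT (a b : ℕ) (p : Prog)

structure State where
  mem : ℕ → ℝ
  input : ℕ → ℝ
  tape : Tape

def UnOp.eval : UnOp → ℝ → ℝ
  | .floor, u => (⌊u⌋ : ℤ)
  | .sqrt, u => Real.sqrt u
  | .exp, u => Real.exp u
  | .log, u => Real.log u

def BinOp.eval : BinOp → ℝ → ℝ → ℝ
  | .add, u, v => u + v
  | .sub, u, v => u - v
  | .mul, u, v => u * v
  | .div, u, v => u / v

/-- Write the value `v` into cell `a`. -/
def State.write (s : State) (a : ℕ) (v : ℝ) : State :=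
  { s with mem := Function.update s.mem a v }

/-- The effect of a basic instruction. -/
def Instr.step : Instr → State → State
  | .const a z, s => s.write a z
  | .unary f a b, s => s.write a (f.eval (s.mem b))
  | .binary f a b c, s => s.write a (f.eval (s.mem b) (s.mem c))
  | .load a b, s => s.write a (s.mem ⌊s.mem b⌋₊)
  | .store a b, s => s.write ⌊s.mem a⌋₊ (s.mem b)
  | .input a b, s => s.write a (s.input ⌊s.mem b⌋₊)
  | .uniform a, s =>
      { s.write a (s.tape.1 0) with tape := (fun k => s.tape.1 (k + 1), s.tape.2) }
  | .gauss a, s =>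
      { s.write a (s.tape.2 0) with tape := (s.tape.1, fun k => s.tape.2 (k + 1)) }

/-- `Exec p s t s'`: started in state `s`, the program `p` halts after exactly `t` steps
in state `s'`. -/
inductive Exec : Prog → State → ℕ → State → Prop
  | skip (s : State) : Exec .skip s 0 s
  | basic (i : Instr) (s : State) : Exec (.basic i) s 1 (i.step s)
  | seq {p q : Prog} {s s₁ s₂ : State} {t₁ t₂ : ℕ}
      (h₁ : Exec p s t₁ s₁) (h₂ : Exec q s₁ t₂ s₂) : Exec (.seq p q) s (t₁ + t₂) s₂
  | if_pos {a b : ℕ} {p q : Prog} {s s₁ : State} {t : ℕ}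
      (hc : s.mem a ≤ s.mem b) (h : Exec p s t s₁) : Exec (.ifLE a b p q) s (1 + t) s₁
  | if_neg {a b : ℕ} {p q : Prog} {s s₁ : State} {t : ℕ}
      (hc : ¬ s.mem a ≤ s.mem b) (h : Exec q s t s₁) : Exec (.ifLE a b p q) s (1 + t) s₁
  | while_done {a b : ℕ} {p : Prog} {s : State}
      (hc : ¬ s.mem a < s.mem b) : Exec (.whileLT a b p) s 1 s
  | while_step {a b : ℕ} {p : Prog} {s s₁ s₂ : State} {t₁ t₂ : ℕ}
      (hc : s.mem a < s.mem b) (h₁ : Exec p s t₁ s₁)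
      (h₂ : Exec (.whileLT a b p) s₁ t₂ s₂) : Exec (.whileLT a b p) s (1 + t₁ + t₂) s₂

end RealRAM

/-- A random hash function on `ℝ^d`: a family of functions indexed by the outcome of the random
tape. The measure `ν` on the family is the image of `tapeMeasure`. -/
structure HashFamily (d : ℕ) where
  Key : Type
  hash : Tape → Pt d → Key
  measurableSet_collision : ∀ x y : Pt d, MeasurableSet {ω : Tape | hash ω x = hash ω y}

/-- The collision probability `p(x,y) = ℙ[h(x) = h(y)]`. -/
def HashFamily.collisionProb {d : ℕ} (F : HashFamily d) (x y : Pt d) : ℝ :=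
  tapeMeasure.real {ω : Tape | F.hash ω x = F.hash ω y}

open Classical in
/-- The bucket `H(x)`: the (indices of the) data points with the same hash value as `x`. -/
def HashFamily.bucket {d n : ℕ} (F : HashFamily d) (P : Fin n → Pt d) (ω : Tape) (x : Pt d) :
    Finset (Fin n) :=
  Finset.univ.filter (fun i => F.hash ω (P i) = F.hash ω x)

/-- `p_i`, with the convention `p_⊥ = 1`. -/
def HashFamily.sampleProb {d n : ℕ} (F : HashFamily d) (P : Fin n → Pt d) (x : Pt d) :
    Option (Fin n) → ℝ
  | none => 1
  | some i => F.collisionProb x (P i)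

/-- `w_i(x) = k(x, x_i)`, with the convention `w_⊥ = 0`. -/
def sampleWeight {d n : ℕ} (k : Pt d → Pt d → ℝ) (P : Fin n → Pt d) (x : Pt d) :
    Option (Fin n) → ℝ
  | none => 0
  | some i => k x (P i)

/-- The value `Z_h(x) = (w_I / p_I) * |H(x)| / n` of the hashing-based estimator, for the hash
function given by `ω` and the sampled element `I` of the bucket (`none` stands for `⊥`). -/
def HashFamily.estimate {d n : ℕ} (F : HashFamily d) (k : Pt d → Pt d → ℝ) (P : Fin n → Pt d)
    (ω : Tape) (x : Pt d) (I : Option (Fin n)) : ℝ :=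
  sampleWeight k P x I / F.sampleProb P x I * (((F.bucket P ω x).card : ℝ) / n)

/-- `I` is a uniformly random element of the finite set `B`, or `⊥` if `B` is empty. -/
def IsUniformSample {n : ℕ} (B : Finset (Fin n)) (I : Tape → Option (Fin n)) : Prop :=
  (∀ o, MeasurableSet {τ : Tape | I τ = o}) ∧
  (B = ∅ → ∀ᵐ τ ∂tapeMeasure, I τ = none) ∧
  ∀ i ∈ B, tapeMeasure.real {τ : Tape | I τ = some i} = 1 / (B.card : ℝ)

/-- The hashing-based estimator of `F` for the kernel `k` is `(β, M)`-scale free, for data sets of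
`n` points and queries such that data set and query together have diameter at most `R`. -/
def HashFamily.IsScaleFree {d : ℕ} (F : HashFamily d) (k : Pt d → Pt d → ℝ) (n : ℕ)
    (R β M : ℝ) : Prop :=
  β ∈ Set.Ioc (0 : ℝ) 1 ∧ 1 ≤ M ∧
  ∀ (P : Fin n → Pt d) (x : Pt d), Metric.diam (insert x (Set.range P)) ≤ R →
    ∀ i, M⁻¹ * k x (P i) ^ β ≤ F.collisionProb x (P i) ∧
      F.collisionProb x (P i) ≤ M * k x (P i) ^ β

/-- Input of the preprocessing: `n, d, R, β`, followed by the coordinates of `P 0, P 1, …`. -/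
def datasetInput {d n : ℕ} (R β : ℝ) (P : Fin n → Pt d) (a : ℕ) : ℝ :=
  if a = 0 then n else if a = 1 then d else if a = 2 then R else if a = 3 then β
  else if h : (a - 4) / d < n ∧ (a - 4) % d < d then P ⟨(a - 4) / d, h.1⟩ ⟨(a - 4) % d, h.2⟩
  else 0

/-- Input of the query: the coordinates of the query point. -/
def queryInput {d : ℕ} (x : Pt d) (a : ℕ) : ℝ :=
  if h : a < d then x ⟨a, h⟩ else 0

/-- Code of a bucket sample as a real number: `0` for `⊥` and `i + 1` for the index `i`. -/
def sampleCode {n : ℕ} : Option (Fin n) → ℝ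
  | none => 0
  | some i => (i : ℕ) + 1

open RealRAM in
/-- The programs `pre` and `query` implement the hashing-based estimator of `F` with
complexity `T`, for data sets of `n` points and diameter parameter `R`.

* Preprocessing draws the hash function `h` given by the tape `ω`, and builds a data structure in
  time at most `T * n`; the data structure occupies at most `T * n` cells. (An execution of `t`
  steps writes at most `t` cells, so working space is covered by the time bound.)
* A query is answered in time at most `T`, from the data structure, the query point and a fresh
  random tape `τ`. It returns a uniformly random element `I` of the bucket `H(x)` in cell `0`, and
  in cell `1` the numerator of the estimate, i.e. the number which divided by the collision
  probability `p_I` is `Z_h(x)`.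

The collision probabilities are regarded as known; they are not available to the programs. -/
def HashFamily.HasComplexity {d : ℕ} (F : HashFamily d) (pre query : Prog)
    (k : Pt d → Pt d → ℝ) (n : ℕ) (R β T : ℝ) : Prop :=
  ∀ P : Fin n → Pt d, Metric.diam (Set.range P) ≤ R →
    ∀ᵐ ω ∂tapeMeasure, ∃ (t : ℕ) (s : State),
      Exec pre ⟨fun _ => 0, datasetInput R β P, ω⟩ t s ∧
      (t : ℝ) ≤ T * n ∧
      (Function.support s.mem).Finite ∧ ((Function.support s.mem).ncard : ℝ) ≤ T * n ∧
      ∀ x : Pt d, Metric.diam (insert x (Set.range P)) ≤ R →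
        ∃ I : Tape → Option (Fin n), IsUniformSample (F.bucket P ω x) I ∧
          ∀ᵐ τ ∂tapeMeasure, ∃ (t' : ℕ) (s' : State),
            Exec query ⟨s.mem, queryInput x, τ⟩ t' s' ∧
            (t' : ℝ) ≤ T ∧
            s'.mem 0 = sampleCode (I τ) ∧
            s'.mem 1 / F.sampleProb P x (I τ) = F.estimate k P ω x (I τ)

/-- The Gaussian kernel. -/
def gaussianKernel {d : ℕ} (x y : Pt d) : ℝ := Real.exp (-‖x - y‖ ^ 2)

end

noncomputable section

/-! ### Exponential moments of the squared norm of a standard Gaussian vector -/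

/-! The hash function is ball carving on a torus, repeated independently. A piece maps a point by a
Gaussian matrix, scaled by `projScale`, to `t = 2m` coordinates modulo `1`, draws `N = t ^ t`
uniform centers, and records the last center within distance `1/4`. The hash value is the tuple of
`k` pieces, so its collision probability is the `k`-th power of that of one piece
(`ballCarving_collisionProb`).

For fixed projected points, the probability of having the same last hit is, apart from the event
that no ball hits, the volume of the intersection of two balls divided by the volume of their union
(`le_measure_agree`, `measure_agree_le`). At distance `D`, the lens of two balls of radius `1/4` has
relative volume `(1 - 4 * D ^ 2) ^ m` up to polynomial factors and a shift by `1/m`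
(`hitSet_inter_le`, `le_hitSet_inter`). Since `D` is `s = σ * r` times the norm of a standard
Gaussian vector `g`, where `r` is the distance of the points, one piece collides with probability
about the mean of `(1 - C * ‖g‖ ^ 2 / (2 * m)) ^ m`, where `C = 8 * m * s ^ 2`.

This mean is `exp (-m * C)` up to `exp (O (m * C ^ 3))` and polynomial factors. The dominant
contribution comes from `‖g‖ ^ 2 ≈ 2 * m * (1 - C)`; there the second-order terms of the lens volume
and of the Gaussian density cancel (`tangent_upper`, `tangent_lower`). The upper bound replaces the
lens by a tangent exponential (`integral_lens_upper`), the lower bound restricts to a window around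
the dominant length (`integral_lens_lower`).

The scale makes `m * C = β * r ^ 2 / k`, so `k` pieces give `exp (-β * r ^ 2)` with an error `O (k *
log m)` in the exponent. With `q = ⌊R ^ (1/4)⌋` and both `k` and `m` of order `q ^ 5`, the cubic
error `m * C ^ 3` is at most `1 / q`, and `k * log m` and `t * log t` are `O (q ^ (16/3)) = O (R ^
(4/3))`. The first bounds the distortion (`gaussianHash_collisionProb_bounds`), the second the
number of trials (`one_add_size_le`). None of these bounds depends on `n`; the factor `log log n`
enters only through the lower bound `log log 3 > 0`.

The programs are written in a small language with registers and arrays whose translation to the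
machine preserves running time (`Cmd.Exec.compile`). Preprocessing stores the samples and a directly
addressed table of buckets; a query hashes its point and picks a table entry with one uniform sample
(`gaussianHash_hasComplexity`). -/

/-- The law of a standard Gaussian vector with `t` coordinates. -/
abbrev stdNormal (t : ℕ) : Measure (Fin t → ℝ) := Measure.pi fun _ => gaussianReal 0 1

/-- The squared Euclidean norm of a coordinate vector. -/
def sqSum {t : ℕ} (g : Fin t → ℝ) : ℝ := ∑ j, g j ^ 2

@[fun_prop]
theorem measurable_sqSum {t : ℕ} : Measurable (sqSum : (Fin t → ℝ) → ℝ) := by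
  unfold sqSum; fun_prop

theorem gaussian_pdf_mul_exp (lam x : ℝ) :
    gaussianPDFReal 0 1 x • Real.exp (-lam * x ^ 2) =
      (Real.sqrt (2 * Real.pi))⁻¹ * Real.exp (-(lam + 1 / 2) * x ^ 2) := by
  rw [gaussianPDFReal, smul_eq_mul, mul_assoc, ← Real.exp_add]
  simp only [NNReal.coe_one, mul_one, sub_zero]
  congr 2
  ring

theorem integral_exp_neg_mul_sq_gaussianReal {lam : ℝ} (h : 0 < 1 + 2 * lam) :
    ∫ x, Real.exp (-lam * x ^ 2) ∂gaussianReal 0 1 = (Real.sqrt (1 + 2 * lam))⁻¹ := by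
  rw [integral_gaussianReal_eq_integral_smul one_ne_zero]
  simp_rw [gaussian_pdf_mul_exp]
  rw [integral_const_mul, integral_gaussian, ← Real.sqrt_inv, ← Real.sqrt_mul (by positivity),
    ← Real.sqrt_inv]
  congr 1
  rw [show 1 + 2 * lam = 2 * (lam + 1 / 2) by ring]
  have : lam + 1 / 2 ≠ 0 := by intro h0; linarith
  field_simp

/-- A function that is not integrable has Bochner integral `0`, whereas the value just computed is
positive. -/
theorem integrable_exp_neg_mul_sq_gaussianReal {lam : ℝ} (h : 0 < 1 + 2 * lam) :
    Integrable (fun x => Real.exp (-lam * x ^ 2)) (gaussianReal 0 1) := by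
  by_contra hn
  have := integral_undef hn
  rw [integral_exp_neg_mul_sq_gaussianReal h] at this
  have : 0 < (Real.sqrt (1 + 2 * lam))⁻¹ := by positivity
  linarith

theorem exp_neg_mul_sqSum {t : ℕ} (lam : ℝ) (g : Fin t → ℝ) :
    Real.exp (-lam * sqSum g) = ∏ j, Real.exp (-lam * g j ^ 2) := by
  rw [sqSum, Finset.mul_sum, Real.exp_sum]

theorem integrable_exp_neg_mul_sqSum {t : ℕ} {lam : ℝ} (h : 0 < 1 + 2 * lam) :
    Integrable (fun g => Real.exp (-lam * sqSum g)) (stdNormal t) := by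
  simp_rw [exp_neg_mul_sqSum]
  exact Integrable.fintype_prod (f := fun _ x => Real.exp (-lam * x ^ 2))
    fun _ => integrable_exp_neg_mul_sq_gaussianReal h

/-- The even dimension pairs the square roots of the one-dimensional integrals into an integral
power. -/
theorem integral_exp_neg_mul_sqSum (m : ℕ) {lam : ℝ} (h : 0 < 1 + 2 * lam) :
    ∫ g, Real.exp (-lam * sqSum g) ∂stdNormal (2 * m) = ((1 + 2 * lam)⁻¹) ^ m := by
  simp_rw [exp_neg_mul_sqSum]
  rw [integral_fintype_prod_eq_pow (fun x => Real.exp (-lam * x ^ 2)),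
    integral_exp_neg_mul_sq_gaussianReal h, Fintype.card_fin, pow_mul, inv_pow,
    Real.sq_sqrt h.le]

/-! ### Elementary estimates -/

theorem log_one_sub_le {y : ℝ} (h0 : 0 ≤ y) (h1 : y < 1) : Real.log (1 - y) ≤ -y - y ^ 2 / 2 := by
  have h := Real.hasSum_pow_div_log_of_abs_lt_one (x := y) (by rwa [abs_of_nonneg h0])
  have := sum_le_hasSum (Finset.range 2) (fun i _ => by positivity) h
  simp [Finset.sum_range_succ] at this
  norm_num at this
  linarith

theorem le_log_one_sub {y : ℝ} (h0 : 0 ≤ y) (h1 : y ≤ 1 / 2) :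
    -y - y ^ 2 / 2 - 2 * y ^ 3 ≤ Real.log (1 - y) := by
  have h := Real.abs_log_sub_add_sum_range_le (x := y) (by rw [abs_of_nonneg h0]; linarith) 2
  simp [Finset.sum_range_succ, abs_of_nonneg h0] at h
  have h2 : y ^ 3 / (1 - y) ≤ 2 * y ^ 3 := by
    rw [div_le_iff₀ (by linarith)]
    nlinarith [pow_nonneg h0 3]
  have := (abs_le.mp h).1
  norm_num at this
  linarith

theorem le_log_one_sub_of_abs {y : ℝ} (h1 : |y| ≤ 1 / 2) :
    -y - 2 * y ^ 2 ≤ Real.log (1 - y) := by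
  have h := Real.abs_log_sub_add_sum_range_le (x := y) (by linarith) 1
  simp at h
  have h2 : y ^ 2 / (1 - |y|) ≤ 2 * y ^ 2 := by
    rw [div_le_iff₀ (by linarith)]
    nlinarith [sq_nonneg y]
  have := (abs_le.mp h).1
  linarith

/-! ### Gaussian averages of relative lens volumes. -/

/-- The two second-order corrections, of the lens volume and of the projected length, cancel. -/
theorem tangent_upper {C : ℝ} (h0 : 0 ≤ C) (h1 : C ≤ 1 / 16) :
    (1 - C + C ^ 2) * Real.exp ((C - C ^ 2) / (1 - C + C ^ 2)) *
      (1 + 2 * (C / (2 * (1 - C + C ^ 2))))⁻¹ ≤ Real.exp (-C + C ^ 3) := by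
  have hA : 0 < 1 - C + C ^ 2 := by nlinarith
  have hB : 0 < 1 + C ^ 2 := by positivity
  -- Here `1 + 2 * lam = (1 + C ^ 2) / A` with `A = 1 - C + C ^ 2`. After taking logarithms, the
  -- coefficients of `C ^ 2` in the bounds `l1` (used twice), `l2` and `l3` add up to zero.
  have e1 : (1 - C + C ^ 2) * Real.exp ((C - C ^ 2) / (1 - C + C ^ 2)) *
      (1 + 2 * (C / (2 * (1 - C + C ^ 2))))⁻¹ = (1 - C + C ^ 2) * (1 - C + C ^ 2) *
        Real.exp ((C - C ^ 2) / (1 - C + C ^ 2)) * (1 + C ^ 2)⁻¹ := by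
    field_simp
    ring
  rw [e1, ← Real.log_le_iff_le_exp (by positivity), Real.log_mul (by positivity) (by positivity),
    Real.log_mul (by positivity) (by positivity), Real.log_mul hA.ne' hA.ne', Real.log_exp,
    Real.log_inv]
  have l1 : Real.log (1 - C + C ^ 2) ≤ -(C - C ^ 2) - (C - C ^ 2) ^ 2 / 2 := by
    have := log_one_sub_le (y := C - C ^ 2) (by nlinarith) (by nlinarith)
    rwa [show 1 - (C - C ^ 2) = 1 - C + C ^ 2 by ring] at this
  have l2 : C ^ 2 - C ^ 4 / 2 ≤ Real.log (1 + C ^ 2) := by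
    refine le_trans ?_ (Real.le_log_one_add_of_nonneg (by positivity))
    rw [le_div_iff₀ (by positivity)]
    nlinarith [pow_nonneg h0 6, pow_nonneg h0 4]
  have l3 : (C - C ^ 2) / (1 - C + C ^ 2) ≤ C - C ^ 3 := by
    rw [div_le_iff₀ hA]
    nlinarith [pow_nonneg h0 4, pow_nonneg h0 3]
  nlinarith [pow_nonneg h0 4]

/-- Upper bound for the average over a Gaussian vector of the relative volume of a lens. -/
theorem integral_lens_upper {m : ℕ} {C eps : ℝ} (hm : 1 ≤ m) (h0 : 0 < C) (h1 : C ≤ 1 / 16)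
    (h3 : m * C ^ 3 ≤ 1) (f : (Fin (2 * m) → ℝ) → ℝ) (hf : Integrable f (stdNormal (2 * m)))
    (hf1 : ∀ g, f g ≤ 1) (heps : 0 ≤ eps)
    (hfu : ∀ g, C / (2 * m) * sqSum g < 1 → f g ≤ (1 - C / (2 * m) * sqSum g) ^ m + eps) :
    ∫ g, f g ∂stdNormal (2 * m) ≤ Real.exp (-(m * C) + 1) + Real.exp (-m) + eps := by
  have hm0 : (0 : ℝ) < m := by exact_mod_cast hm
  -- `A` is the value of `1 - y` at `y = C - C ^ 2`, that is, at squared length `2 * m * (1 - C)`.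
  -- The tangent of `log (1 - y)` at this point gives `1 - y ≤ A * exp ((C - C ^ 2 - y) / A)`, whose
  -- `m`-th power is an exponential in `sqSum` with rate `lam`.
  set A := 1 - C + C ^ 2 with hA'
  have hA : 0 < A := by nlinarith
  set lam := C / (2 * A) with hlam
  have hlam0 : 0 < 1 + 2 * lam := by positivity
  set D := (A * Real.exp ((C - C ^ 2) / A)) ^ m with hD
  set a := C / (2 * m) with ha
  have ha0 : 0 < a := by positivity
  -- The tangent exponential handles the vectors where the lens bound applies; the term with rate
  -- `-1/4` is at least `1` on the others and serves as a Chernoff bound for them.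
  have key : ∀ g, f g ≤ D * Real.exp (-lam * sqSum g) +
      Real.exp (-(1 / (4 * a))) * Real.exp (-(-(1 / 4)) * sqSum g) + eps := by
    intro g
    have p1 : 0 ≤ D * Real.exp (-lam * sqSum g) := by positivity
    have p2 : 0 ≤ Real.exp (-(1 / (4 * a))) * Real.exp (-(-(1 / 4)) * sqSum g) := by positivity
    by_cases h : a * sqSum g < 1
    · have := hfu g h
      have h2 : (1 - a * sqSum g) ^ m ≤ D * Real.exp (-lam * sqSum g) := by
        have e : D * Real.exp (-lam * sqSum g) =
            (A * Real.exp ((C - C ^ 2 - a * sqSum g) / A)) ^ m := by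
          have : -lam * sqSum g = m * (-(a * sqSum g) / A) := by
            rw [hlam, ha]; field_simp
          rw [hD, this, Real.exp_nat_mul, ← mul_pow, mul_assoc, ← Real.exp_add]
          congr 3
          ring
        rw [e]
        apply pow_le_pow_left₀ (by linarith)
        have := Real.add_one_le_exp ((C - C ^ 2 - a * sqSum g) / A)
        calc 1 - a * sqSum g = A * ((C - C ^ 2 - a * sqSum g) / A + 1) := by
              field_simp; rw [hA']; ring
          _ ≤ _ := by gcongr
      linarith
    · have : 1 ≤ Real.exp (-(1 / (4 * a))) * Real.exp (-(-(1 / 4)) * sqSum g) := by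
        rw [← Real.exp_add]
        apply Real.one_le_exp
        have : 1 / (4 * a) ≤ sqSum g / 4 := by
          rw [div_le_div_iff₀ (by positivity) (by positivity)]
          nlinarith
        linarith
      have := hf1 g
      linarith
  have hl2 : (0 : ℝ) < 1 + 2 * (-(1 / 4)) := by norm_num
  have i1 := integrable_exp_neg_mul_sqSum (t := 2 * m) hlam0
  have i2 := integrable_exp_neg_mul_sqSum (t := 2 * m) hl2
  have i12 : Integrable (fun g => D * Real.exp (-lam * sqSum g) +
      Real.exp (-(1 / (4 * a))) * Real.exp (-(-(1 / 4)) * sqSum g)) (stdNormal (2 * m)) :=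
    (i1.const_mul D).add (i2.const_mul (Real.exp (-(1 / (4 * a)))))
  calc ∫ g, f g ∂stdNormal (2 * m) ≤ ∫ g, (D * Real.exp (-lam * sqSum g) +
      Real.exp (-(1 / (4 * a))) * Real.exp (-(-(1 / 4)) * sqSum g) + eps) ∂stdNormal (2 * m) :=
        integral_mono hf (i12.add (integrable_const _)) key
    _ = D * ((1 + 2 * lam)⁻¹) ^ m +
        Real.exp (-(1 / (4 * a))) * ((1 + 2 * (-(1 / 4)))⁻¹) ^ m + eps := by
        rw [integral_add i12 (integrable_const _)]
        rw [integral_add (i1.const_mul D) (i2.const_mul _), integral_const_mul,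
          integral_const_mul, integral_exp_neg_mul_sqSum m hlam0, integral_exp_neg_mul_sqSum m hl2]
        simp
    _ ≤ _ := by
        gcongr
        · rw [hD, ← mul_pow]
          calc _ ≤ (Real.exp (-C + C ^ 3)) ^ m := by
                apply pow_le_pow_left₀ (by positivity)
                exact tangent_upper h0.le h1
            _ = Real.exp (m * (-C + C ^ 3)) := by rw [Real.exp_nat_mul]
            _ ≤ _ := by
                apply Real.exp_le_exp.mpr
                linarith
        · have h2 : ((1 + 2 * (-(1 / 4)))⁻¹ : ℝ) = 2 := by norm_num
          rw [h2]
          have h3 : (2 : ℝ) ^ m ≤ Real.exp m := by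
            rw [show Real.exp m = Real.exp 1 ^ m by rw [← Real.exp_nat_mul]; simp]
            apply pow_le_pow_left₀ (by norm_num)
            linarith [Real.add_one_le_exp 1]
          -- `1 / (4 * a) = m / (2 * C)` exceeds `2 * m` because `C` is small; half of this gain
          -- pays for `2 ^ m ≤ exp m`.
          have h4 : Real.exp (-(1 / (4 * a))) ≤ Real.exp (-(2 * m)) := by
            apply Real.exp_le_exp.mpr
            rw [neg_le_neg_iff, ha, le_div_iff₀ (by positivity)]
            field_simp
            linarith
          calc _ ≤ Real.exp (-(2 * m)) * Real.exp m := by gcongr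
            _ = _ := by rw [← Real.exp_add]; congr 1; ring

theorem integral_sub_sub_le {α : Type*} [MeasurableSpace α] {μ : Measure α} {F G H K : α → ℝ}
    (hF : Integrable F μ) (hG : Integrable G μ) (hH : Integrable H μ) (hK : Integrable K μ)
    (h : ∀ x, F x - G x - H x ≤ K x) :
    ∫ x, F x ∂μ - ∫ x, G x ∂μ - ∫ x, H x ∂μ ≤ ∫ x, K x ∂μ := by
  rw [← integral_sub hF hG, ← integral_sub (f := fun x => F x - G x) (hF.sub hG) hH]
  exact integral_mono ((hF.sub hG).sub hH) hK h

/-- When `|y| > W`, one of the two exponentials has a positive exponent, so its term already cancels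
`E`. This is a two-sided Chernoff bound in pointwise form. -/
theorem window_pointwise {E ε W : ℝ} (hE : 0 ≤ E) (hε : 0 ≤ ε) (hW : 4 ≤ ε * W) (y : ℝ) :
    E - E * Real.exp (-4 - ε * y) - E * Real.exp (-4 + ε * y) ≤ if |y| ≤ W then E else 0 := by
  have p1 := mul_nonneg hE (Real.exp_pos (-4 - ε * y)).le
  have p2 := mul_nonneg hE (Real.exp_pos (-4 + ε * y)).le
  split_ifs with h
  · linarith
  · push Not at h
    rcases lt_abs.mp h with h | h
    · have h2 := mul_le_mul_of_nonneg_left h.le hε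
      have := mul_le_mul_of_nonneg_left
        (Real.one_le_exp (x := -4 + ε * y) (by linarith)) hE
      linarith
    · have h2 := mul_le_mul_of_nonneg_left h.le hε
      have := mul_le_mul_of_nonneg_left
        (Real.one_le_exp (x := -4 - ε * y) (by linarith)) hE
      linarith

/-- A tilted Gaussian vector has typical length: a lower bound for the exponential moment restricted
to a window. -/
theorem integral_window_lower {m : ℕ} {C : ℝ} (hm : 4 ≤ m) (h0 : 0 ≤ C) (h1 : C ≤ 1 / 16) :
    (1 - C) ^ m / 2 ≤ ∫ g, {g : Fin (2 * m) → ℝ |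
      |sqSum g - 2 * m * (1 - C)| ≤ 8 * Real.sqrt m}.indicator
        (fun g => Real.exp (-(C / (2 * (1 - C))) * sqSum g)) g ∂stdNormal (2 * m) := by
  have hm0 : (4 : ℝ) ≤ m := by exact_mod_cast hm
  have hC : 0 < 1 - C := by linarith
  have hs : 2 ≤ Real.sqrt m := Real.le_sqrt_of_sq_le (by norm_num; linarith)
  have hs2 : Real.sqrt m ^ 2 = m := Real.sq_sqrt (by linarith)
  set r := Real.sqrt m with hr
  set lam := C / (2 * (1 - C)) with hlam
  have hl : 1 + 2 * lam = (1 - C)⁻¹ := by rw [hlam]; field_simp; ring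
  -- The product of `ε` and the half-width `8 * r` of the window is `4`, as `window_pointwise`
  -- requires. Below, `u` is `ε` rescaled so that tilting by `±ε` turns `1 + 2 * lam` into `(1 ± u)
  -- / (1 - C)`.
  set ε := 1 / (2 * r) with hε
  have hε0 : 0 < ε := by positivity
  have hε1 : ε ≤ 1 / 4 := by
    rw [hε, div_le_div_iff₀ (by positivity) (by positivity)]; linarith
  set η := 2 * m * (1 - C) with hη
  set u := 2 * ε * (1 - C) with hu
  have hu0 : 0 < u := by positivity
  have hu1 : u ≤ 1 / 2 := by rw [hu]; nlinarith
  have hu2 : m * u ^ 2 ≤ 1 := by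
    rw [hu, hε, ← hs2]; field_simp; nlinarith
  have hur : 1 ≤ (1 - C)⁻¹ := (one_le_inv₀ hC).mpr (by linarith)
  -- one-sided tilts
  have tilt : ∀ v : ℝ, |v| = u → (1 + 2 * (lam + v / (2 * (1 - C))))⁻¹ ^ m *
      Real.exp (m * v) ≤ (1 - C) ^ m * Real.exp 2 := by
    intro v hv
    have e : 1 + 2 * (lam + v / (2 * (1 - C))) = (1 + v) / (1 - C) := by
      rw [hlam]; field_simp; ring
    have hv1 := abs_le.mp hv.le
    have h1v : 0 < 1 + v := by linarith
    rw [e, inv_div, div_eq_mul_inv, mul_pow, mul_assoc]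
    gcongr
    rw [inv_pow, ← Real.exp_log h1v, ← Real.exp_nat_mul, ← Real.exp_neg, ← Real.exp_add]
    apply Real.exp_le_exp.mpr
    have := le_log_one_sub_of_abs (y := -v) (by rw [abs_neg]; linarith)
    rw [show (1 : ℝ) - -v = 1 + v by ring] at this
    have hv2 : v ^ 2 = u ^ 2 := by rw [← hv, sq_abs]
    rw [show (-v) ^ 2 = u ^ 2 by rw [neg_sq, hv2]] at this
    nlinarith
  have hp : 0 < 1 + 2 * lam := by rw [hl]; positivity
  have hpp : ∀ v : ℝ, |v| = u → 0 < 1 + 2 * (lam + v / (2 * (1 - C))) := by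
    intro v hv
    have e : 1 + 2 * (lam + v / (2 * (1 - C))) = (1 + v) / (1 - C) := by
      rw [hlam]; field_simp; ring
    rw [e]
    have hv1 := abs_le.mp hv.le
    have : 0 < 1 + v := by linarith
    positivity
  have key : ∀ g : Fin (2 * m) → ℝ, Real.exp (-lam * sqSum g) -
      Real.exp (-4) * (Real.exp (m * u) * Real.exp (-(lam + u / (2 * (1 - C))) * sqSum g)) -
      Real.exp (-4) * (Real.exp (m * -u) * Real.exp (-(lam + -u / (2 * (1 - C))) * sqSum g)) ≤
      {g : Fin (2 * m) → ℝ | |sqSum g - η| ≤ 8 * r}.indicator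
        (fun g => Real.exp (-lam * sqSum g)) g := by
    intro g
    simp only [Set.indicator_apply, Set.mem_ofPred_eq]
    have e1 : u / (2 * (1 - C)) = ε := by rw [hu]; field_simp
    have e2 : -u / (2 * (1 - C)) = -ε := by rw [neg_div, e1]
    have e3 : (m : ℝ) * u = ε * η := by rw [hu, hη]; ring
    rw [e1, e2, mul_neg, e3]
    have q1 : Real.exp (-4) * (Real.exp (ε * η) * Real.exp (-(lam + ε) * sqSum g)) =
        Real.exp (-lam * sqSum g) * Real.exp (-4 - ε * (sqSum g - η)) := by
      rw [← Real.exp_add, ← Real.exp_add, ← Real.exp_add]; congr 1; ring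
    have q2 : Real.exp (-4) * (Real.exp (-(ε * η)) * Real.exp (-(lam + -ε) * sqSum g)) =
        Real.exp (-lam * sqSum g) * Real.exp (-4 + ε * (sqSum g - η)) := by
      rw [← Real.exp_add, ← Real.exp_add, ← Real.exp_add]; congr 1; ring
    rw [q1, q2]
    exact window_pointwise (Real.exp_pos _).le hε0.le (by rw [hε]; field_simp; norm_num) _
  have i0 := integrable_exp_neg_mul_sqSum (t := 2 * m) hp
  have hau : |u| = u := abs_of_pos hu0
  have hau' : |-u| = u := by rw [abs_neg, hau]
  have i1 := ((integrable_exp_neg_mul_sqSum (t := 2 * m) (hpp u hau)).const_mul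
    (Real.exp (m * u))).const_mul (Real.exp (-4))
  have i2 := ((integrable_exp_neg_mul_sqSum (t := 2 * m) (hpp (-u) hau')).const_mul
    (Real.exp (m * -u))).const_mul (Real.exp (-4))
  have hS : MeasurableSet {g : Fin (2 * m) → ℝ | |sqSum g - η| ≤ 8 * r} :=
    measurableSet_le (by fun_prop) (by fun_prop)
  have J1 : ∫ g, Real.exp (-4) * (Real.exp (m * u) *
      Real.exp (-(lam + u / (2 * (1 - C))) * sqSum g)) ∂stdNormal (2 * m) = Real.exp (-4) *
      (Real.exp (m * u) * (1 + 2 * (lam + u / (2 * (1 - C))))⁻¹ ^ m) := by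
    rw [integral_const_mul, integral_const_mul, integral_exp_neg_mul_sqSum m (hpp u hau)]
  have J2 : ∫ g, Real.exp (-4) * (Real.exp (m * -u) *
      Real.exp (-(lam + -u / (2 * (1 - C))) * sqSum g)) ∂stdNormal (2 * m) = Real.exp (-4) *
      (Real.exp (m * -u) * (1 + 2 * (lam + -u / (2 * (1 - C))))⁻¹ ^ m) := by
    rw [integral_const_mul, integral_const_mul, integral_exp_neg_mul_sqSum m (hpp (-u) hau')]
  have J0 := integral_exp_neg_mul_sqSum m hp
  rw [hl, inv_inv] at J0
  have main := integral_sub_sub_le i0 i1 i2 (i0.indicator hS) key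
  rw [J0, J1, J2] at main
  refine le_trans ?_ main
  have t1 := tilt u hau
  have t2 := tilt (-u) hau'
  have hcm : 0 < (1 - C) ^ m := by positivity
  -- Each of the two tails takes at most a quarter of the total mass `(1 - C) ^ m`, which leaves
  -- half of it in the window.
  have h4 : Real.exp (-4) * Real.exp 2 ≤ 1 / 4 := by
    rw [← Real.exp_add, show (-4 + 2 : ℝ) = -2 by norm_num, Real.exp_neg, one_div]
    have h2 : (2 : ℝ) ≤ Real.exp 1 := by linarith [Real.add_one_le_exp 1]
    refine inv_anti₀ (by norm_num) ?_
    rw [show (2 : ℝ) = 1 + 1 by norm_num, Real.exp_add]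
    nlinarith
  generalize (1 + 2 * (lam + u / (2 * (1 - C))))⁻¹ ^ m = X1 at *
  generalize (1 + 2 * (lam + -u / (2 * (1 - C))))⁻¹ ^ m = X2 at *
  generalize (1 - C) ^ m = Z at *
  have p3 := Real.exp_pos (-4)
  have s1 := mul_le_mul_of_nonneg_left t1 p3.le
  have s2 := mul_le_mul_of_nonneg_left t2 p3.le
  have s3 := mul_le_mul_of_nonneg_left h4 hcm.le
  linarith

/-- The exponent per unit of `m` at squared length `2 * m * (1 - C)`: `log (1 - C) + C` comes from
the Gaussian, `log (1 - C + C ^ 2)` from the lens. The quadratic terms cancel, and only a cubic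
error remains. -/
theorem tangent_lower {C : ℝ} (h0 : 0 ≤ C) (h1 : C ≤ 1 / 16) :
    -C - 20 * C ^ 3 ≤ Real.log (1 - C) + Real.log (1 - C + C ^ 2) + C := by
  have hA : 0 < 1 - C + C ^ 2 := by nlinarith
  rw [← Real.log_mul (by linarith) hA.ne']
  have h := le_log_one_sub (y := 2 * C - 2 * C ^ 2 + C ^ 3) (by nlinarith [pow_nonneg h0 3])
    (by nlinarith [pow_nonneg h0 3])
  rw [show 1 - (2 * C - 2 * C ^ 2 + C ^ 3) = (1 - C) * (1 - C + C ^ 2) by ring] at h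
  have h3 := pow_nonneg h0 3
  have hy : (2 * C - 2 * C ^ 2 + C ^ 3) ^ 3 ≤ (2 * C) ^ 3 := by
    apply pow_le_pow_left₀ (by nlinarith)
    nlinarith
  have h4 : C ^ 4 ≤ C ^ 3 := by nlinarith
  have h5 : C ^ 5 ≤ C ^ 3 := by nlinarith [pow_nonneg h0 4]
  have h6 : C ^ 6 ≤ C ^ 3 := by nlinarith [pow_nonneg h0 5, pow_nonneg h0 4]
  nlinarith [pow_nonneg h0 5, pow_nonneg h0 4, pow_nonneg h0 6]

/-- On the typical window the lens volume is, up to a constant, an exponential of the length. -/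
theorem lens_ge_of_window {m : ℕ} {C y : ℝ} (hm : 4096 ≤ m) (h0 : 0 ≤ C) (h1 : C ≤ 1 / 16)
    (h3 : m * C ^ 3 ≤ 1) (hy : |y - 2 * m * (1 - C)| ≤ 8 * Real.sqrt m) :
    C / (2 * m) * y ≤ 1 / 2 ∧
      Real.exp (-(m * C) - 25) ≤ (1 - C) ^ m * (Real.exp (C / (2 * (1 - C)) * y) *
        (1 - C / (2 * m) * y) ^ m) := by
  have hm0 : (4096 : ℝ) ≤ m := by exact_mod_cast hm
  have hC : 0 < 1 - C := by linarith
  have hA : 0 < 1 - C + C ^ 2 := by nlinarith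
  have hs : 64 ≤ Real.sqrt m := Real.le_sqrt_of_sq_le (by norm_num; linarith)
  have hs2 : Real.sqrt m ^ 2 = m := Real.sq_sqrt (by linarith)
  set r := Real.sqrt m with hr
  -- `δ` is the deviation of the squared length in units of `2 * m`; the window makes `m * δ ^ 2`
  -- bounded.
  obtain ⟨δ, hδ⟩ : ∃ δ, y = 2 * m * (1 - C) + 2 * m * δ :=
    ⟨(y - 2 * m * (1 - C)) / (2 * m), by field_simp; ring⟩
  have hδ1 : |δ| * r ≤ 4 := by
    rw [hδ, add_sub_cancel_left, abs_mul, abs_of_pos (by linarith)] at hy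
    have : (|δ| * r) * r ≤ 4 * r := by
      have : |δ| * r * r = |δ| * m := by rw [← hs2]; ring
      linarith
    exact le_of_mul_le_mul_right this (by linarith)
  have hδ2 : m * δ ^ 2 ≤ 16 := by
    rw [← hs2, ← sq_abs δ]
    nlinarith [mul_nonneg (abs_nonneg δ) (by linarith : (0 : ℝ) ≤ r)]
  have hδ3 : |δ| ≤ 1 / 16 := by
    nlinarith [abs_nonneg δ]
  have hδ4 := abs_le.mp hδ3
  have ha : C / (2 * m) * y = C * (1 - C) + C * δ := by rw [hδ]; field_simp
  have hl : C / (2 * (1 - C)) * y = m * (C + C * δ / (1 - C)) := by rw [hδ]; field_simp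
  have ha2 : C / (2 * m) * y ≤ 1 / 2 := by rw [ha]; nlinarith
  refine ⟨ha2, ?_⟩
  have hp : 0 < 1 - C / (2 * m) * y := by linarith
  rw [← Real.exp_log hp, ← Real.exp_log hC, ← Real.exp_nat_mul, ← Real.exp_nat_mul,
    Real.exp_log hC, ← Real.exp_add, ← Real.exp_add]
  apply Real.exp_le_exp.mpr
  set w := C * δ / (1 - C + C ^ 2) with hw
  have hfac : 1 - C / (2 * m) * y = (1 - C + C ^ 2) * (1 - w) := by rw [ha, hw]; field_simp; ring
  have hA2 : 1 / 2 ≤ 1 - C + C ^ 2 := by nlinarith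
  have hw1 : |w| ≤ 2 * C * |δ| := by
    rw [hw, abs_div, abs_of_pos hA, abs_mul, abs_of_nonneg h0, div_le_iff₀ hA]
    nlinarith [mul_nonneg h0 (abs_nonneg δ)]
  have hw2 : |w| ≤ 1 / 2 := by nlinarith [abs_nonneg δ]
  have hw3 := le_log_one_sub_of_abs hw2
  have hw4 : 0 < 1 - w := by linarith [(abs_le.mp hw2).2]
  rw [hfac, Real.log_mul hA.ne' hw4.ne', hl]
  have ht := tangent_lower h0 h1
  -- The terms linear in `δ` from the tilt and from the lens have coefficients `C / (1 - C)` and `C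
  -- / (1 - C + C ^ 2)`. Their difference is of order `C ^ 3`, so `m * C ^ 3 ≤ 1` controls it.
  have hdiff : -(1 / 8 : ℝ) ≤ m * (C * δ / (1 - C) - w) := by
    have e : C * δ / (1 - C) - w = C ^ 3 * (δ / ((1 - C) * (1 - C + C ^ 2))) := by
      rw [hw]; field_simp; ring
    have hb : |δ / ((1 - C) * (1 - C + C ^ 2))| ≤ 1 / 8 := by
      rw [abs_div, abs_of_pos (mul_pos hC hA), div_le_iff₀ (mul_pos hC hA)]
      have : 1 / 2 ≤ (1 - C) * (1 - C + C ^ 2) := by nlinarith [pow_nonneg h0 3]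
      linarith
    have hb2 : |m * (C ^ 3 * (δ / ((1 - C) * (1 - C + C ^ 2))))| ≤ 1 / 8 := by
      rw [← mul_assoc, abs_mul, abs_of_nonneg (by positivity)]
      linarith [mul_le_mul h3 hb (abs_nonneg _) zero_le_one]
    rw [e]; exact (abs_le.mp hb2).1
  have hww : m * w ^ 2 ≤ 1 := by
    have : w ^ 2 ≤ 4 * C ^ 2 * δ ^ 2 := by
      rw [← sq_abs w, ← sq_abs δ]
      rw [show 4 * C ^ 2 * |δ| ^ 2 = (2 * C * |δ|) ^ 2 by ring]
      exact pow_le_pow_left₀ (abs_nonneg w) hw1 2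
    have h4 : m * w ^ 2 ≤ m * (4 * C ^ 2 * δ ^ 2) := by gcongr
    have h5 : C ^ 2 ≤ (1 / 16) ^ 2 := pow_le_pow_left₀ h0 h1 2
    have h6 : C ^ 2 * (m * δ ^ 2) ≤ (1 / 16) ^ 2 * 16 :=
      mul_le_mul h5 hδ2 (by positivity) (by norm_num)
    linarith
  have hmm : (0 : ℝ) ≤ m := by linarith
  have e1 := mul_le_mul_of_nonneg_left hw3 hmm
  have e2 := mul_le_mul_of_nonneg_left ht hmm
  linarith

/-- This shows that the loss of `1/m` in the lens volume costs only a constant factor after raising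
to the power `m`. -/
theorem exp_le_one_sub_pow {m : ℕ} (hm : 4096 ≤ m) : Real.exp (-3) ≤ (1 - 2 / m : ℝ) ^ m := by
  have hm0 : (4096 : ℝ) ≤ m := by exact_mod_cast hm
  have hp : (2 : ℝ) / m ≤ 1 / 2048 := by
    rw [div_le_div_iff₀ (by linarith) (by norm_num)]; linarith
  have hp0 : 0 ≤ (2 : ℝ) / m := by positivity
  have h := le_log_one_sub_of_abs (y := 2 / m) (by rw [abs_of_nonneg hp0]; linarith)
  have h1 : 0 < 1 - (2 : ℝ) / m := by linarith
  rw [← Real.exp_log h1, ← Real.exp_nat_mul]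
  apply Real.exp_le_exp.mpr
  have e : (m : ℝ) * (2 / m) = 2 := by field_simp
  have e2 := mul_le_mul_of_nonneg_left h (by linarith : (0 : ℝ) ≤ m)
  have e3 : (m : ℝ) * (-(2 / m) - 2 * (2 / m) ^ 2) = -2 - 4 * (2 / m) := by
    field_simp; norm_num
  rw [e3] at e2
  linarith

/-- Lower bound for the average over a Gaussian vector of the relative volume of a lens. -/
theorem integral_lens_lower {m : ℕ} {C : ℝ} (hm : 4096 ≤ m) (h0 : 0 ≤ C) (h1 : C ≤ 1 / 16)
    (h3 : m * C ^ 3 ≤ 1) (f : (Fin (2 * m) → ℝ) → ℝ) (hf : Integrable f (stdNormal (2 * m)))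
    (hf0 : ∀ g, 0 ≤ f g)
    (hfl : ∀ g, C / (2 * m) * sqSum g ≤ 1 / 2 →
      (1 - C / (2 * m) * sqSum g - 1 / m) ^ m / (4 * m) ≤ f g) :
    Real.exp (-(m * C) - 31) / m ≤ ∫ g, f g ∂stdNormal (2 * m) := by
  have hm0 : (4096 : ℝ) ≤ m := by exact_mod_cast hm
  have hC : 0 < 1 - C := by linarith
  have hw := integral_window_lower (m := m) (C := C) (by omega) h0 h1
  set S := {g : Fin (2 * m) → ℝ | |sqSum g - 2 * m * (1 - C)| ≤ 8 * Real.sqrt m} with hS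
  -- On the window, `f` is at least `c` times the exponential tilt. The denominator `(1 - C) ^ m`
  -- will cancel against the tilted mass of the window; `exp (-3) / (4 * m)` covers the shift by
  -- `1/m` and the denominator in `hfl`.
  set c := Real.exp (-(m * C) - 25) / (1 - C) ^ m * (Real.exp (-3) / (4 * m)) with hc
  have hcpos : 0 ≤ c := by positivity
  have hlam : 0 < 1 + 2 * (C / (2 * (1 - C))) := by positivity
  have i0 := integrable_exp_neg_mul_sqSum (t := 2 * m) hlam
  have hSm : MeasurableSet S := measurableSet_le (by fun_prop) (by fun_prop)
  have key : ∀ g, c * S.indicator (fun g => Real.exp (-(C / (2 * (1 - C))) * sqSum g)) g ≤ f g := by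
    intro g
    by_cases hg : g ∈ S
    · rw [Set.indicator_of_mem hg]
      obtain ⟨ha, hb⟩ := lens_ge_of_window hm h0 h1 h3 hg
      refine le_trans ?_ (hfl g ha)
      -- When the subtracted term is at most `1/2`, reducing the base by the factor `1 - 2/m` lowers
      -- it by at least `1/m`; this separates the shift from the lens volume.
      have h2 : (1 - 2 / m : ℝ) * (1 - C / (2 * m) * sqSum g) ≤
          1 - C / (2 * m) * sqSum g - 1 / m := by
        have : (2 : ℝ) / m = 2 * (1 / m) := by ring
        have hp : (0 : ℝ) < 1 / m := by positivity
        rw [this]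
        nlinarith
      have hp1 : (0 : ℝ) ≤ 1 - 2 / m := by
        rw [sub_nonneg, div_le_one (by linarith)]; linarith
      have h4 := pow_le_pow_left₀ (mul_nonneg hp1 (by linarith)) h2 m
      rw [mul_pow] at h4
      have h5 := exp_le_one_sub_pow hm
      have h6 : 0 ≤ (1 - C / (2 * m) * sqSum g) ^ m := by
        apply pow_nonneg; linarith
      have h7 : Real.exp (-(m * C) - 25) / (1 - C) ^ m *
          Real.exp (-(C / (2 * (1 - C))) * sqSum g) ≤ (1 - C / (2 * m) * sqSum g) ^ m := by
        rw [neg_mul, Real.exp_neg, div_mul_eq_mul_div, div_le_iff₀ (by positivity),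
          mul_inv_le_iff₀ (by positivity)]
        linarith
      calc _ = (Real.exp (-(m * C) - 25) / (1 - C) ^ m *
          Real.exp (-(C / (2 * (1 - C))) * sqSum g)) * Real.exp (-3) / (4 * m) := by
            rw [hc]; ring
        _ ≤ (1 - C / (2 * m) * sqSum g) ^ m * Real.exp (-3) / (4 * m) := by gcongr
        _ ≤ _ := by
            gcongr
            refine le_trans ?_ h4
            rw [mul_comm]
            gcongr
    · rw [Set.indicator_of_notMem hg, mul_zero]; exact hf0 g
  have := integral_mono ((i0.indicator hSm).const_mul c) hf key
  rw [integral_const_mul] at this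
  refine le_trans ?_ (le_trans (mul_le_mul_of_nonneg_left hw hcpos) this)
  have e : c * ((1 - C) ^ m / 2) = Real.exp (-(m * C) - 25) * Real.exp (-3) / 8 / m := by
    rw [hc]; field_simp; norm_num
  rw [e]
  gcongr
  rw [le_div_iff₀ (by norm_num), ← Real.exp_add,
    show -(m * C) - 25 + -3 = (-(m * C) - 31) + 3 by ring, Real.exp_add]
  gcongr
  have h2 : (2 : ℝ) ≤ Real.exp 1 := by linarith [Real.add_one_le_exp 1]
  calc (8 : ℝ) = 2 ^ 3 := by norm_num
    _ ≤ Real.exp 1 ^ 3 := by gcongr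
    _ = Real.exp 3 := by rw [← Real.exp_nat_mul]; norm_num

/-! ### Volumes of lenses -/

theorem norm_sub_half_sq {E : Type*} [NormedAddCommGroup E] [InnerProductSpace ℝ E] (y d : E) :
    ‖y - (1 / 2 : ℝ) • d‖ ^ 2 = ‖y‖ ^ 2 - inner ℝ d y + ‖d‖ ^ 2 / 4 := by
  rw [norm_sub_sq_real, inner_smul_right, norm_smul, real_inner_comm]
  norm_num
  ring

theorem norm_add_half_sq {E : Type*} [NormedAddCommGroup E] [InnerProductSpace ℝ E] (y d : E) :
    ‖y + (1 / 2 : ℝ) • d‖ ^ 2 = ‖y‖ ^ 2 + inner ℝ d y + ‖d‖ ^ 2 / 4 := by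
  rw [norm_add_sq_real, inner_smul_right, norm_smul, real_inner_comm]
  norm_num
  ring

section Lens

variable {E : Type*} [NormedAddCommGroup E] [InnerProductSpace ℝ E] [FiniteDimensional ℝ E]
  [MeasurableSpace E] [BorelSpace E] (μ : Measure E) [μ.IsAddHaarMeasure]

/-- Among the parallel slabs of a ball, the central one is the largest. -/
theorem measure_closedBall_le_slab {e : E} (he : ‖e‖ = 1) {lam rho : ℝ} (hl : 0 < lam) {n : ℕ}
    (hn : 1 ≤ n) (hrho : rho ≤ n * lam) :
    μ.real (Metric.closedBall 0 rho) ≤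
      2 * n * μ.real {y : E | ‖y‖ ≤ rho ∧ |inner ℝ e y| ≤ lam} := by
  set S := {y : E | ‖y‖ ≤ rho ∧ |inner ℝ e y| ≤ lam} with hS
  have hSfin : μ S ≠ ⊤ := by
    refine ne_top_of_le_ne_top (measure_closedBall_lt_top (μ := μ) (x := (0 : E)) (r := rho)).ne
      (measure_mono fun y hy => ?_)
    simpa using hy.1
  have shift : ∀ c : E, μ.real ((fun y => c + y) ⁻¹' S) = μ.real S := fun c => by
    rw [measureReal_def, measure_preimage_add, measureReal_def]
  -- The inner product with `e` is at most `n * lam` in absolute value, so the ball splits into `n`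
  -- slices of width `lam` on each side. Moving slice `j` by `j * lam` towards the center does not
  -- increase norms and lands in the central slab.
  have cov : Metric.closedBall (0 : E) rho ⊆ ⋃ j ∈ Finset.range n,
      ((fun y => (-(j * lam)) • e + y) ⁻¹' S ∪ (fun y => (j * lam) • e + y) ⁻¹' S) := by
    -- reduce a point to the central slab
    have red : ∀ (y : E) (c : ℝ), ‖y‖ ≤ rho → 0 ≤ c → ∀ σ : ℝ, σ ^ 2 = 1 →
        c ≤ -σ * inner ℝ e y → -σ * inner ℝ e y ≤ c + lam → (σ * c) • e + y ∈ S := by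
      intro y c hy hc σ hσ h1 h2
      have hin : inner ℝ e ((σ * c) • e + y) = σ * c + inner ℝ e y := by
        rw [inner_add_right, inner_smul_right, real_inner_self_eq_norm_sq, he]; ring
      constructor
      · refine le_trans ?_ hy
        apply le_of_sq_le_sq _ (norm_nonneg y)
        rw [norm_add_sq_real, norm_smul, he, mul_one, inner_smul_left, Real.norm_eq_abs, sq_abs,
          mul_pow, hσ]
        simp only [conj_trivial]
        nlinarith
      · rw [hin]
        have : |σ * c + inner ℝ e y| ^ 2 ≤ lam ^ 2 := by
          rw [sq_abs]
          have : (σ * c + inner ℝ e y) ^ 2 = (c - (-σ * inner ℝ e y)) ^ 2 := by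
            have : (σ * c + inner ℝ e y) ^ 2 =
              σ ^ 2 * c ^ 2 + 2 * c * (σ * inner ℝ e y) + inner ℝ e y ^ 2 := by ring
            rw [this, hσ]
            have : (c - (-σ * inner ℝ e y)) ^ 2 =
              c ^ 2 + 2 * c * (σ * inner ℝ e y) + σ ^ 2 * inner ℝ e y ^ 2 := by ring
            rw [this, hσ]; ring
          rw [this]
          nlinarith
        exact le_of_sq_le_sq this hl.le
    have idx : ∀ s : ℝ, 0 ≤ s → s ≤ rho → ∃ j < n, (j * lam : ℝ) ≤ s ∧ s ≤ j * lam + lam := by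
      intro s hs hs2
      rcases lt_or_ge ⌊s / lam⌋₊ n with h | h
      · refine ⟨⌊s / lam⌋₊, h, ?_, ?_⟩
        · have := Nat.floor_le (div_nonneg hs hl.le)
          rwa [le_div_iff₀ hl] at this
        · have := (Nat.lt_floor_add_one (s / lam)).le
          rw [div_le_iff₀ hl] at this
          linarith
      -- Only the endpoint `s = n * lam` remains; it belongs to the last slice.
      · refine ⟨n - 1, by omega, ?_, ?_⟩
        · have : (n : ℝ) ≤ s / lam := le_trans (by exact_mod_cast h) (Nat.floor_le (by positivity))
          rw [le_div_iff₀ hl] at this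
          rw [Nat.cast_sub hn]; push_cast; nlinarith
        · rw [Nat.cast_sub hn]; push_cast; nlinarith
    intro y hy
    rw [mem_closedBall_zero_iff] at hy
    have hin : |inner ℝ e y| ≤ rho := by
      have := abs_real_inner_le_norm e y
      rw [he, one_mul] at this; linarith
    have hin2 := abs_le.mp hin
    simp only [Set.mem_iUnion, Finset.mem_range, Set.mem_union, Set.mem_preimage]
    rcases le_total 0 (inner ℝ e y) with h | h
    · obtain ⟨j, hj, h1, h2⟩ := idx _ h hin2.2
      refine ⟨j, hj, Or.inl ?_⟩
      have := red y (j * lam) hy (by positivity) (-1) (by norm_num) (by linarith) (by linarith)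
      rwa [neg_one_mul] at this
    · obtain ⟨j, hj, h1, h2⟩ := idx (-inner ℝ e y) (by linarith) (by linarith)
      refine ⟨j, hj, Or.inr ?_⟩
      have := red y (j * lam) hy (by positivity) 1 (by norm_num) (by linarith) (by linarith)
      rwa [one_mul] at this
  have hfin : ∀ c : E, μ ((fun y => c + y) ⁻¹' S) ≠ ⊤ := fun c => by
    rwa [measure_preimage_add]
  calc μ.real (Metric.closedBall 0 rho) ≤ _ := measureReal_mono cov (by
        refine (measure_biUnion_lt_top (Finset.range n).finite_toSet fun j _ => ?_).ne
        exact measure_union_lt_top (hfin _).lt_top (hfin _).lt_top)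
    _ ≤ ∑ j ∈ Finset.range n, μ.real ((fun y => (-(j * lam)) • e + y) ⁻¹' S ∪
          (fun y => (j * lam) • e + y) ⁻¹' S) := measureReal_biUnion_finset_le _ _
    _ ≤ ∑ j ∈ Finset.range n, (μ.real S + μ.real S) := by
        gcongr with j
        refine (measureReal_union_le _ _).trans ?_
        rw [shift, shift]
    _ = _ := by rw [Finset.sum_const, Finset.card_range, nsmul_eq_mul]; ring

/-- Seen from the midpoint of the two centers, the squared distances to them are `‖y‖ ^ 2 ± inner ℝ
d y + ‖d‖ ^ 2 / 4`. Hence the lens contains a translate of the part of a ball where the inner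
product is small, and this central slab has a share of at least `1 / (2 * n)` of the ball. -/
theorem measure_lens_ge {d : E} {w rho lam : ℝ} (hw : 0 ≤ w) (hl : 0 < lam) {n : ℕ} (hn : 1 ≤ n)
    (hrho : rho ≤ n * lam) (h : rho ^ 2 + ‖d‖ ^ 2 / 4 + ‖d‖ * lam ≤ w ^ 2) :
    μ.real (Metric.closedBall 0 rho) ≤ 2 * n * μ.real {y : E | ‖y‖ ≤ w ∧ ‖y + d‖ ≤ w} := by
  have hLfin : μ {y : E | ‖y‖ ≤ w ∧ ‖y + d‖ ≤ w} ≠ ⊤ := by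
    refine ne_top_of_le_ne_top (measure_closedBall_lt_top (μ := μ) (x := (0 : E)) (r := w)).ne
      (measure_mono fun y hy => ?_)
    simpa using hy.1
  have shift : μ.real ((fun y => (-(1 / 2 : ℝ)) • d + y) ⁻¹' {y : E | ‖y‖ ≤ w ∧ ‖y + d‖ ≤ w}) =
      μ.real {y : E | ‖y‖ ≤ w ∧ ‖y + d‖ ≤ w} := by
    rw [measureReal_def, measure_preimage_add, measureReal_def]
  have key : ∀ y : E, ‖y‖ ≤ rho → |inner ℝ d y| ≤ ‖d‖ * lam →
      (-(1 / 2 : ℝ)) • d + y ∈ {y : E | ‖y‖ ≤ w ∧ ‖y + d‖ ≤ w} := by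
    intro y hy hi
    have hi2 := abs_le.mp hi
    have hy2 : ‖y‖ ^ 2 ≤ rho ^ 2 := pow_le_pow_left₀ (norm_nonneg y) hy 2
    have e1 : (-(1 / 2 : ℝ)) • d + y = y - (1 / 2 : ℝ) • d := by module
    have e2 : (-(1 / 2 : ℝ)) • d + y + d = y + (1 / 2 : ℝ) • d := by module
    constructor
    · rw [e1]
      apply le_of_sq_le_sq _ hw
      rw [norm_sub_half_sq]; linarith
    · rw [e2]
      apply le_of_sq_le_sq _ hw
      rw [norm_add_half_sq]; linarith
  have hn1 : (1 : ℝ) ≤ n := by exact_mod_cast hn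
  -- Without a direction there is no slab; in this case the whole ball fits into the lens.
  by_cases hd : d = 0
  · have hsub : μ.real (Metric.closedBall 0 rho) ≤ μ.real {y : E | ‖y‖ ≤ w ∧ ‖y + d‖ ≤ w} := by
      rw [← shift]
      refine measureReal_mono (fun y hy => key y (by simpa using hy) (by simp [hd])) ?_
      rwa [measure_preimage_add]
    have : 0 ≤ μ.real {y : E | ‖y‖ ≤ w ∧ ‖y + d‖ ≤ w} := measureReal_nonneg
    nlinarith
  · have hd0 : 0 < ‖d‖ := norm_pos_iff.mpr hd
    have he : ‖(‖d‖⁻¹ : ℝ) • d‖ = 1 := by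
      rw [norm_smul, norm_inv, norm_norm]; field_simp
    refine (measure_closedBall_le_slab μ he hl hn hrho).trans ?_
    rw [← shift]
    gcongr
    · rwa [measure_preimage_add]
    · rintro y ⟨hy, hi⟩
      refine key y hy ?_
      rw [inner_smul_left, abs_mul] at hi
      simp only [conj_trivial, abs_inv, abs_norm] at hi
      rwa [inv_mul_le_iff₀ hd0] at hi

/-- Averaging the two squared distances removes the inner product (the parallelogram law), so the
lens lies in a ball around the midpoint. -/
theorem measure_lens_le {d : E} {w rho : ℝ} (hrho : 0 ≤ rho) (h : w ^ 2 ≤ rho ^ 2 + ‖d‖ ^ 2 / 4) :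
    μ.real {y : E | ‖y‖ ≤ w ∧ ‖y + d‖ ≤ w} ≤ μ.real (Metric.closedBall 0 rho) := by
  have shift : μ.real ((fun y => (1 / 2 : ℝ) • d + y) ⁻¹' Metric.closedBall 0 rho) =
      μ.real (Metric.closedBall 0 rho) := by
    rw [measureReal_def, measure_preimage_add, measureReal_def]
  rw [← shift]
  refine measureReal_mono ?_ ?_
  · rintro y ⟨h1, h2⟩
    rw [Set.mem_preimage, mem_closedBall_zero_iff]
    apply le_of_sq_le_sq _ hrho
    rw [add_comm, norm_add_half_sq]
    have h3 : ‖y‖ ^ 2 ≤ w ^ 2 := pow_le_pow_left₀ (norm_nonneg _) h1 2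
    have h4 : ‖y + d‖ ^ 2 ≤ w ^ 2 := pow_le_pow_left₀ (norm_nonneg _) h2 2
    rw [norm_add_sq_real, real_inner_comm] at h4
    linarith
  · rw [measure_preimage_add]
    exact measure_closedBall_lt_top.ne

end Lens

/-! ### Balls on the torus -/

/-- The representative of `y` modulo `1` in `[-1/2, 1/2)`. -/
def wrap (y : ℝ) : ℝ := y - ⌊y + 1 / 2⌋

@[fun_prop]
theorem measurable_wrap : Measurable wrap := by unfold wrap; fun_prop

theorem wrap_mem (y : ℝ) : wrap y ∈ Set.Ico (-1 / 2 : ℝ) (1 / 2) := by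
  have h1 := Int.floor_le (y + 1 / 2)
  have h2 := Int.lt_floor_add_one (y + 1 / 2)
  unfold wrap
  constructor <;> linarith

theorem wrap_eq_self {y : ℝ} (h : y ∈ Set.Ico (-1 / 2 : ℝ) (1 / 2)) : wrap y = y := by
  have : ⌊y + 1 / 2⌋ = 0 := by
    rw [Int.floor_eq_zero_iff]
    constructor <;> linarith [h.1, h.2]
  rw [wrap, this]; simp

theorem wrap_add_int (y : ℝ) (n : ℤ) : wrap (y + n) = wrap y := by
  unfold wrap
  rw [show y + n + 1 / 2 = y + 1 / 2 + n by ring, Int.floor_add_intCast]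
  push_cast
  ring

theorem wrap_wrap_add (y d : ℝ) : wrap (wrap y + d) = wrap (y + d) := by
  have : wrap y + d = y + d + ((-⌊y + 1 / 2⌋ : ℤ) : ℝ) := by unfold wrap; push_cast; ring
  rw [this, wrap_add_int]

theorem sq_wrap_le (y : ℝ) : wrap y ^ 2 ≤ y ^ 2 := by
  by_cases h : y ∈ Set.Ico (-1 / 2 : ℝ) (1 / 2)
  · rw [wrap_eq_self h]
  · have h1 := wrap_mem y
    have h2 : wrap y ^ 2 ≤ (1 / 2) ^ 2 := by
      rw [sq_le_sq, abs_of_pos (by norm_num : (0 : ℝ) < 1 / 2), abs_le]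
      constructor <;> linarith [h1.1, h1.2]
    have h3 : (1 / 2 : ℝ) ^ 2 ≤ y ^ 2 := by
      rw [sq_le_sq, abs_of_pos (by norm_num : (0 : ℝ) < 1 / 2), le_abs]
      by_contra hc
      push Not at hc
      exact h ⟨by linarith [hc.2], hc.1⟩
    linarith

/-- The integer `y - wrap y` has absolute value below `3/4 + 1/4`, so it is zero. -/
theorem wrap_eq_self_of_sq_le {y : ℝ} (h : |y| < 3 / 4) (hw : wrap y ^ 2 ≤ 1 / 16) :
    wrap y = y := by
  have h1 : |wrap y| ≤ 1 / 4 := by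
    apply abs_le_of_sq_le_sq' _ (by norm_num) |> abs_le.mpr
    linarith
  have h2 : |((⌊y + 1 / 2⌋ : ℤ) : ℝ)| < 1 := by
    have : ((⌊y + 1 / 2⌋ : ℤ) : ℝ) = y - wrap y := by unfold wrap; ring
    rw [this]
    linarith [abs_sub y (wrap y)]
  have h3 : ⌊y + 1 / 2⌋ = 0 := by
    rw [← Int.abs_lt_one_iff]
    exact_mod_cast h2
  rw [wrap, h3]; simp

/-- Preimages under `wrap` of a difference are invariant under integer translations, so they have
the same measure in every fundamental domain. In the one around `z`, `wrap` acts as the identity and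
only the reflection `c ↦ z - c` remains. -/
theorem measurePreserving_wrap_sub (z : ℝ) :
    MeasurePreserving (fun c => wrap (z - c)) (volume.restrict (Set.Icc 0 1))
      (volume.restrict (Set.Ico (-1 / 2) (1 / 2))) := by
  refine ⟨by fun_prop, ?_⟩
  ext S hS
  have hm : Measurable fun c => wrap (z - c) := by fun_prop
  rw [Measure.map_apply hm hS, Measure.restrict_congr_set Ioc_ae_eq_Icc.symm,
    Measure.restrict_apply (hm hS), Measure.restrict_apply hS]
  have hinv : ∀ g : AddSubgroup.zmultiples (1 : ℝ), (fun x => g +ᵥ x) ⁻¹'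
      ((fun c => wrap (z - c)) ⁻¹' S) = (fun c => wrap (z - c)) ⁻¹' S := by
    rintro ⟨g, n, rfl⟩
    ext x
    simp only [Set.mem_preimage, vadd_eq_add, zsmul_eq_mul, mul_one,
      AddSubgroup.mk_vadd]
    rw [show z - (n + x) = z - x + ((-n : ℤ) : ℝ) by push_cast; ring, wrap_add_int]
  have h1 := (isAddFundamentalDomain_Ioc (T := 1) one_pos 0 volume).measure_set_eq
    (isAddFundamentalDomain_Ioc (T := 1) one_pos (z - 1 / 2) volume) (hm hS) hinv
  rw [zero_add] at h1
  rw [h1]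
  have h2 : (fun c => wrap (z - c)) ⁻¹' S ∩ Set.Ioc (z - 1 / 2) (z - 1 / 2 + 1) =
      (fun c => z - c) ⁻¹' (S ∩ Set.Ico (-1 / 2) (1 / 2)) := by
    ext c
    simp only [Set.mem_inter_iff, Set.mem_preimage, Set.mem_Ioc, Set.mem_Ico]
    have : (z - 1 / 2 < c ∧ c ≤ z - 1 / 2 + 1) ↔ (-1 / 2 ≤ z - c ∧ z - c < 1 / 2) := by
      constructor <;> rintro ⟨h, h'⟩ <;> constructor <;> linarith
    rw [this]
    constructor
    · rintro ⟨h, h'⟩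
      rw [wrap_eq_self h'] at h
      exact ⟨h, h'⟩
    · rintro ⟨h, h'⟩
      refine ⟨?_, h'⟩
      rwa [wrap_eq_self h']
  rw [h2, (Measure.measurePreserving_sub_left volume z).measure_preimage
    (hS.inter measurableSet_Ico).nullMeasurableSet]

/-- The law of a random center of a ball. -/
abbrev centerLaw (t : ℕ) : Measure (Fin t → ℝ) :=
  Measure.pi fun _ => (volume : Measure ℝ).restrict (Set.Icc 0 1)

instance : IsProbabilityMeasure ((volume : Measure ℝ).restrict (Set.Icc 0 1)) :=
  ⟨by simp⟩

/-- The set of centers whose ball of radius `1/4` on the torus contains `z`. -/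
def hitSet {t : ℕ} (z : Fin t → ℝ) : Set (Fin t → ℝ) :=
  {c | sqSum (fun j => wrap (z j - c j)) ≤ 1 / 16}

theorem measurableSet_hitSet {t : ℕ} (z : Fin t → ℝ) : MeasurableSet (hitSet z) := by
  refine measurableSet_le (measurable_sqSum.comp ?_) measurable_const
  exact measurable_pi_lambda _ fun j => by fun_prop

/-- The volume of the ball of radius `1/4`. -/
def ballVol (t : ℕ) : ℝ := (volume : Measure (Pt t)).real (Metric.closedBall 0 (1 / 4))

theorem sqSum_eq_norm {t : ℕ} (x : Pt t) : sqSum (fun j => x j) = ‖x‖ ^ 2 := by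
  rw [EuclideanSpace.real_norm_sq_eq, sqSum]

theorem sqSum_le_iff {t : ℕ} (x : Pt t) : sqSum (fun j => x j) ≤ 1 / 16 ↔ ‖x‖ ≤ 1 / 4 := by
  rw [sqSum_eq_norm, show (1 / 16 : ℝ) = (1 / 4) ^ 2 by norm_num,
    pow_le_pow_iff_left₀ (norm_nonneg _) (by norm_num) two_ne_zero]

/-- Transfer of events about a random center to volumes in Euclidean space. -/
theorem centerLaw_real_eq {t : ℕ} (z : Fin t → ℝ) {S : Set (Fin t → ℝ)} (hS : MeasurableSet S)
    (hS1 : ∀ y ∈ S, sqSum y ≤ 1 / 16) :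
    (centerLaw t).real ((fun c j => wrap (z j - c j)) ⁻¹' S) =
      (volume : Measure (Pt t)).real {x | (fun j => x j) ∈ S} := by
  have h1 := measurePreserving_pi
    (fun _ : Fin t => (volume : Measure ℝ).restrict (Set.Icc 0 1))
    (fun _ : Fin t => (volume : Measure ℝ).restrict (Set.Ico (-1 / 2) (1 / 2)))
    (f := fun j c => wrap (z j - c)) fun j => measurePreserving_wrap_sub (z j)
  rw [h1.measureReal_preimage hS.nullMeasurableSet, ← Measure.restrict_pi_pi, measureReal_def,
    Measure.restrict_apply hS, Set.inter_eq_left.mpr]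
  · rw [measureReal_def, ← volume_pi,
      ← (PiLp.volume_preserving_ofLp (Fin t)).measure_preimage hS.nullMeasurableSet]
    rfl
  -- Membership in the ball bounds every coordinate by `1/4`, so the restriction to the unit cell
  -- loses nothing.
  · intro y hy j _
    have h2 : y j ^ 2 ≤ 1 / 16 :=
      (Finset.single_le_sum (f := fun j => y j ^ 2) (fun _ _ => sq_nonneg _)
        (Finset.mem_univ j)).trans (hS1 y hy)
    have h3 := abs_le_of_sq_le_sq' (a := y j) (b := 1 / 4) (by linarith) (by norm_num)
    constructor <;> linarith [h3.1, h3.2]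

theorem centerLaw_hitSet {t : ℕ} (z : Fin t → ℝ) : (centerLaw t).real (hitSet z) = ballVol t := by
  have := centerLaw_real_eq z (S := {y | sqSum y ≤ 1 / 16})
    (measurableSet_le (by fun_prop) (by fun_prop)) (fun _ h => h)
  refine Eq.trans this ?_
  rw [ballVol]
  congr 1
  ext x
  simp only [Set.mem_ofPred_eq, mem_closedBall_zero_iff]
  exact sqSum_le_iff x

/-- The displacement from the random center to `z` is uniform on the torus, and the displacement to
`z'` is obtained by adding `z' - z`. Hence only the difference of the points matters. -/
theorem centerLaw_hitSet_inter {t : ℕ} (z z' : Fin t → ℝ) :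
    (centerLaw t).real (hitSet z ∩ hitSet z') = (volume : Measure (Pt t)).real
      {x | ‖x‖ ≤ 1 / 4 ∧ sqSum (fun j => wrap (x j + (z' j - z j))) ≤ 1 / 16} := by
  have hm : Measurable fun y : Fin t → ℝ => sqSum (fun j => wrap (y j + (z' j - z j))) := by
    refine measurable_sqSum.comp (measurable_pi_lambda _ fun j => by fun_prop)
  have := centerLaw_real_eq z (S := {y | sqSum y ≤ 1 / 16} ∩
      {y | sqSum (fun j => wrap (y j + (z' j - z j))) ≤ 1 / 16})
    ((measurableSet_le (by fun_prop) (by fun_prop)).inter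
      (measurableSet_le hm (by fun_prop))) (fun _ h => h.1)
  convert this using 2
  · ext c
    simp only [hitSet, Set.mem_inter_iff, Set.mem_ofPred_eq, Set.mem_preimage, wrap_wrap_add]
    have : ∀ j, z j - c j + (z' j - z j) = z' j - c j := fun j => by ring
    simp only [this]
  · ext x
    simp only [Set.mem_ofPred_eq, Set.mem_inter_iff]
    rw [← sqSum_le_iff]

theorem closedBall_real_eq {m : ℕ} {s : ℝ} (hs : 0 ≤ s) :
    (volume : Measure (Pt (2 * m))).real (Metric.closedBall 0 (Real.sqrt s)) =
      (16 * s) ^ m * ballVol (2 * m) := by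
  rw [ballVol, Measure.addHaar_real_closedBall _ _ (Real.sqrt_nonneg s),
    Measure.addHaar_real_closedBall _ _ (by norm_num), finrank_euclideanSpace_fin, pow_mul,
    Real.sq_sqrt hs, pow_mul, ← mul_assoc, ← mul_pow]
  congr 2
  ring

theorem sqSum_ofLp_add {t : ℕ} (x d : Pt t) : sqSum (fun j => x j + d j) = ‖x + d‖ ^ 2 := by
  rw [← sqSum_eq_norm]
  rfl

/-- Under the hypothesis the points are less than `1/2` apart. A displacement in the first ball then
moves to coordinates below `3/4`, and membership in the second ball excludes wrapping around: the
toroidal lens is a Euclidean one. -/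
theorem hitSet_inter_le {m : ℕ} (z z' : Fin (2 * m) → ℝ)
    (h : 4 * sqSum (fun j => z' j - z j) < 1) :
    (centerLaw (2 * m)).real (hitSet z ∩ hitSet z') ≤
      (1 - 4 * sqSum (fun j => z' j - z j)) ^ m * ballVol (2 * m) := by
  rw [centerLaw_hitSet_inter]
  set d : Pt (2 * m) := WithLp.toLp 2 (fun j => z' j - z j) with hd
  have hdj : ∀ j, z' j - z j = d j := fun j => rfl
  simp only [hdj] at *
  rw [sqSum_eq_norm] at *
  have hsub : {x : Pt (2 * m) | ‖x‖ ≤ 1 / 4 ∧ sqSum (fun j => wrap (x j + d j)) ≤ 1 / 16} ⊆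
      {x | ‖x‖ ≤ 1 / 4 ∧ ‖x + d‖ ≤ 1 / 4} := by
    rintro x ⟨h1, h2⟩
    refine ⟨h1, ?_⟩
    have hx : ∀ j, wrap (x j + d j) = x j + d j := by
      intro j
      have a1 : wrap (x j + d j) ^ 2 ≤ 1 / 16 :=
        (Finset.single_le_sum (f := fun j => wrap (x j + d j) ^ 2) (fun _ _ => sq_nonneg _)
          (Finset.mem_univ j)).trans h2
      have a2 : |x j| ≤ 1 / 4 := (PiLp.norm_apply_le x j).trans h1
      have a3 : |d j| < 1 / 2 := by
        refine lt_of_le_of_lt (PiLp.norm_apply_le d j) ?_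
        nlinarith [norm_nonneg d]
      refine wrap_eq_self_of_sq_le ?_ a1
      linarith [abs_add_le (x j) (d j)]
    simp only [hx, sqSum_ofLp_add] at h2
    apply le_of_sq_le_sq _ (by norm_num)
    linarith
  have hfin : (volume : Measure (Pt (2 * m))) {x | ‖x‖ ≤ 1 / 4 ∧ ‖x + d‖ ≤ 1 / 4} ≠ ⊤ := by
    refine ne_top_of_le_ne_top
      (measure_closedBall_lt_top (x := (0 : Pt (2 * m))) (r := 1 / 4)).ne
      (measure_mono fun y hy => ?_)
    simpa using hy.1
  have hs : 0 ≤ 1 / 16 - ‖d‖ ^ 2 / 4 := by linarith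
  refine (measureReal_mono hsub hfin).trans ((measure_lens_le volume
    (Real.sqrt_nonneg (1 / 16 - ‖d‖ ^ 2 / 4)) ?_).trans_eq ?_)
  · rw [Real.sq_sqrt hs]; linarith
  · rw [closedBall_real_eq hs]
    congr 2
    ring

/-- Wrapping only decreases distances, so the Euclidean lens lies in the toroidal one. -/
theorem le_hitSet_inter {m : ℕ} (hm : 2 ≤ m) (z z' : Fin (2 * m) → ℝ)
    (h : 4 * sqSum (fun j => z' j - z j) ≤ 1 / 2) :
    (1 - 4 * sqSum (fun j => z' j - z j) - 1 / m) ^ m * ballVol (2 * m) ≤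
      4 * m * (centerLaw (2 * m)).real (hitSet z ∩ hitSet z') := by
  have hm0 : (2 : ℝ) ≤ m := by exact_mod_cast hm
  rw [centerLaw_hitSet_inter]
  set d : Pt (2 * m) := WithLp.toLp 2 (fun j => z' j - z j) with hd
  have hdj : ∀ j, z' j - z j = d j := fun j => rfl
  simp only [hdj] at *
  rw [sqSum_eq_norm] at *
  have hsub : {x : Pt (2 * m) | ‖x‖ ≤ 1 / 4 ∧ ‖x + d‖ ≤ 1 / 4} ⊆
      {x | ‖x‖ ≤ 1 / 4 ∧ sqSum (fun j => wrap (x j + d j)) ≤ 1 / 16} := by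
    rintro x ⟨h1, h2⟩
    refine ⟨h1, ?_⟩
    refine (Finset.sum_le_sum fun j _ => sq_wrap_le (x j + d j)).trans ?_
    change sqSum (fun j => x j + d j) ≤ _
    rw [sqSum_ofLp_add]
    nlinarith [norm_nonneg (x + d)]
  have hfin : (volume : Measure (Pt (2 * m)))
      {x | ‖x‖ ≤ 1 / 4 ∧ sqSum (fun j => wrap (x j + d j)) ≤ 1 / 16} ≠ ⊤ := by
    refine ne_top_of_le_ne_top
      (measure_closedBall_lt_top (x := (0 : Pt (2 * m))) (r := 1 / 4)).ne
      (measure_mono fun y hy => ?_)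
    simpa using hy.1
  have hp : (1 : ℝ) / m ≤ 1 / 2 := by
    rw [div_le_div_iff₀ (by linarith) (by norm_num)]; linarith
  have hp0 : (0 : ℝ) < 1 / m := by positivity
  have hs : 0 ≤ (1 - 4 * ‖d‖ ^ 2 - 1 / m) / 16 := by linarith
  have hs2 : Real.sqrt ((1 - 4 * ‖d‖ ^ 2 - 1 / m) / 16) ≤ 1 / 4 := by
    apply Real.sqrt_le_iff.mpr
    constructor
    · norm_num
    · nlinarith [sq_nonneg ‖d‖]
  have hd2 : ‖d‖ ≤ 1 / 2 := by nlinarith [norm_nonneg d]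
  -- The half-width `1 / (8 * m)` is thin enough that `‖d‖ * lam` is paid for by the shift `1/m`,
  -- and `2 * m` such slices reach the radius `1/4`.
  have key := measure_lens_ge (volume : Measure (Pt (2 * m))) (d := d) (w := 1 / 4)
    (lam := 1 / (8 * m)) (n := 2 * m) (by norm_num) (by positivity) (by omega)
    (rho := Real.sqrt ((1 - 4 * ‖d‖ ^ 2 - 1 / m) / 16)) (by
      push_cast
      refine hs2.trans_eq ?_
      field_simp
      norm_num) (by
      rw [Real.sq_sqrt hs]
      have : ‖d‖ * (1 / (8 * m)) ≤ 1 / m / 16 := by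
        rw [show (1 : ℝ) / (8 * m) = 1 / m / 8 by field_simp]
        nlinarith
      nlinarith)
  rw [closedBall_real_eq hs] at key
  have e : 16 * ((1 - 4 * ‖d‖ ^ 2 - 1 / m) / 16) = 1 - 4 * ‖d‖ ^ 2 - 1 / m := by ring
  rw [e] at key
  refine key.trans ?_
  push_cast
  rw [show (2 : ℝ) * (2 * m) = 4 * m by ring]
  gcongr

/-- The ball contains the cube of half-side `b`, since the squared norm on it is at most `2 * m * b
^ 2 = 1/16`. -/
theorem ballVol_ge {m : ℕ} (hm : 1 ≤ m) : ((1 : ℝ) / (8 * m)) ^ m ≤ ballVol (2 * m) := by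
  have hm0 : (0 : ℝ) < m := by exact_mod_cast hm
  set b : ℝ := Real.sqrt (1 / (32 * m)) with hb
  have hb2 : b ^ 2 = 1 / (32 * m) := Real.sq_sqrt (by positivity)
  have hb0 : 0 ≤ b := Real.sqrt_nonneg _
  set Q : Set (Fin (2 * m) → ℝ) := Set.univ.pi fun _ => Set.Ico (-b) b with hQ
  have hQm : MeasurableSet Q := MeasurableSet.univ_pi fun _ => measurableSet_Ico
  have h1 : (volume : Measure (Fin (2 * m) → ℝ)).real Q = (1 / (8 * m)) ^ m := by
    rw [measureReal_def, hQ, Real.volume_pi_Ico, Finset.prod_const, Finset.card_univ,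
      Fintype.card_fin, ENNReal.toReal_pow, ENNReal.toReal_ofReal (by linarith), pow_mul,
      show (b - -b) ^ 2 = 4 * b ^ 2 by ring, hb2]
    congr 1
    field_simp
    norm_num
  rw [← h1, ← (PiLp.volume_preserving_ofLp (Fin (2 * m))).measureReal_preimage
    hQm.nullMeasurableSet, ballVol]
  refine measureReal_mono ?_ measure_closedBall_lt_top.ne
  intro x hx
  rw [mem_closedBall_zero_iff, ← sqSum_le_iff, sqSum]
  calc ∑ j, x j ^ 2 ≤ ∑ j : Fin (2 * m), b ^ 2 := by
        refine Finset.sum_le_sum fun j _ => ?_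
        have := hx j (Set.mem_univ j)
        rw [sq_le_sq, abs_of_nonneg hb0, abs_le]
        exact ⟨this.1, this.2.le⟩
    _ = 1 / 16 := by
        rw [Finset.sum_const, Finset.card_univ, Fintype.card_fin, hb2, nsmul_eq_mul]
        push_cast
        field_simp
        norm_num

theorem ballVol_pos {m : ℕ} (hm : 1 ≤ m) : 0 < ballVol (2 * m) := by
  have hm0 : (0 : ℝ) < m := by exact_mod_cast hm
  exact lt_of_lt_of_le (by positivity) (ballVol_ge hm)

/-! ### Last hits -/

section LastHit

variable {Ω : Type*} [MeasurableSpace Ω]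

/-- Two points with hitting sets `A` and `B` have the same last hit among the trials `c`. -/
def agree (A B : Set Ω) : (N : ℕ) → Set (Fin N → Ω)
  | 0 => Set.univ
  | N + 1 => {c | c (Fin.last N) ∈ A ∩ B ∨ c (Fin.last N) ∉ A ∪ B ∧ Fin.init c ∈ agree A B N}

theorem measurableSet_agree {A B : Set Ω} (hA : MeasurableSet A) (hB : MeasurableSet B) (N : ℕ) :
    MeasurableSet (agree A B N) := by
  induction N with
  | zero => exact MeasurableSet.univ
  | succ N ih =>
    have h1 : Measurable fun c : Fin (N + 1) → Ω => c (Fin.last N) := by fun_prop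
    have h2 : Measurable fun c : Fin (N + 1) → Ω => (Fin.init c : Fin N → Ω) :=
      measurable_pi_lambda _ fun j => by unfold Fin.init; fun_prop
    exact (h1 (hA.inter hB)).union ((h1 (hA.union hB)).compl.inter (h2 ih))

variable (μ : Measure Ω) [IsProbabilityMeasure μ]

/-- The last trial decides unless it misses both sets, and it is independent of the earlier trials.
-/
theorem measure_agree_succ {A B : Set Ω} (hA : MeasurableSet A) (hB : MeasurableSet B) (N : ℕ) :
    (Measure.pi fun _ : Fin (N + 1) => μ).real (agree A B (N + 1)) =
      μ.real (A ∩ B) + (1 - μ.real (A ∪ B)) * (Measure.pi fun _ : Fin N => μ).real (agree A B N) := by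
  have hmp := measurePreserving_piFinSuccAbove (fun _ : Fin (N + 1) => μ) (Fin.last N)
  have hset : agree A B (N + 1) = MeasurableEquiv.piFinSuccAbove (fun _ => Ω) (Fin.last N) ⁻¹'
      ((A ∩ B) ×ˢ Set.univ ∪ (A ∪ B)ᶜ ×ˢ agree A B N) := by
    ext c
    simp only [agree, Set.mem_ofPred_eq, Set.mem_preimage, Set.mem_union, Set.mem_prod,
      Set.mem_univ, and_true, Set.mem_compl_iff]
    have : (MeasurableEquiv.piFinSuccAbove (fun _ => Ω) (Fin.last N) c).2 = Fin.init c := by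
      ext j; simp [MeasurableEquiv.piFinSuccAbove, Fin.init]
    rw [this]
    rfl
  have hM := measurableSet_agree hA hB N
  have m1 := (hA.inter hB).prod (MeasurableSet.univ : MeasurableSet (Set.univ : Set (Fin N → Ω)))
  have m2 := (hA.union hB).compl.prod hM
  rw [hset, hmp.measureReal_preimage (m1.union m2).nullMeasurableSet,
    measureReal_union _ m2]
  · rw [measureReal_prod_prod, measureReal_prod_prod, probReal_compl_eq_one_sub (hA.union hB),
      probReal_univ, mul_one]
  · rw [Set.disjoint_left]
    rintro ⟨x, y⟩ ⟨h1, -⟩ ⟨h2, -⟩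
    exact h2 (Or.inl h1.1)

/-- The ratio of the measures of `A ∩ B` and `A ∪ B` is the fixed point of the recursion. The
starting value `1`, which counts two points without hits as agreeing, is above it, and the recursion
preserves this. -/
theorem le_measure_agree {A B : Set Ω} (hA : MeasurableSet A) (hB : MeasurableSet B) (N : ℕ) :
    μ.real (A ∩ B) ≤ μ.real (A ∪ B) * (Measure.pi fun _ : Fin N => μ).real (agree A B N) := by
  induction N with
  | zero =>
    simp only [agree, probReal_univ, mul_one]
    exact measureReal_mono fun x h => Or.inl h.1
  | succ N ih =>
    rw [measure_agree_succ μ hA hB]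
    have h1 : μ.real (A ∪ B) ≤ 1 := measureReal_le_one
    nlinarith

/-- The distance to the fixed point shrinks by the factor `1 - μ (A ∪ B)` in each trial. -/
theorem measure_agree_le {A B : Set Ω} (hA : MeasurableSet A) (hB : MeasurableSet B)
    (hpos : 0 < μ.real (A ∪ B)) (N : ℕ) :
    (Measure.pi fun _ : Fin N => μ).real (agree A B N) ≤
      μ.real (A ∩ B) / μ.real (A ∪ B) + (1 - μ.real (A ∪ B)) ^ N := by
  induction N with
  | zero =>
    simp only [agree, probReal_univ, pow_zero]
    have : 0 ≤ μ.real (A ∩ B) / μ.real (A ∪ B) := by positivity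
    linarith
  | succ N ih =>
    rw [measure_agree_succ μ hA hB]
    have h1 : 0 ≤ 1 - μ.real (A ∪ B) := by linarith [measureReal_le_one (μ := μ) (s := A ∪ B)]
    refine (add_le_add_right (mul_le_mul_of_nonneg_left ih h1) _).trans_eq ?_
    field_simp
    ring

end LastHit

/-- The probability that the points at positions `z` and `z'` of the torus have the same last hit
among `N` random balls. -/
def agreeProb {t : ℕ} (N : ℕ) (z z' : Fin t → ℝ) : ℝ :=
  (Measure.pi fun _ : Fin N => centerLaw t).real (agree (hitSet z) (hitSet z') N)

theorem hitSet_union {t : ℕ} (z z' : Fin t → ℝ) :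
    (centerLaw t).real (hitSet z ∪ hitSet z') =
      2 * ballVol t - (centerLaw t).real (hitSet z ∩ hitSet z') := by
  have := measureReal_union_add_inter (μ := centerLaw t) (s := hitSet z)
    (measurableSet_hitSet z')
  rw [centerLaw_hitSet, centerLaw_hitSet] at this
  linarith

/-- The recursion involves only the volumes of the intersection and the union, and these depend only
on `z' - z`. -/
theorem agreeProb_eq_sub {t : ℕ} (N : ℕ) (z z' : Fin t → ℝ) :
    agreeProb N z z' = agreeProb N 0 (fun j => z' j - z j) := by
  have h : (centerLaw t).real (hitSet z ∩ hitSet z') =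
      (centerLaw t).real (hitSet 0 ∩ hitSet fun j => z' j - z j) := by
    rw [centerLaw_hitSet_inter, centerLaw_hitSet_inter]
    simp
  induction N with
  | zero => simp [agreeProb, agree]
  | succ N ih =>
    unfold agreeProb at *
    rw [measure_agree_succ _ (measurableSet_hitSet _) (measurableSet_hitSet _),
      measure_agree_succ _ (measurableSet_hitSet _) (measurableSet_hitSet _), hitSet_union,
      hitSet_union, h, ih]

/-- The expected number of hits is at least `m`, so missing all balls has probability at most `exp
(-m)`. The inscribed cube leaves `(2 * m) ^ 2 / (8 * m) = m / 2 ≥ 2` per pair of coordinates. -/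
theorem mul_trials_ge {m : ℕ} (hm : 4 ≤ m) :
    (m : ℝ) ≤ ballVol (2 * m) * (((2 * m) ^ (2 * m) : ℕ) : ℝ) := by
  have hm0 : (4 : ℝ) ≤ m := by exact_mod_cast hm
  have h := ballVol_ge (m := m) (by omega)
  calc (m : ℝ) ≤ 2 ^ m := by exact_mod_cast (Nat.lt_two_pow_self (n := m)).le
    _ ≤ (1 / (8 * m) * (2 * m) ^ 2) ^ m := by
        apply pow_le_pow_left₀ (by norm_num)
        rw [one_div_mul_eq_div, le_div_iff₀ (by positivity)]
        nlinarith
    _ = (1 / (8 * m)) ^ m * (((2 * m) ^ (2 * m) : ℕ) : ℝ) := by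
        push_cast
        rw [mul_pow, ← pow_mul]
    _ ≤ _ := by gcongr

/-- The union is bounded below by a single ball; the second term bounds the probability that all
trials miss. -/
theorem agreeProb_le {m : ℕ} (hm : 4 ≤ m) (z z' : Fin (2 * m) → ℝ)
    (h : 4 * sqSum (fun j => z' j - z j) < 1) :
    agreeProb ((2 * m) ^ (2 * m)) z z' ≤
      (1 - 4 * sqSum (fun j => z' j - z j)) ^ m + Real.exp (-m) := by
  have hpos := ballVol_pos (m := m) (by omega)
  have hu1 : ballVol (2 * m) ≤ (centerLaw (2 * m)).real (hitSet z ∪ hitSet z') := by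
    rw [← centerLaw_hitSet z]
    exact measureReal_mono Set.subset_union_left
  have hq := hitSet_inter_le z z' h
  have hu : (centerLaw (2 * m)).real (hitSet z ∪ hitSet z') ≤ 1 := measureReal_le_one
  refine (measure_agree_le _ (measurableSet_hitSet z) (measurableSet_hitSet z') (by linarith)
    _).trans (add_le_add ?_ ?_)
  · rw [div_le_iff₀ (by linarith)]
    refine hq.trans ?_
    gcongr
  · set u := (centerLaw (2 * m)).real (hitSet z ∪ hitSet z') with hud
    calc (1 - u) ^ ((2 * m) ^ (2 * m)) ≤ (Real.exp (-u)) ^ ((2 * m) ^ (2 * m)) := by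
          apply pow_le_pow_left₀ (by linarith)
          linarith [Real.add_one_le_exp (-u)]
      _ = Real.exp (-(u * ((2 * m) ^ (2 * m) : ℕ))) := by
          rw [← Real.exp_nat_mul]; congr 1; ring
      _ ≤ _ := by
          apply Real.exp_le_exp.mpr
          rw [neg_le_neg_iff]
          refine (mul_trials_ge hm).trans ?_
          gcongr

/-- The union has at most twice the volume of a ball, which doubles the factor `4 * m` of
`le_hitSet_inter`. -/
theorem le_agreeProb {m : ℕ} (hm : 4 ≤ m) (N : ℕ) (z z' : Fin (2 * m) → ℝ)
    (h : 4 * sqSum (fun j => z' j - z j) ≤ 1 / 2) :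
    (1 - 4 * sqSum (fun j => z' j - z j) - 1 / m) ^ m / (8 * m) ≤ agreeProb N z z' := by
  have hm0 : (4 : ℝ) ≤ m := by exact_mod_cast hm
  have hpos := ballVol_pos (m := m) (by omega)
  have hq := le_hitSet_inter (by omega) z z' h
  have ha := le_measure_agree (centerLaw (2 * m)) (measurableSet_hitSet z)
    (measurableSet_hitSet z') N
  rw [hitSet_union] at ha
  have h0 : 0 ≤ (centerLaw (2 * m)).real (hitSet z ∩ hitSet z') := measureReal_nonneg
  have hA : 0 ≤ agreeProb N z z' := measureReal_nonneg
  change _ ≤ _ * agreeProb N z z' at ha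
  rw [div_le_iff₀ (by positivity)]
  have h1 : (centerLaw (2 * m)).real (hitSet z ∩ hitSet z') ≤
      2 * ballVol (2 * m) * agreeProb N z z' := by nlinarith
  have h2 : (1 - 4 * sqSum (fun j => z' j - z j) - 1 / m) ^ m * ballVol (2 * m) ≤
      (agreeProb N z z' * (8 * m)) * ballVol (2 * m) := by nlinarith
  exact le_of_mul_le_mul_right h2 hpos

/-- Joint measurability in positions and centers is what Fubini requires once the positions are
random projections. -/
theorem measurableSet_agree_comp {α : Type*} [MeasurableSpace α] {t : ℕ} {Z Z' : α → Fin t → ℝ}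
    (hZ : Measurable Z) (hZ' : Measurable Z') {N : ℕ} {c : α → Fin N → Fin t → ℝ}
    (hc : Measurable c) : MeasurableSet {a | c a ∈ agree (hitSet (Z a)) (hitSet (Z' a)) N} := by
  induction N with
  | zero => exact MeasurableSet.univ
  | succ N ih =>
    have h1 : Measurable fun a => c a (Fin.last N) := (measurable_pi_apply _).comp hc
    have h2 : Measurable fun a => (Fin.init (c a) : Fin N → Fin t → ℝ) :=
      measurable_pi_lambda _ fun j => (measurable_pi_apply _).comp hc
    have hit : ∀ W : α → Fin t → ℝ, Measurable W →
        MeasurableSet {a | c a (Fin.last N) ∈ hitSet (W a)} := by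
      intro W hW
      refine measurableSet_le (measurable_sqSum.comp (measurable_pi_lambda _ fun j => ?_))
        measurable_const
      exact measurable_wrap.comp
        (((measurable_pi_apply j).comp hW).sub ((measurable_pi_apply j).comp h1))
    exact ((hit Z hZ).inter (hit Z' hZ')).union
      (((hit Z hZ).union (hit Z' hZ')).compl.inter (ih h2))

theorem measurable_agreeProb {t : ℕ} (N : ℕ) :
    Measurable fun v : Fin t → ℝ => agreeProb N 0 v := by
  have h : MeasurableSet {a : (Fin t → ℝ) × (Fin N → Fin t → ℝ) |
      a.2 ∈ agree (hitSet 0) (hitSet a.1) N} :=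
    measurableSet_agree_comp measurable_const measurable_fst measurable_snd
  exact (measurable_measure_prodMk_left h).ennreal_toReal

theorem agreeProb_nonneg {t N : ℕ} (z z' : Fin t → ℝ) : 0 ≤ agreeProb N z z' := measureReal_nonneg

theorem agreeProb_le_one {t N : ℕ} (z z' : Fin t → ℝ) : agreeProb N z z' ≤ 1 := measureReal_le_one

/-! ### Averaging over the Gaussian projection -/

theorem integrable_agreeProb {t : ℕ} (N : ℕ) (s : ℝ) :
    Integrable (fun g : Fin t → ℝ => agreeProb N 0 (fun j => s * g j)) (stdNormal t) := by
  refine Integrable.of_bound (C := 1) (Measurable.aestronglyMeasurable ?_) ?_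
  · exact (measurable_agreeProb N).comp (measurable_pi_lambda _ fun j => by fun_prop)
  · filter_upwards with g
    rw [Real.norm_of_nonneg (agreeProb_nonneg _ _)]
    exact agreeProb_le_one _ _

theorem sqSum_mul {t : ℕ} (s : ℝ) (g : Fin t → ℝ) :
    sqSum (fun j => s * g j - (0 : Fin t → ℝ) j) = s ^ 2 * sqSum g := by
  simp [sqSum, Finset.mul_sum, mul_pow]

theorem integral_agreeProb_le {m : ℕ} (hm : 4096 ≤ m) {s : ℝ} (h1 : 8 * m * s ^ 2 ≤ 1 / 16)
    (h3 : m * (8 * m * s ^ 2) ^ 3 ≤ 1) :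
    ∫ g, agreeProb ((2 * m) ^ (2 * m)) 0 (fun j => s * g j) ∂stdNormal (2 * m) ≤
      Real.exp (-(m * (8 * m * s ^ 2)) + 3) := by
  have hm0 : (4096 : ℝ) ≤ m := by exact_mod_cast hm
  -- `integral_lens_upper` needs `C > 0`; for coinciding points the trivial bound `1` suffices.
  by_cases hs : s = 0
  · rw [hs]
    refine (integral_mono (integrable_agreeProb _ _) (integrable_const 1)
      fun g => agreeProb_le_one _ _).trans ?_
    simp
  set C := 8 * m * s ^ 2 with hC
  have hC0 : 0 < C := by positivity
  have hCs : ∀ y, C / (2 * m) * y = 4 * (s ^ 2 * y) := fun y => by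
    rw [hC]; field_simp; ring
  have := integral_lens_upper (m := m) (by omega) hC0 h1 h3 _
    (integrable_agreeProb ((2 * m) ^ (2 * m)) s) (fun g => agreeProb_le_one _ _)
    (Real.exp_pos (-m)).le (fun g hg => by
      rw [hCs] at hg ⊢
      rw [← sqSum_mul] at hg ⊢
      exact agreeProb_le (by omega) _ _ hg)
  refine this.trans ?_
  have hmC : m * C ≤ m := by nlinarith
  have e1 : Real.exp (-m) ≤ Real.exp (-(m * C) + 1) := Real.exp_le_exp.mpr (by linarith)
  have e2 : Real.exp (-(m * C) + 3) = Real.exp (-(m * C) + 1) * Real.exp 2 := by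
    rw [← Real.exp_add]; congr 1; ring
  have e3 : (3 : ℝ) ≤ Real.exp 2 := by linarith [Real.add_one_le_exp 2]
  have e4 := Real.exp_pos (-(m * C) + 1)
  rw [e2]
  nlinarith

theorem le_integral_agreeProb {m : ℕ} (hm : 4096 ≤ m) (N : ℕ) {s : ℝ}
    (h1 : 8 * m * s ^ 2 ≤ 1 / 16) (h3 : m * (8 * m * s ^ 2) ^ 3 ≤ 1) :
    Real.exp (-(m * (8 * m * s ^ 2)) - 31) / (2 * m) ≤
      ∫ g, agreeProb N 0 (fun j => s * g j) ∂stdNormal (2 * m) := by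
  have hm0 : (4096 : ℝ) ≤ m := by exact_mod_cast hm
  set C := 8 * m * s ^ 2 with hC
  have hC0 : 0 ≤ C := by positivity
  have hCs : ∀ y, C / (2 * m) * y = 4 * (s ^ 2 * y) := fun y => by
    rw [hC]; field_simp; ring
  -- The function is doubled because `le_agreeProb` has denominator `8 * m` where `4 * m` is
  -- expected.
  have := integral_lens_lower hm hC0 h1 h3 _
    ((integrable_agreeProb N s).const_mul 2)
    (fun g => mul_nonneg zero_le_two (agreeProb_nonneg _ _)) (fun g hg => by
      rw [hCs] at hg ⊢
      rw [← sqSum_mul] at hg ⊢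
      have := le_agreeProb (by omega) N _ _ hg
      rw [div_le_iff₀ (by positivity)] at this ⊢
      linarith)
  rw [integral_const_mul, div_le_iff₀ (by positivity)] at this
  rw [div_le_iff₀ (by positivity)]
  linarith

/-! ### The law of a random projection -/

/-- The coordinates of a point under the linear map with matrix `G`. -/
def project {t d : ℕ} (σ : ℝ) (G : Fin t → Fin d → ℝ) (x : Pt d) (j : Fin t) : ℝ :=
  (∑ i, G j i * x i) * σ

/-- Both laws are centered Gaussians on the line with variance `σ ^ 2 * ‖w‖ ^ 2`. -/
theorem map_linear_gaussian {d : ℕ} (σ : ℝ) (w : Pt d) :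
    (stdNormal d).map (fun g => (∑ i, g i * w i) * σ) =
      (gaussianReal 0 1).map (fun y => σ * ‖w‖ * y) := by
  have h1 : (fun g : Fin d → ℝ => (∑ i, g i * w i) * σ) =
      (σ • innerSL ℝ w) ∘ (WithLp.toLp 2) := by
    ext g
    simp [PiLp.inner_apply, mul_comm]
  rw [h1, ← Measure.map_map (by fun_prop) (by fun_prop), map_pi_eq_stdGaussian,
    IsGaussian.map_eq_gaussianReal, integral_strongDual_stdGaussian, variance_dual_stdGaussian,
    gaussianReal_map_const_mul, norm_smul, innerSL_apply_norm]
  congr 1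
  · simp
  · ext
    simp [mul_pow]
    positivity

theorem map_project_sub {t d : ℕ} (σ : ℝ) (x y : Pt d) :
    (Measure.pi fun _ : Fin t => stdNormal d).map (fun G j => project σ G y j - project σ G x j) =
      (stdNormal t).map (fun g j => σ * ‖x - y‖ * g j) := by
  have h1 : (fun (G : Fin t → Fin d → ℝ) j => project σ G y j - project σ G x j) =
      fun G j => (fun g : Fin d → ℝ => (∑ i, g i * (y - x) i) * σ) (G j) := by
    ext G j
    simp only [project, ← sub_mul, ← Finset.sum_sub_distrib, ← mul_sub]
    rfl
  have hf : Measurable fun g : Fin d → ℝ => (∑ i, g i * (y - x) i) * σ := by fun_prop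
  have hf2 : Measurable fun z : ℝ => σ * ‖x - y‖ * z := by fun_prop
  rw [h1, Measure.pi_map_pi (fun _ => hf.aemeasurable),
    Measure.pi_map_pi (fun _ => hf2.aemeasurable), map_linear_gaussian, norm_sub_rev]

/-- The law of the randomness of one piece of the hash function. -/
abbrev pieceLaw (t d N : ℕ) : Measure ((Fin N → Fin t → ℝ) × (Fin t → Fin d → ℝ)) :=
  (Measure.pi fun _ : Fin N => centerLaw t).prod (Measure.pi fun _ : Fin t => stdNormal d)

/-- The event that two points collide in one piece of the hash function. -/
def pieceEvent {t d : ℕ} (N : ℕ) (σ : ℝ) (x y : Pt d) :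
    Set ((Fin N → Fin t → ℝ) × (Fin t → Fin d → ℝ)) :=
  {a | a.1 ∈ agree (hitSet (project σ a.2 x)) (hitSet (project σ a.2 y)) N}

theorem measurable_project {t d : ℕ} (σ : ℝ) (x : Pt d) :
    Measurable fun G : Fin t → Fin d → ℝ => project σ G x := by
  refine measurable_pi_lambda _ fun j => ?_
  unfold project
  fun_prop

theorem measurableSet_pieceEvent {t d : ℕ} (N : ℕ) (σ : ℝ) (x y : Pt d) :
    MeasurableSet (pieceEvent (t := t) N σ x y) :=
  measurableSet_agree_comp ((measurable_project σ x).comp measurable_snd)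
    ((measurable_project σ y).comp measurable_snd) measurable_fst

/-- For a fixed matrix the collision probability depends only on the difference of the projections.
Its law is that of a Gaussian vector scaled by the distance, so the dimension `d` disappears. -/
theorem pieceLaw_pieceEvent {t d : ℕ} (N : ℕ) (σ : ℝ) (x y : Pt d) :
    (pieceLaw t d N).real (pieceEvent N σ x y) =
      ∫ g, agreeProb N 0 (fun j => σ * ‖x - y‖ * g j) ∂stdNormal t := by
  have hm := measurableSet_pieceEvent (t := t) N σ x y
  have h1 : (pieceLaw t d N).real (pieceEvent N σ x y) =
      ∫ G, agreeProb N 0 (fun j => project σ G y j - project σ G x j)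
        ∂(Measure.pi fun _ : Fin t => stdNormal d) := by
    rw [measureReal_def, Measure.prod_apply_symm hm, ← integral_toReal]
    · refine integral_congr_ae (Filter.Eventually.of_forall fun G => ?_)
      simp only
      rw [← agreeProb_eq_sub]
      rfl
    · exact (measurable_measure_prodMk_right hm).aemeasurable
    · exact Filter.Eventually.of_forall fun G => measure_lt_top _ _
  have m1 : Measurable fun (G : Fin t → Fin d → ℝ) j => project σ G y j - project σ G x j :=
    measurable_pi_lambda _ fun j => ((measurable_pi_apply j).comp (measurable_project σ y)).sub
      ((measurable_pi_apply j).comp (measurable_project σ x))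
  have m2 : Measurable fun (g : Fin t → ℝ) j => σ * ‖x - y‖ * g j := by fun_prop
  rw [h1, ← integral_map (φ := fun G j => project σ G y j - project σ G x j)
      (f := fun v => agreeProb N 0 v) m1.aemeasurable
      (measurable_agreeProb N).aestronglyMeasurable, map_project_sub,
    integral_map m2.aemeasurable (measurable_agreeProb N).aestronglyMeasurable]

/-! ### The hash function -/

/-- Coordinate number `row` of the image of `x` under the random linear map. -/
def projCoord (d : ℕ) (σ : ℝ) (g x : ℕ → ℝ) (row : ℕ) : ℝ :=
  (∑ i ∈ Finset.range d, g (row * d + i) * x i) * σ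

/-- The squared distance on the torus from `z` to the center number `row`. -/
def trialDist (t : ℕ) (z u : ℕ → ℝ) (row : ℕ) : ℝ :=
  ∑ j ∈ Finset.range t, wrap (z j - u (row * t + j)) ^ 2

/-- One plus the index of the last of the first `N` trials with squared distance at most `1/16`,
or `0` if there is none. -/
def lastHit (D : ℕ → ℝ) : ℕ → ℕ
  | 0 => 0
  | m + 1 => if D m ≤ 1 / 16 then m + 1 else lastHit D m

/-- Piece number `l` of the hash value. -/
def pieceIndex (d t N : ℕ) (σ : ℝ) (g u x : ℕ → ℝ) (l : ℕ) : ℕ :=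
  lastHit (fun m => trialDist t (fun j => projCoord d σ g x (l * t + j)) u (l * N + m)) N

/-- The hash value composed of the first `k` pieces. -/
def hashCode (d t N : ℕ) (σ : ℝ) (g u x : ℕ → ℝ) : ℕ → ℕ
  | 0 => 0
  | l + 1 => hashCode d t N σ g u x l * (N + 1) + pieceIndex d t N σ g u x l

theorem lastHit_le (D : ℕ → ℝ) (N : ℕ) : lastHit D N ≤ N := by
  induction N with
  | zero => rfl
  | succ N ih => rw [lastHit]; split_ifs <;> omega

theorem mul_add_inj_of_lt {c A A' j j' : ℕ} (hj : j < c) (hj' : j' < c)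
    (h : A * c + j = A' * c + j') : A = A' ∧ j = j' := by
  have hc : 0 < c := by omega
  have h1 : (A * c + j) / c = A := by
    rw [mul_comm, Nat.mul_add_div hc, Nat.div_eq_of_lt hj, add_zero]
  have h2 : (A' * c + j') / c = A' := by
    rw [mul_comm, Nat.mul_add_div hc, Nat.div_eq_of_lt hj', add_zero]
  have : A = A' := by rw [← h1, h, h2]
  subst this
  exact ⟨rfl, by omega⟩

/-- Pieces are at most `N`, so they are the digits of the code in base `N + 1`. -/
theorem hashCode_eq_iff (d t N : ℕ) (σ : ℝ) (g u x y : ℕ → ℝ) (k : ℕ) :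
    hashCode d t N σ g u x k = hashCode d t N σ g u y k ↔
      ∀ l < k, pieceIndex d t N σ g u x l = pieceIndex d t N σ g u y l := by
  induction k with
  | zero => simp [hashCode]
  | succ k ih =>
    simp only [hashCode]
    have hx := lastHit_le (fun m =>
      trialDist t (fun j => projCoord d σ g x (k * t + j)) u (k * N + m)) N
    have hy := lastHit_le (fun m =>
      trialDist t (fun j => projCoord d σ g y (k * t + j)) u (k * N + m)) N
    change pieceIndex d t N σ g u x k ≤ N at hx
    change pieceIndex d t N σ g u y k ≤ N at hy
    constructor
    · intro h l hl
      obtain ⟨h1, h2⟩ := mul_add_inj_of_lt (by omega) (by omega) h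
      rcases Nat.lt_succ_iff_lt_or_eq.mp hl with h3 | rfl
      · exact ih.mp h1 l h3
      · exact h2
    · intro h
      rw [ih.mpr fun l hl => h l (by omega), h k (by omega)]

/-- If only one point is hit by the latest trial, its index is `N + 1`, while the other one is at
most `N`. -/
theorem lastHit_eq_iff {t : ℕ} (z z' : Fin t → ℝ) (c : ℕ → Fin t → ℝ) (N : ℕ) :
    lastHit (fun m => sqSum fun j => wrap (z j - c m j)) N =
      lastHit (fun m => sqSum fun j => wrap (z' j - c m j)) N ↔
      (fun i : Fin N => c i) ∈ agree (hitSet z) (hitSet z') N := by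
  induction N with
  | zero => simp [lastHit, agree]
  | succ N ih =>
    have hx := lastHit_le (fun m => sqSum fun j => wrap (z j - c m j)) N
    have hy := lastHit_le (fun m => sqSum fun j => wrap (z' j - c m j)) N
    change _ ↔ (c N ∈ hitSet z ∧ c N ∈ hitSet z' ∨ ¬ (c N ∈ hitSet z ∨ c N ∈ hitSet z') ∧
      (fun i : Fin N => c i) ∈ agree (hitSet z) (hitSet z') N)
    rw [← ih]
    rw [lastHit, lastHit]
    split_ifs with h1 h2 h2
    all_goals simp only [show (sqSum fun j => wrap (z j - c N j)) ≤ 1 / 16 ↔ c N ∈ hitSet z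
      from Iff.rfl] at h1
    all_goals simp only [show (sqSum fun j => wrap (z' j - c N j)) ≤ 1 / 16 ↔ c N ∈ hitSet z'
      from Iff.rfl] at h2
    · exact ⟨fun _ => Or.inl ⟨h1, h2⟩, fun _ => rfl⟩
    · exact ⟨fun h => by omega, fun h => by tauto⟩
    · exact ⟨fun h => by omega, fun h => by tauto⟩
    · tauto

/-- The random linear map used by piece `l`. -/
def gaussBlock (t d : ℕ) (g : ℕ → ℝ) (l : ℕ) (j : Fin t) (i : Fin d) : ℝ :=
  g ((l * t + j) * d + i)

theorem projCoord_eq {d t : ℕ} (σ : ℝ) (g : ℕ → ℝ) (x : Pt d) (l : ℕ) (j : Fin t) :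
    projCoord d σ g (queryInput x) (l * t + j) = project σ (gaussBlock t d g l) x j := by
  rw [projCoord, project, Finset.sum_range]
  simp [gaussBlock, queryInput]

theorem trialDist_eq {d t : ℕ} (N : ℕ) (σ : ℝ) (g u : ℕ → ℝ) (x : Pt d) (l m : ℕ) :
    trialDist t (fun j => projCoord d σ g (queryInput x) (l * t + j)) u (l * N + m) =
      sqSum fun j : Fin t => wrap (project σ (gaussBlock t d g l) x j -
        u ((l * N + m) * t + j)) := by
  rw [trialDist, sqSum, Finset.sum_range]
  simp only [projCoord_eq]

theorem pieceIndex_eq_iff {d t : ℕ} (N : ℕ) (σ : ℝ) (g u : ℕ → ℝ) (x y : Pt d) (l : ℕ) :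
    pieceIndex d t N σ g u (queryInput x) l = pieceIndex d t N σ g u (queryInput y) l ↔
      ((gaussBlock N t u l, gaussBlock t d g l) :
        (Fin N → Fin t → ℝ) × (Fin t → Fin d → ℝ)) ∈ pieceEvent N σ x y := by
  simp only [pieceIndex, trialDist_eq]
  rw [lastHit_eq_iff _ _ (fun m (j : Fin t) => u ((l * N + m) * t + j))]
  rfl

/-! ### Independence of the pieces -/

theorem measurable_gaussBlock (a b : ℕ) (l : ℕ) :
    Measurable fun u : ℕ → ℝ => gaussBlock a b u l := by
  refine measurable_pi_lambda _ fun i => measurable_pi_lambda _ fun j => ?_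
  exact measurable_pi_apply _

/-- The blocks read the tape along an injection of index triples into `ℕ`, so their entries are
independent; currying groups them into matrices. -/
theorem map_gaussBlock (μ : Measure ℝ) [IsProbabilityMeasure μ] (k a b : ℕ) :
    (Measure.infinitePi fun _ : ℕ => μ).map (fun u (l : Fin k) => gaussBlock a b u l) =
      Measure.pi fun _ : Fin k => Measure.pi fun _ : Fin a => Measure.pi fun _ : Fin b => μ := by
  set e : Fin k × Fin a × Fin b → ℕ := fun p => (p.1 * a + p.2.1) * b + p.2.2 with he
  have hinj : Function.Injective e := by
    rintro ⟨l, i, j⟩ ⟨l', i', j'⟩ h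
    obtain ⟨h1, h2⟩ := mul_add_inj_of_lt j.2 j'.2 h
    obtain ⟨h3, h4⟩ := mul_add_inj_of_lt i.2 i'.2 h1
    simp only [Prod.mk.injEq, Fin.ext_iff]
    exact ⟨h3, h4, h2⟩
  have h1 := Measure.map_infinitePi_infinitePi_of_inj (P := fun _ : ℕ => μ) hinj
  have h2 := Measure.infinitePi_map_curry (fun (_ : Fin k) (_ : Fin a × Fin b) => μ)
  have h3 := Measure.infinitePi_map_curry (fun (_ : Fin a) (_ : Fin b) => μ)
  have h4 := Measure.infinitePi_map_pi
    (μ := fun _ : Fin k => Measure.infinitePi fun _ : Fin a × Fin b => μ)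
    (f := fun _ => MeasurableEquiv.curry (Fin a) (Fin b) ℝ)
    (fun _ => (MeasurableEquiv.curry (Fin a) (Fin b) ℝ).measurable)
  simp only [h3] at h4
  rw [← h2, ← h1, Measure.map_map (by fun_prop) (by fun_prop), Measure.map_map (by fun_prop)
    (by fun_prop)] at h4
  simp only [Measure.infinitePi_eq_pi] at h4
  exact h4

theorem map_tape_blocks (k t d N : ℕ) :
    tapeMeasure.map (fun ω => ((fun l : Fin k => gaussBlock N t ω.1 l),
      fun l : Fin k => gaussBlock t d ω.2 l)) =
      (Measure.pi fun _ : Fin k => Measure.pi fun _ : Fin N => centerLaw t).prod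
        (Measure.pi fun _ : Fin k => Measure.pi fun _ : Fin t => stdNormal d) := by
  have hm : ∀ a b : ℕ, Measurable fun (u : ℕ → ℝ) (l : Fin k) => gaussBlock a b u l :=
    fun a b => measurable_pi_lambda _ fun l => measurable_gaussBlock a b l
  rw [← map_gaussBlock, ← map_gaussBlock, Measure.map_prod_map _ _ (hm _ _) (hm _ _)]
  rfl

/-- Distinct pieces use disjoint parts of the tape, so collisions are independent. -/
theorem tapeMeasure_forall_block (k t d N : ℕ)
    {S : Set ((Fin N → Fin t → ℝ) × (Fin t → Fin d → ℝ))} (hS : MeasurableSet S) :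
    tapeMeasure.real {ω | ∀ l < k, (gaussBlock N t ω.1 l, gaussBlock t d ω.2 l) ∈ S} =
      (pieceLaw t d N).real S ^ k := by
  have hm : ∀ a b : ℕ, Measurable fun (u : ℕ → ℝ) (l : Fin k) => gaussBlock a b u l :=
    fun a b => measurable_pi_lambda _ fun l => measurable_gaussBlock a b l
  have hT : Measurable fun ω : Tape => ((fun l : Fin k => gaussBlock N t ω.1 l),
      fun l : Fin k => gaussBlock t d ω.2 l) :=
    ((hm N t).comp measurable_fst).prodMk ((hm t d).comp measurable_snd)
  have hpi : MeasurableSet (Set.univ.pi fun _ : Fin k => S) := MeasurableSet.univ_pi fun _ => hS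
  have hmp := measurePreserving_arrowProdEquivProdArrow (Fin N → Fin t → ℝ) (Fin t → Fin d → ℝ)
    (Fin k) (fun _ => Measure.pi fun _ : Fin N => centerLaw t)
    (fun _ => Measure.pi fun _ : Fin t => stdNormal d)
  have hsymm := hmp.symm
  have hset : {ω : Tape | ∀ l < k, (gaussBlock N t ω.1 l, gaussBlock t d ω.2 l) ∈ S} =
      (fun ω : Tape => ((fun l : Fin k => gaussBlock N t ω.1 l),
      fun l : Fin k => gaussBlock t d ω.2 l)) ⁻¹'
        ((MeasurableEquiv.arrowProdEquivProdArrow _ _ _).symm ⁻¹' (Set.univ.pi fun _ => S)) := by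
    ext ω
    simp only [Set.mem_ofPred_eq, Set.mem_preimage, Set.mem_pi, Set.mem_univ, true_imp_iff]
    exact ⟨fun h l => h l l.2, fun h l hl => h ⟨l, hl⟩⟩
  rw [hset, ← map_measureReal_apply hT (hsymm.measurable hpi), map_tape_blocks,
    hsymm.measureReal_preimage hpi.nullMeasurableSet, measureReal_def, Measure.pi_pi,
    Finset.prod_const, Finset.card_univ, Fintype.card_fin, ENNReal.toReal_pow]
  rfl

theorem setOf_hashCode_eq {d : ℕ} (k t N : ℕ) (σ : ℝ) (x y : Pt d) :
    {ω : Tape | hashCode d t N σ ω.2 ω.1 (queryInput x) k =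
      hashCode d t N σ ω.2 ω.1 (queryInput y) k} =
    {ω | ∀ l < k, (gaussBlock N t ω.1 l, gaussBlock t d ω.2 l) ∈ pieceEvent N σ x y} := by
  ext ω
  simp only [Set.mem_ofPred_eq, hashCode_eq_iff, pieceIndex_eq_iff]

/-- The ball carving hash family. -/
def ballCarving (d k t N : ℕ) (σ : ℝ) : HashFamily d where
  Key := ℕ
  hash ω x := hashCode d t N σ ω.2 ω.1 (queryInput x) k
  measurableSet_collision x y := by
    rw [setOf_hashCode_eq]
    simp only [Set.ofPred_forall]
    refine MeasurableSet.iInter fun l => MeasurableSet.iInter fun _ => ?_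
    exact (((measurable_gaussBlock N t l).comp measurable_fst).prodMk
      ((measurable_gaussBlock t d l).comp measurable_snd)) (measurableSet_pieceEvent N σ x y)

theorem ballCarving_collisionProb {d : ℕ} (k t N : ℕ) (σ : ℝ) (x y : Pt d) :
    (ballCarving d k t N σ).collisionProb x y =
      (∫ g, agreeProb N 0 (fun j => σ * ‖x - y‖ * g j) ∂stdNormal t) ^ k := by
  rw [← pieceLaw_pieceEvent, ← tapeMeasure_forall_block k t d N (measurableSet_pieceEvent N σ x y),
    ← setOf_hashCode_eq]
  rfl

/-! ### Parameters -/

/-- The fourth root of the diameter, rounded down. -/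
def rootParam (R : ℝ) : ℕ := ⌊Real.sqrt (Real.sqrt R)⌋₊

/-- The number of pieces of the hash function. -/
def numPieces (R : ℝ) : ℕ := rootParam R ^ 5

/-- The dimension of the random projections. -/
def numDims (R : ℝ) : ℕ := 8192 * rootParam R ^ 5

/-- The number of random balls of each piece. -/
def numTrials (R : ℝ) : ℕ := numDims R ^ numDims R

/-- The scaling factor of the random projections. -/
def projScale (R β : ℝ) : ℝ := Real.sqrt (β / (2 * numPieces R)) / numDims R

/-- The ball carving hash family for diameter `R` and exponent `β`. -/
def gaussianHash (d : ℕ) (R β : ℝ) : HashFamily d :=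
  ballCarving d (numPieces R) (numDims R) (numTrials R) (projScale R β)

theorem pow_rootParam_le {R : ℝ} (hR : 0 ≤ R) : (rootParam R : ℝ) ^ 4 ≤ R := by
  have h := Nat.floor_le (Real.sqrt_nonneg (Real.sqrt R))
  calc (rootParam R : ℝ) ^ 4 ≤ Real.sqrt (Real.sqrt R) ^ 4 := by
        exact pow_le_pow_left₀ (Nat.cast_nonneg _) h 4
    _ = R := by
        rw [show (4 : ℕ) = 2 * 2 by norm_num, pow_mul, Real.sq_sqrt (Real.sqrt_nonneg R),
          Real.sq_sqrt hR]

theorem lt_pow_rootParam {R : ℝ} (hR : 0 ≤ R) : R < ((rootParam R : ℝ) + 1) ^ 4 := by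
  have h := Nat.lt_floor_add_one (Real.sqrt (Real.sqrt R))
  calc R = Real.sqrt (Real.sqrt R) ^ 4 := by
        rw [show (4 : ℕ) = 2 * 2 by norm_num, pow_mul, Real.sq_sqrt (Real.sqrt_nonneg R),
          Real.sq_sqrt hR]
    _ < _ := pow_lt_pow_left₀ h (Real.sqrt_nonneg _) (by norm_num)

/-- The identity `5 + 1/3 = 4 * (4/3)` leaves a factor `q ^ (1/3)` to absorb the logarithm of the
dimension. -/
theorem rootParam_rpow_le {R : ℝ} (hR : 0 ≤ R) :
    (rootParam R : ℝ) ^ 5 * (rootParam R : ℝ) ^ (1 / 3 : ℝ) ≤ R ^ (4 / 3 : ℝ) := by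
  have hq : (0 : ℝ) ≤ rootParam R := Nat.cast_nonneg _
  calc _ = ((rootParam R : ℝ) ^ 4) ^ (4 / 3 : ℝ) := by
        rw [← Real.rpow_natCast, ← Real.rpow_natCast, ← Real.rpow_mul hq]
        rcases hq.eq_or_lt with h | h
        · rw [← h]; norm_num
        · rw [← Real.rpow_add h]; norm_num
    _ ≤ _ := Real.rpow_le_rpow (by positivity) (pow_rootParam_le hR) (by norm_num)

theorem rootParam_pow_five_le {R : ℝ} (hR : 0 ≤ R) :
    (rootParam R : ℝ) ^ 5 ≤ R ^ (4 / 3 : ℝ) := by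
  refine le_trans ?_ (rootParam_rpow_le hR)
  rcases Nat.eq_zero_or_pos (rootParam R) with h | h
  · simp [h]
  · have h1 : (1 : ℝ) ≤ rootParam R := by exact_mod_cast h
    exact le_mul_of_one_le_right (by positivity) (Real.one_le_rpow h1 (by norm_num))

theorem log_numDims_le {R : ℝ} (h : 1 ≤ rootParam R) :
    Real.log (numDims R) ≤ 28 * (rootParam R : ℝ) ^ (1 / 3 : ℝ) := by
  have h1 : (1 : ℝ) ≤ rootParam R := by exact_mod_cast h
  have h2 : 1 ≤ (rootParam R : ℝ) ^ (1 / 3 : ℝ) := Real.one_le_rpow h1 (by norm_num)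
  have e : ((numDims R : ℕ) : ℝ) = 2 ^ 13 * (rootParam R : ℝ) ^ 5 := by
    rw [numDims]; push_cast; norm_num
  rw [e, Real.log_mul (by positivity) (by positivity), Real.log_pow, Real.log_pow]
  have h3 : Real.log 2 ≤ 1 := by linarith [Real.log_le_sub_one_of_pos (x := 2) (by norm_num)]
  have h4 : Real.log (rootParam R) ≤ (rootParam R : ℝ) ^ (1 / 3 : ℝ) / (1 / 3) :=
    Real.log_le_rpow_div (by linarith) (by norm_num)
  push_cast
  linarith

theorem le_log_log {n : ℕ} (hn : 3 ≤ n) :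
    0 < Real.log (Real.log 3) ∧ Real.log (Real.log 3) ≤ Real.log (Real.log n) := by
  have h1 : (1 : ℝ) < Real.log 3 := by
    rw [Real.lt_log_iff_exp_lt (by norm_num)]
    exact Real.exp_one_lt_three
  have h3 : (3 : ℝ) ≤ n := by exact_mod_cast hn
  exact ⟨Real.log_pos h1,
    Real.log_le_log (by linarith) (Real.log_le_log (by norm_num) h3)⟩

/-! ### The collision probability -/

/-- Each piece contributes `exp (-(β * r ^ 2) / k)` up to a constant factor above and a factor of
order `1 / t` below; taking `k`-th powers turns these into `exp (O (k * log t))`. -/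
theorem gaussianHash_collisionProb_bounds {d : ℕ} {R β : ℝ} (hR : 0 < R)
    (hβ : β ∈ Set.Ioc (0 : ℝ) 1) {x y : Pt d} (hxy : ‖x - y‖ ≤ R) :
    Real.exp (-(β * ‖x - y‖ ^ 2) - 60 * R ^ (4 / 3 : ℝ)) ≤
        (gaussianHash d R β).collisionProb x y ∧
      (gaussianHash d R β).collisionProb x y ≤
        Real.exp (-(β * ‖x - y‖ ^ 2) + 60 * R ^ (4 / 3 : ℝ)) := by
  have hR43 : 0 ≤ R ^ (4 / 3 : ℝ) := by positivity
  set r := ‖x - y‖ with hr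
  have hr0 : 0 ≤ r := norm_nonneg _
  have hr2 : r ^ 2 ≤ R ^ 2 := pow_le_pow_left₀ hr0 hxy 2
  have hβr : 0 ≤ β * r ^ 2 := mul_nonneg hβ.1.le (sq_nonneg r)
  rw [gaussianHash, ballCarving_collisionProb]
  -- For `R < 1` there are no pieces and all points collide; the kernel is then bounded below by
  -- `exp (-R ^ 2) ≥ exp (-R ^ (4/3))`, which is close enough.
  rcases Nat.eq_zero_or_pos (rootParam R) with hq | hq
  · have hR1 : R ≤ 1 := by
      have := lt_pow_rootParam hR.le
      rw [hq] at this
      norm_num at this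
      exact this.le
    have h2 : R ^ 2 ≤ R ^ (4 / 3 : ℝ) := by
      rw [← Real.rpow_natCast]
      exact Real.rpow_le_rpow_of_exponent_ge hR hR1 (by norm_num)
    have h3 : β * r ^ 2 ≤ R ^ 2 := by nlinarith [hβ.2, sq_nonneg r]
    rw [numPieces, hq]
    norm_num only [zero_pow, pow_zero]
    rw [Real.exp_le_one_iff, Real.one_le_exp_iff]
    constructor <;> linarith
  · have hq1 : (1 : ℝ) ≤ rootParam R := by exact_mod_cast hq
    set q : ℝ := (rootParam R : ℝ) with hqd
    set m : ℕ := 4096 * rootParam R ^ 5 with hm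
    have hdims : numDims R = 2 * m := by rw [numDims, hm]; ring
    have hm1 : 4096 ≤ m := by
      have : 1 ≤ rootParam R ^ 5 := Nat.one_le_pow _ _ hq
      omega
    have hmq : (m : ℝ) = 4096 * q ^ 5 := by rw [hm]; push_cast; rfl
    have hk : ((numPieces R : ℕ) : ℝ) = q ^ 5 := by rw [numPieces]; push_cast; rfl
    -- This is the parameter `C` of the lens averages. The scale is chosen so that `m * C = β * r ^
    -- 2 / k`.
    have hs : 8 * m * (projScale R β * r) ^ 2 = β * r ^ 2 / (q ^ 5 * m) := by
      rw [projScale, hdims, hk, mul_pow, div_pow,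
        Real.sq_sqrt (div_nonneg hβ.1.le (by positivity))]
      push_cast
      have : (m : ℝ) ≠ 0 := by rw [hmq]; positivity
      field_simp
      ring
    have hRq : R ≤ 16 * q ^ 4 := by
      refine (lt_pow_rootParam hR.le).le.trans ?_
      calc (q + 1) ^ 4 ≤ (2 * q) ^ 4 := pow_le_pow_left₀ (by linarith) (by linarith) 4
        _ = _ := by ring
    have hx : β * r ^ 2 ≤ 256 * q ^ 8 := by
      have h1 : β * r ^ 2 ≤ 1 * R ^ 2 := mul_le_mul hβ.2 hr2 (sq_nonneg r) zero_le_one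
      have h2 : R ^ 2 ≤ (16 * q ^ 4) ^ 2 := pow_le_pow_left₀ hR.le hRq 2
      linarith [show (16 * q ^ 4) ^ 2 = 256 * q ^ 8 by ring]
    have hC : 8 * m * (projScale R β * r) ^ 2 ≤ 1 / 16 / q ^ 2 := by
      rw [hs, hmq, div_le_div_iff₀ (by positivity) (by positivity)]
      calc β * r ^ 2 * q ^ 2 ≤ 256 * q ^ 8 * q ^ 2 := by gcongr
        _ = _ := by ring
    have hC1 : 8 * m * (projScale R β * r) ^ 2 ≤ 1 / 16 :=
      hC.trans (div_le_self (by norm_num) (one_le_pow₀ hq1))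
    -- With `C ≤ 1 / (16 * q ^ 2)` and `m = 4096 * q ^ 5`, the cubic error is at most `1 / q`; this
    -- is where the fifth power of `q` is needed.
    have hC3 : m * (8 * m * (projScale R β * r) ^ 2) ^ 3 ≤ 1 := by
      calc m * (8 * m * (projScale R β * r) ^ 2) ^ 3 ≤ m * (1 / 16 / q ^ 2) ^ 3 := by gcongr
        _ = 1 / q := by rw [hmq]; field_simp; norm_num
        _ ≤ 1 := by rw [div_le_one (by linarith)]; exact hq1
    have hup := integral_agreeProb_le hm1 hC1 hC3
    have hlo := le_integral_agreeProb hm1 (numTrials R) hC1 hC3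
    rw [numTrials, hdims] at hlo ⊢
    set I := ∫ g, agreeProb ((2 * m) ^ (2 * m)) 0 (fun j => projScale R β * r * g j)
      ∂stdNormal (2 * m) with hI
    have hmC : m * (8 * m * (projScale R β * r) ^ 2) = β * r ^ 2 / q ^ 5 := by
      rw [hs]
      have : (m : ℝ) ≠ 0 := by rw [hmq]; positivity
      field_simp
    rw [hmC] at hup hlo
    have hq5 : q ^ 5 ≠ 0 := by positivity
    have hq5R := rootParam_pow_five_le hR.le
    constructor
    · have hlog := log_numDims_le hq
      rw [hdims] at hlog
      have hm0 : (0 : ℝ) < ((2 * m : ℕ) : ℝ) := by push_cast; rw [hmq]; positivity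
      have e1 : Real.exp (-(β * r ^ 2 / q ^ 5) - 31) / (2 * m) =
          Real.exp (-(β * r ^ 2 / q ^ 5) - 31 - Real.log ((2 * m : ℕ) : ℝ)) := by
        rw [Real.exp_sub _ (Real.log _), Real.exp_log hm0]; push_cast; rfl
      rw [e1] at hlo
      have h1 := pow_le_pow_left₀ (Real.exp_pos _).le hlo (numPieces R)
      rw [← Real.exp_nat_mul] at h1
      refine le_trans (Real.exp_le_exp.mpr ?_) h1
      rw [hk]
      -- The loss in the exponent is `31 * q ^ 5` from the constants and `28 * q ^ 5 * q ^ (1/3)`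
      -- from the logarithm; together this is at most `59 * R ^ (4/3)`.
      have h2 := rootParam_rpow_le hR.le
      have h3 : q ^ 5 * Real.log ((2 * m : ℕ) : ℝ) ≤ q ^ 5 * (28 * q ^ (1 / 3 : ℝ)) := by gcongr
      have h4 : q ^ 5 * (β * r ^ 2 / q ^ 5) = β * r ^ 2 := by field_simp
      rw [mul_sub, mul_sub, mul_neg, h4]
      linarith
    · have h1 := pow_le_pow_left₀ (integral_nonneg fun g => agreeProb_nonneg _ _) hup (numPieces R)
      rw [← Real.exp_nat_mul] at h1
      refine h1.trans (Real.exp_le_exp.mpr ?_)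
      rw [hk]
      have h4 : q ^ 5 * (β * r ^ 2 / q ^ 5) = β * r ^ 2 := by field_simp
      rw [mul_add, mul_neg, h4]
      linarith

theorem gaussianHash_isScaleFree {C : ℝ} (hC : 60 ≤ C * Real.log (Real.log 3)) {n d : ℕ}
    {R β : ℝ} (hn : 3 ≤ n) (hR : 0 < R) (hβ : β ∈ Set.Ioc (0 : ℝ) 1) :
    (gaussianHash d R β).IsScaleFree gaussianKernel n R β
      (Real.exp (C * R ^ (4 / 3 : ℝ) * Real.log (Real.log n))) := by
  obtain ⟨hL, hLn⟩ := le_log_log hn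
  have hR43 : 0 ≤ R ^ (4 / 3 : ℝ) := by positivity
  have hC0 : 0 ≤ C := by
    by_contra h
    push Not at h
    nlinarith
  have hM : 60 * R ^ (4 / 3 : ℝ) ≤ C * R ^ (4 / 3 : ℝ) * Real.log (Real.log n) := by
    have : C * Real.log (Real.log 3) ≤ C * Real.log (Real.log n) := by gcongr
    nlinarith
  refine ⟨hβ, Real.one_le_exp (by linarith), fun P x hdiam i => ?_⟩
  have hb : Bornology.IsBounded (insert x (Set.range P)) :=
    ((Set.finite_range P).insert x).isBounded
  have hd : ‖x - P i‖ ≤ R := by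
    rw [← dist_eq_norm]
    exact (Metric.dist_le_diam_of_mem hb (Set.mem_insert _ _)
      (Set.mem_insert_of_mem _ (Set.mem_range_self i))).trans hdiam
  obtain ⟨h1, h2⟩ := gaussianHash_collisionProb_bounds hR hβ hd
  have hk : gaussianKernel x (P i) ^ β = Real.exp (-(β * ‖x - P i‖ ^ 2)) := by
    rw [gaussianKernel, ← Real.exp_mul]; congr 1; ring
  rw [hk, ← Real.exp_neg, ← Real.exp_add, ← Real.exp_add]
  exact ⟨le_trans (Real.exp_le_exp.mpr (by linarith)) h1,
    h2.trans (Real.exp_le_exp.mpr (by linarith))⟩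

/-! ### A structured language on top of the real RAM -/

namespace RealRAM

/-- Commands on registers and arrays. -/
inductive Cmd : Type
  | skip
  | const (a : ℕ) (z : ℤ)
  | unary (f : UnOp) (a b : ℕ)
  | binary (f : BinOp) (a b c : ℕ)
  | input (a b : ℕ)
  | uniform (a : ℕ)
  | gauss (a : ℕ)
  /-- `reg[a] := arr[r][reg[i]]` -/
  | load (a r i : ℕ)
  /-- `arr[r][reg[i]] := reg[b]` -/
  | store (r i b : ℕ)
  | seq (p q : Cmd)
  | ifLE (a b : ℕ) (p q : Cmd)
  | whileLT (a b : ℕ) (p : Cmd)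

/-- A configuration: registers, arrays, input and tape. -/
structure Cfg where
  reg : ℕ → ℝ
  arr : ℕ → ℕ → ℝ
  input : ℕ → ℝ
  tape : Tape

/-- Write a register. -/
def Cfg.set (A : Cfg) (a : ℕ) (v : ℝ) : Cfg := { A with reg := Function.update A.reg a v }

/-- Write an array entry. -/
def Cfg.setArr (A : Cfg) (r m : ℕ) (v : ℝ) : Cfg :=
  { A with arr := Function.update A.arr r (Function.update (A.arr r) m v) }

/-- Remove a sample from the uniform stream. -/
def Cfg.dropUniform (A : Cfg) : Cfg :=
  { A with tape := (fun k => A.tape.1 (k + 1), A.tape.2) }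

/-- Remove a sample from the Gaussian stream. -/
def Cfg.dropGauss (A : Cfg) : Cfg :=
  { A with tape := (A.tape.1, fun k => A.tape.2 (k + 1)) }

section CfgLemmas
variable (A : Cfg) (a r m : ℕ) (v : ℝ)

@[simp] theorem Cfg.set_reg (b : ℕ) : (A.set a v).reg b = if b = a then v else A.reg b := by
  simp [Cfg.set, Function.update_apply]
@[simp] theorem Cfg.set_arr : (A.set a v).arr = A.arr := rfl
@[simp] theorem Cfg.set_input : (A.set a v).input = A.input := rfl
@[simp] theorem Cfg.set_tape : (A.set a v).tape = A.tape := rfl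
@[simp] theorem Cfg.setArr_reg : (A.setArr r m v).reg = A.reg := rfl
@[simp] theorem Cfg.setArr_arr (r' : ℕ) : (A.setArr r m v).arr r' =
    if r' = r then Function.update (A.arr r) m v else A.arr r' := by
  simp [Cfg.setArr, Function.update_apply]
@[simp] theorem Cfg.setArr_input : (A.setArr r m v).input = A.input := rfl
@[simp] theorem Cfg.setArr_tape : (A.setArr r m v).tape = A.tape := rfl
@[simp] theorem Cfg.dropUniform_reg : A.dropUniform.reg = A.reg := rfl
@[simp] theorem Cfg.dropUniform_arr : A.dropUniform.arr = A.arr := rfl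
@[simp] theorem Cfg.dropUniform_input : A.dropUniform.input = A.input := rfl
@[simp] theorem Cfg.dropUniform_tape :
    A.dropUniform.tape = (fun k => A.tape.1 (k + 1), A.tape.2) := rfl
@[simp] theorem Cfg.dropGauss_reg : A.dropGauss.reg = A.reg := rfl
@[simp] theorem Cfg.dropGauss_arr : A.dropGauss.arr = A.arr := rfl
@[simp] theorem Cfg.dropGauss_input : A.dropGauss.input = A.input := rfl
@[simp] theorem Cfg.dropGauss_tape :
    A.dropGauss.tape = (A.tape.1, fun k => A.tape.2 (k + 1)) := rfl

end CfgLemmas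

/-- Started in configuration `A`, the command halts after `t` steps in configuration `B`. -/
inductive Cmd.Exec : Cmd → Cfg → ℕ → Cfg → Prop
  | skip (A : Cfg) : Exec .skip A 0 A
  | const (a : ℕ) (z : ℤ) (A : Cfg) : Exec (.const a z) A 1 (A.set a z)
  | unary (f : UnOp) (a b : ℕ) (A : Cfg) : Exec (.unary f a b) A 1 (A.set a (f.eval (A.reg b)))
  | binary (f : BinOp) (a b c : ℕ) (A : Cfg) :
      Exec (.binary f a b c) A 1 (A.set a (f.eval (A.reg b) (A.reg c)))
  | input (a b m : ℕ) (A : Cfg) (h : A.reg b = m) : Exec (.input a b) A 1 (A.set a (A.input m))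
  | uniform (a : ℕ) (A : Cfg) : Exec (.uniform a) A 1 (A.set a (A.tape.1 0)).dropUniform
  | gauss (a : ℕ) (A : Cfg) : Exec (.gauss a) A 1 (A.set a (A.tape.2 0)).dropGauss
  | load (a r i m : ℕ) (A : Cfg) (h : A.reg i = m) : Exec (.load a r i) A 5 (A.set a (A.arr r m))
  | store (r i b m : ℕ) (A : Cfg) (h : A.reg i = m) :
      Exec (.store r i b) A 5 (A.setArr r m (A.reg b))
  | seq {p q : Cmd} {A B D : Cfg} {t₁ t₂ : ℕ} (h₁ : Exec p A t₁ B) (h₂ : Exec q B t₂ D) :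
      Exec (.seq p q) A (t₁ + t₂) D
  | if_pos {a b : ℕ} {p q : Cmd} {A B : Cfg} {t : ℕ} (hc : A.reg a ≤ A.reg b)
      (h : Exec p A t B) : Exec (.ifLE a b p q) A (1 + t) B
  | if_neg {a b : ℕ} {p q : Cmd} {A B : Cfg} {t : ℕ} (hc : ¬ A.reg a ≤ A.reg b)
      (h : Exec q A t B) : Exec (.ifLE a b p q) A (1 + t) B
  | while_done {a b : ℕ} {p : Cmd} {A : Cfg} (hc : ¬ A.reg a < A.reg b) :
      Exec (.whileLT a b p) A 1 A
  | while_step {a b : ℕ} {p : Cmd} {A B D : Cfg} {t₁ t₂ : ℕ} (hc : A.reg a < A.reg b)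
      (h₁ : Exec p A t₁ B) (h₂ : Exec (.whileLT a b p) B t₂ D) :
      Exec (.whileLT a b p) A (1 + t₁ + t₂) D

/-! ### Translation of commands into machine programs. -/

/-- Compute the address of entry number `reg[i]` of array `r` in cell `60`. -/
def address (r i : ℕ) (p : Prog) : Prog :=
  .seq (.basic (.const 60 8)) (.seq (.basic (.binary .mul 60 60 i))
    (.seq (.basic (.const 61 (64 + r))) (.seq (.basic (.binary .add 60 60 61)) p)))

/-- The translation of commands into programs. -/
def Cmd.compile : Cmd → Prog
  | .skip => .skip
  | .const a z => .basic (.const a z)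
  | .unary f a b => .basic (.unary f a b)
  | .binary f a b c => .basic (.binary f a b c)
  | .input a b => .basic (.input a b)
  | .uniform a => .basic (.uniform a)
  | .gauss a => .basic (.gauss a)
  | .load a r i => address r i (.basic (.load a 60))
  | .store r i b => address r i (.basic (.store 60 b))
  | .seq p q => .seq p.compile q.compile
  | .ifLE a b p q => .ifLE a b p.compile q.compile
  | .whileLT a b p => .whileLT a b p.compile

/-- Register numbers are below `60` and array numbers below `8`. -/
def Cmd.WellFormed : Cmd → Prop
  | .skip => True
  | .const a _ => a < 60
  | .unary _ a b => a < 60 ∧ b < 60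
  | .binary _ a b c => a < 60 ∧ b < 60 ∧ c < 60
  | .input a b => a < 60 ∧ b < 60
  | .uniform a => a < 60
  | .gauss a => a < 60
  | .load a r i => a < 60 ∧ r < 8 ∧ i < 60
  | .store r i b => r < 8 ∧ i < 60 ∧ b < 60
  | .seq p q => p.WellFormed ∧ q.WellFormed
  | .ifLE a b p q => a < 60 ∧ b < 60 ∧ p.WellFormed ∧ q.WellFormed
  | .whileLT a b p => a < 60 ∧ b < 60 ∧ p.WellFormed

/-- The state of the machine represents the configuration. -/
structure Rep (s : State) (A : Cfg) : Prop where
  reg : ∀ a < 60, s.mem a = A.reg a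
  arr : ∀ r < 8, ∀ i, s.mem (64 + 8 * i + r) = A.arr r i
  input : s.input = A.input
  tape : s.tape = A.tape

@[simp] theorem State.write_mem (s : State) (a : ℕ) (v : ℝ) (b : ℕ) :
    (s.write a v).mem b = if b = a then v else s.mem b := by
  simp [State.write, Function.update_apply]

theorem Rep.write {s : State} {A : Cfg} (h : Rep s A) {a : ℕ} (ha : a < 60) (v : ℝ) :
    Rep (s.write a v) (A.set a v) where
  reg b hb := by simp [h.reg b hb]
  arr r hr i := by simp [h.arr r hr i, show 64 + 8 * i + r ≠ a by omega]
  input := h.input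
  tape := h.tape

/-- The eight arrays are interleaved: the residue modulo `8` determines the array and the quotient
the entry. Thus all arrays are unbounded and never overlap. -/
theorem Rep.write_arr {s : State} {A : Cfg} (h : Rep s A) {r : ℕ} (hr : r < 8) (m : ℕ) (v : ℝ) :
    Rep (s.write (64 + 8 * m + r) v) (A.setArr r m v) where
  reg b hb := by simp [h.reg b hb, show b ≠ 64 + 8 * m + r by omega]
  arr r' hr' i := by
    by_cases e : r' = r
    · subst e
      by_cases e' : i = m
      · subst e'; simp
      · simp [h.arr r' hr' i, e']
    · simp [h.arr r' hr' i, e, show 64 + 8 * i + r' ≠ 64 + 8 * m + r by omega]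
  input := h.input
  tape := h.tape

theorem Rep.write_scratch {s : State} {A : Cfg} (h : Rep s A) {a : ℕ} (ha : 60 ≤ a)
    (ha' : a < 64) (v : ℝ) : Rep (s.write a v) A where
  reg b hb := by simp [h.reg b hb, show b ≠ a by omega]
  arr r hr i := by simp [h.arr r hr i, show 64 + 8 * i + r ≠ a by omega]
  input := h.input
  tape := h.tape

/-- The four address instructions write only cells `60` and `61`, which represent neither registers
nor arrays; `p` is the fifth instruction, the actual access. -/
theorem exec_address {s : State} {A B : Cfg} (h : Rep s A) {r i m : ℕ} (hi : i < 60)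
    (hm : A.reg i = m) {p : Prog}
    (hp : ∀ s₁, Rep s₁ A → ⌊s₁.mem 60⌋₊ = 64 + 8 * m + r → ∃ s', RealRAM.Exec p s₁ 1 s' ∧ Rep s' B) :
    ∃ s', RealRAM.Exec (address r i p) s 5 s' ∧ Rep s' B := by
  set s₁ := s.write 60 8 with hs₁
  set s₂ := s₁.write 60 (s₁.mem 60 * s₁.mem i) with hs₂
  set s₃ := s₂.write 61 ((64 + r : ℤ) : ℝ) with hs₃
  set s₄ := s₃.write 60 (s₃.mem 60 + s₃.mem 61) with hs₄
  have h₁ : Rep s₁ A := h.write_scratch le_rfl (by norm_num) _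
  have h₂ : Rep s₂ A := h₁.write_scratch le_rfl (by norm_num) _
  have h₃ : Rep s₃ A := h₂.write_scratch (by norm_num) (by norm_num) _
  have h₄ : Rep s₄ A := h₃.write_scratch le_rfl (by norm_num) _
  have he : s₄.mem 60 = ((64 + 8 * m + r : ℕ) : ℝ) := by
    have hi' : s.mem i = m := by rw [h.reg i hi, hm]
    simp [hs₄, hs₃, hs₂, hs₁, show i ≠ 60 by omega, hi']
    ring
  obtain ⟨s', h5, h6⟩ := hp s₄ h₄ (by rw [he, Nat.floor_natCast])
  refine ⟨s', ?_, h6⟩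
  have e1 : RealRAM.Exec (.basic (.const 60 8)) s 1 s₁ := by
    have := RealRAM.Exec.basic (.const 60 8) s
    simpa [Instr.step] using this
  have e2 : RealRAM.Exec (.basic (.binary .mul 60 60 i)) s₁ 1 s₂ := .basic _ _
  have e3 : RealRAM.Exec (.basic (.const 61 (64 + r))) s₂ 1 s₃ := .basic _ _
  have e4 : RealRAM.Exec (.basic (.binary .add 60 60 61)) s₃ 1 s₄ := .basic _ _
  exact .seq e1 (.seq e2 (.seq e3 (.seq e4 h5)))

/-- The translation is correct and preserves the running time. -/
theorem Cmd.Exec.compile {c : Cmd} {A B : Cfg} {t : ℕ} (h : c.Exec A t B) :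
    c.WellFormed → ∀ s, Rep s A → ∃ s', RealRAM.Exec c.compile s t s' ∧ Rep s' B := by
  induction h with
  | skip A => exact fun _ s hs => ⟨s, .skip s, hs⟩
  | const a z A => exact fun hw s hs => ⟨_, .basic _ _, hs.write hw _⟩
  | unary f a b A =>
    intro hw s hs
    refine ⟨_, .basic _ _, ?_⟩
    rw [← hs.reg b hw.2]
    exact hs.write hw.1 _
  | binary f a b c A =>
    intro hw s hs
    refine ⟨_, .basic _ _, ?_⟩
    rw [← hs.reg b hw.2.1, ← hs.reg c hw.2.2]
    exact hs.write hw.1 _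
  | input a b m A h =>
    intro hw s hs
    refine ⟨_, .basic _ _, ?_⟩
    have : ⌊s.mem b⌋₊ = m := by rw [hs.reg b hw.2, h, Nat.floor_natCast]
    rw [← this, ← hs.input]
    exact hs.write hw.1 _
  | uniform a A =>
    intro hw s hs
    refine ⟨_, .basic _ _, ?_⟩
    have := hs.write hw (s.tape.1 0)
    rw [hs.tape] at this
    exact ⟨by simpa [Instr.step, hs.tape] using this.reg,
      by simpa [Instr.step, hs.tape] using this.arr, hs.input,
      by simp [Instr.step, hs.tape]⟩
  | gauss a A =>
    intro hw s hs
    refine ⟨_, .basic _ _, ?_⟩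
    have := hs.write hw (s.tape.2 0)
    rw [hs.tape] at this
    exact ⟨by simpa [Instr.step, hs.tape] using this.reg,
      by simpa [Instr.step, hs.tape] using this.arr, hs.input,
      by simp [Instr.step, hs.tape]⟩
  | load a r i m A h =>
    intro hw s hs
    refine exec_address hs hw.2.2 h fun s₁ h₁ he => ⟨_, .basic _ _, ?_⟩
    rw [← h₁.arr r hw.2.1, ← he]
    exact h₁.write hw.1 _
  | store r i b m A h =>
    intro hw s hs
    refine exec_address hs hw.2.1 h fun s₁ h₁ he => ⟨_, .basic _ _, ?_⟩
    have := h₁.write_arr hw.1 m (A.reg b)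
    rw [← he, ← h₁.reg b hw.2.2] at this
    rw [← h₁.reg b hw.2.2]
    exact this
  | seq h₁ h₂ ih₁ ih₂ =>
    intro hw s hs
    obtain ⟨s₁, e₁, r₁⟩ := ih₁ hw.1 s hs
    obtain ⟨s₂, e₂, r₂⟩ := ih₂ hw.2 s₁ r₁
    exact ⟨s₂, .seq e₁ e₂, r₂⟩
  | if_pos hc h ih =>
    intro hw s hs
    obtain ⟨s₁, e₁, r₁⟩ := ih hw.2.2.1 s hs
    exact ⟨s₁, .if_pos (by rwa [hs.reg _ hw.1, hs.reg _ hw.2.1]) e₁, r₁⟩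
  | if_neg hc h ih =>
    intro hw s hs
    obtain ⟨s₁, e₁, r₁⟩ := ih hw.2.2.2 s hs
    exact ⟨s₁, .if_neg (by rwa [hs.reg _ hw.1, hs.reg _ hw.2.1]) e₁, r₁⟩
  | while_done hc =>
    intro hw s hs
    exact ⟨s, .while_done (by rwa [hs.reg _ hw.1, hs.reg _ hw.2.1]), hs⟩
  | while_step hc h₁ h₂ ih₁ ih₂ =>
    intro hw s hs
    obtain ⟨s₁, e₁, r₁⟩ := ih₁ hw.2.2 s hs
    obtain ⟨s₂, e₂, r₂⟩ := ih₂ hw s₁ r₁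
    exact ⟨s₂, .while_step (by rwa [hs.reg _ hw.1, hs.reg _ hw.2.1]) e₁ e₂, r₂⟩

/-! ### Registers and arrays that are not written -/

/-- The registers that a command may write. -/
def Cmd.regs : Cmd → List ℕ
  | .skip | .store _ _ _ => []
  | .const a _ | .unary _ a _ | .binary _ a _ _ | .input a _ | .uniform a | .gauss a
  | .load a _ _ => [a]
  | .seq p q | .ifLE _ _ p q => p.regs ++ q.regs
  | .whileLT _ _ p => p.regs

/-- The arrays that a command may write. -/
def Cmd.arrs : Cmd → List ℕ
  | .store r _ _ => [r]
  | .seq p q | .ifLE _ _ p q => p.arrs ++ q.arrs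
  | .whileLT _ _ p => p.arrs
  | _ => []

/-- Whether a command may read the tape. -/
def Cmd.draws : Cmd → Bool
  | .uniform _ | .gauss _ => true
  | .seq p q | .ifLE _ _ p q => p.draws || q.draws
  | .whileLT _ _ p => p.draws
  | _ => false

/-- The configurations agree except for what the command may write. -/
structure Frame (c : Cmd) (A B : Cfg) : Prop where
  reg : ∀ a, a ∉ c.regs → B.reg a = A.reg a
  arr : ∀ r, r ∉ c.arrs → B.arr r = A.arr r
  input : B.input = A.input
  tape : c.draws = false → B.tape = A.tape

theorem Frame.refl (c : Cmd) (A : Cfg) : Frame c A A :=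
  ⟨fun _ _ => rfl, fun _ _ => rfl, rfl, fun _ => rfl⟩

theorem Frame.trans {c : Cmd} {A B D : Cfg} (h₁ : Frame c A B) (h₂ : Frame c B D) :
    Frame c A D :=
  ⟨fun a ha => (h₂.reg a ha).trans (h₁.reg a ha), fun a ha => (h₂.arr a ha).trans (h₁.arr a ha),
    h₂.input.trans h₁.input, fun h => (h₂.tape h).trans (h₁.tape h)⟩

theorem Frame.mono {c c' : Cmd} {A B : Cfg} (h : Frame c A B) (h₁ : ∀ a ∈ c.regs, a ∈ c'.regs)
    (h₂ : ∀ a ∈ c.arrs, a ∈ c'.arrs) (h₃ : c'.draws = false → c.draws = false) : Frame c' A B :=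
  ⟨fun a ha => h.reg a fun h' => ha (h₁ a h'), fun a ha => h.arr a fun h' => ha (h₂ a h'),
    h.input, fun h' => h.tape (h₃ h')⟩

/-- Preservation of data becomes a syntactic check, so the later verifications can discharge it by
`decide`. -/
theorem Cmd.Exec.frame {c : Cmd} {A B : Cfg} {t : ℕ} (h : c.Exec A t B) : Frame c A B := by
  induction h with
  | skip A => exact .refl _ _
  | const a z A => exact ⟨fun b hb => by simp_all [Cmd.regs], fun _ _ => rfl, rfl, fun _ => rfl⟩
  | unary f a b A =>
    exact ⟨fun b hb => by simp_all [Cmd.regs], fun _ _ => rfl, rfl, fun _ => rfl⟩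
  | binary f a b c A =>
    exact ⟨fun b hb => by simp_all [Cmd.regs], fun _ _ => rfl, rfl, fun _ => rfl⟩
  | input a b m A h =>
    exact ⟨fun b hb => by simp_all [Cmd.regs], fun _ _ => rfl, rfl, fun _ => rfl⟩
  | uniform a A =>
    exact ⟨fun b hb => by simp_all [Cmd.regs], fun _ _ => rfl, rfl, fun h => by cases h⟩
  | gauss a A =>
    exact ⟨fun b hb => by simp_all [Cmd.regs], fun _ _ => rfl, rfl, fun h => by cases h⟩
  | load a r i m A h =>
    exact ⟨fun b hb => by simp_all [Cmd.regs], fun _ _ => rfl, rfl, fun _ => rfl⟩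
  | store r i b m A h =>
    exact ⟨fun b hb => rfl, fun b hb => by simp_all [Cmd.arrs], rfl, fun _ => rfl⟩
  | seq h₁ h₂ ih₁ ih₂ =>
    exact (ih₁.mono (by simp +contextual [Cmd.regs]) (by simp +contextual [Cmd.arrs])
      (by simp +contextual [Cmd.draws])).trans
      (ih₂.mono (by simp +contextual [Cmd.regs]) (by simp +contextual [Cmd.arrs])
      (by simp +contextual [Cmd.draws]))
  | if_pos hc h ih =>
    exact ih.mono (by simp +contextual [Cmd.regs]) (by simp +contextual [Cmd.arrs])
      (by simp +contextual [Cmd.draws])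
  | if_neg hc h ih =>
    exact ih.mono (by simp +contextual [Cmd.regs]) (by simp +contextual [Cmd.arrs])
      (by simp +contextual [Cmd.draws])
  | while_done hc => exact .refl _ _
  | while_step hc h₁ h₂ ih₁ ih₂ => exact Frame.trans (c := .whileLT _ _ _) (ih₁.mono (fun _ h => h) (fun _ h => h) id) ih₂

/-! ### Rules for total correctness -/

/-- The command halts, and running time and final configuration satisfy `Q`. -/
def Runs (c : Cmd) (A : Cfg) (Q : ℕ → Cfg → Prop) : Prop :=
  ∃ t B, c.Exec A t B ∧ Q t B

theorem Runs.mono {c : Cmd} {A : Cfg} {Q Q' : ℕ → Cfg → Prop} (h : Runs c A Q)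
    (hQ : ∀ t B, Frame c A B → Q t B → Q' t B) : Runs c A Q' := by
  obtain ⟨t, B, h1, h2⟩ := h
  exact ⟨t, B, h1, hQ t B h1.frame h2⟩

section Rules
variable {A : Cfg} {Q : ℕ → Cfg → Prop}

theorem runs_skip (h : Q 0 A) : Runs .skip A Q := ⟨_, _, .skip _, h⟩
theorem runs_const {a : ℕ} {z : ℤ} (h : Q 1 (A.set a z)) : Runs (.const a z) A Q :=
  ⟨_, _, .const _ _ _, h⟩
theorem runs_unary {f : UnOp} {a b : ℕ} (h : Q 1 (A.set a (f.eval (A.reg b)))) :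
    Runs (.unary f a b) A Q := ⟨_, _, .unary _ _ _ _, h⟩
theorem runs_binary {f : BinOp} {a b c : ℕ} (h : Q 1 (A.set a (f.eval (A.reg b) (A.reg c)))) :
    Runs (.binary f a b c) A Q := ⟨_, _, .binary _ _ _ _ _, h⟩
theorem runs_input {a b : ℕ} (m : ℕ) (hm : A.reg b = m) (h : Q 1 (A.set a (A.input m))) :
    Runs (.input a b) A Q := ⟨_, _, .input _ _ _ _ hm, h⟩
theorem runs_uniform {a : ℕ} (h : Q 1 (A.set a (A.tape.1 0)).dropUniform) :
    Runs (.uniform a) A Q := ⟨_, _, .uniform _ _, h⟩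
theorem runs_gauss {a : ℕ} (h : Q 1 (A.set a (A.tape.2 0)).dropGauss) :
    Runs (.gauss a) A Q := ⟨_, _, .gauss _ _, h⟩
theorem runs_load {a r i : ℕ} (m : ℕ) (hm : A.reg i = m) (h : Q 5 (A.set a (A.arr r m))) :
    Runs (.load a r i) A Q := ⟨_, _, .load _ _ _ _ _ hm, h⟩
theorem runs_store {r i b : ℕ} (m : ℕ) (hm : A.reg i = m) (h : Q 5 (A.setArr r m (A.reg b))) :
    Runs (.store r i b) A Q := ⟨_, _, .store _ _ _ _ _ hm, h⟩

theorem runs_seq {p q : Cmd} (h : Runs p A fun t B => Runs q B fun t' D => Q (t + t') D) :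
    Runs (.seq p q) A Q := by
  obtain ⟨t, B, h1, t', D, h2, h3⟩ := h
  exact ⟨_, _, .seq h1 h2, h3⟩

theorem runs_ifLE {a b : ℕ} {p q : Cmd}
    (h₁ : A.reg a ≤ A.reg b → Runs p A fun t B => Q (1 + t) B)
    (h₂ : ¬ A.reg a ≤ A.reg b → Runs q A fun t B => Q (1 + t) B) : Runs (.ifLE a b p q) A Q := by
  by_cases hc : A.reg a ≤ A.reg b
  · obtain ⟨t, B, h, hQ⟩ := h₁ hc
    exact ⟨_, _, .if_pos hc h, hQ⟩
  · obtain ⟨t, B, h, hQ⟩ := h₂ hc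
    exact ⟨_, _, .if_neg hc h, hQ⟩

/-- A loop with counter `reg[a]` running from `0` to `reg[b] = n`. -/
theorem runs_for {a b n K : ℕ} {p : Cmd} (Inv : ℕ → Cfg → Prop) (hb : b ∉ p.regs)
    (hA : A.reg a = 0) (hn : A.reg b = n) (h0 : Inv 0 A)
    (step : ∀ i < n, ∀ B, Frame p A B → B.reg a = i → Inv i B →
      Runs p B fun t D => t ≤ K ∧ D.reg a = i + 1 ∧ Inv (i + 1) D)
    (hQ : ∀ t B, Frame (.whileLT a b p) A B → t ≤ n * (K + 1) + 1 → B.reg a = n → Inv n B → Q t B) :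
    Runs (.whileLT a b p) A Q := by
  -- The induction is on the number `j` of remaining iterations. The frame of the body keeps the
  -- bound `reg[b]` equal to `n`.
  have key : ∀ j i, i + j = n → ∀ B, Frame p A B → B.reg a = i → Inv i B →
      ∃ t D, (Cmd.whileLT a b p).Exec B t D ∧ t ≤ j * (K + 1) + 1 ∧ Frame p A D ∧
        D.reg a = n ∧ Inv n D := by
    intro j
    induction j with
    | zero =>
      intro i hi B hF hBa hI
      obtain rfl : i = n := by omega
      exact ⟨1, B, .while_done (by rw [hBa, hF.reg b hb, hn]; exact lt_irrefl _), by omega, hF,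
        hBa, hI⟩
    | succ j ih =>
      intro i hi B hF hBa hI
      obtain ⟨t, D, h1, h2, h3, h4⟩ := step i (by omega) B hF hBa hI
      obtain ⟨t', E, h5, h6, h7⟩ := ih (i + 1) (by omega) D (hF.trans h1.frame)
        (by rw [h3]; push_cast; rfl) h4
      refine ⟨1 + t + t', E, .while_step ?_ h1 h5, ?_, h7⟩
      · rw [hBa, hF.reg b hb, hn]
        exact_mod_cast (by omega : i < n)
      · rw [add_mul]; omega
  obtain ⟨t, D, h1, h2, h3, h4, h5⟩ := key n 0 (by omega) A (.refl _ _) (by simpa using hA) h0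
  exact ⟨t, D, h1, hQ t D h1.frame h2 h4 h5⟩

end Rules

/-- Sequential composition of a list of commands. -/
def seqs : List Cmd → Cmd
  | [] => .skip
  | [c] => c
  | c :: l => .seq c (seqs l)

/-! ### Space -/

/-- An execution of `t` steps changes at most `t` cells. -/
theorem Exec.support {p : Prog} {s s' : State} {t : ℕ} (h : Exec p s t s') :
    (Function.support s.mem).Finite → (Function.support s'.mem).Finite ∧
      (Function.support s'.mem).ncard ≤ (Function.support s.mem).ncard + t := by
  have hw : ∀ (m : ℕ → ℝ) (a : ℕ) (v : ℝ), (Function.support m).Finite →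
      (Function.support (Function.update m a v)).Finite ∧
      (Function.support (Function.update m a v)).ncard ≤ (Function.support m).ncard + 1 := by
    intro m a v hm
    have hsub : Function.support (Function.update m a v) ⊆ insert a (Function.support m) := by
      intro b hb
      by_cases e : b = a
      · exact Or.inl e
      · right
        simpa [Function.update_apply, e] using hb
    exact ⟨(hm.insert a).subset hsub, (Set.ncard_le_ncard hsub (hm.insert a)).trans
      (Set.ncard_insert_le _ _)⟩
  induction h with
  | skip s => exact fun h => ⟨h, le_rfl⟩
  | basic i s => intro h; cases i <;> exact hw _ _ _ h
  | seq h₁ h₂ ih₁ ih₂ =>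
    intro h
    obtain ⟨h1, h2⟩ := ih₁ h
    obtain ⟨h3, h4⟩ := ih₂ h1
    exact ⟨h3, by omega⟩
  | if_pos hc h ih => intro h; exact ⟨(ih h).1, by have := (ih h).2; omega⟩
  | if_neg hc h ih => intro h; exact ⟨(ih h).1, by have := (ih h).2; omega⟩
  | while_done hc => exact fun h => ⟨h, by omega⟩
  | while_step hc h₁ h₂ ih₁ ih₂ =>
    intro h
    obtain ⟨h1, h2⟩ := ih₁ h
    obtain ⟨h3, h4⟩ := ih₂ h1
    exact ⟨h3, by omega⟩

end RealRAM

namespace RealRAM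

/-! ### Evaluation of the hash function

Registers: `2` number of points, `3` dimension, `4` number of pieces, `5` projection dimension,
`6` number of trials, `7` scaling factor, `8` to `10` the constants `1`, `1/2`, `1/16`, `11` hash
value, `12` piece, `13` position in the Gaussian samples, `14` position in the uniform samples,
`15` and `16` coordinate counters, `17` accumulator, `21` index of the last hit, `22` trial.

Arrays: `0` data points, `1` Gaussian samples, `2` uniform samples, `3` projected point,
`4` buckets, `5` current point. -/

/-- The registers `2, …, 10` hold the parameters. -/
structure HasParams (A : Cfg) (n d k t N : ℕ) (σ : ℝ) : Prop where
  r2 : A.reg 2 = n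
  r3 : A.reg 3 = d
  r4 : A.reg 4 = k
  r5 : A.reg 5 = t
  r6 : A.reg 6 = N
  r7 : A.reg 7 = σ
  r8 : A.reg 8 = 1
  r9 : A.reg 9 = 1 / 2
  r10 : A.reg 10 = 1 / 16

/-- The command does not write the registers `2, …, 10`. -/
def Cmd.KeepsParams (c : Cmd) : Prop := ∀ a ∈ c.regs, a < 2 ∨ 10 < a

instance (c : Cmd) : Decidable c.KeepsParams := by unfold Cmd.KeepsParams; infer_instance

theorem HasParams.frame {A B : Cfg} {n d k t N : ℕ} {σ : ℝ} (h : HasParams A n d k t N σ)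
    {c : Cmd} (hF : Frame c A B) (hc : c.KeepsParams) : HasParams B n d k t N σ := by
  have e : ∀ a, ¬ (a < 2 ∨ 10 < a) → B.reg a = A.reg a :=
    fun a ha => hF.reg a fun h' => ha (hc a h')
  exact ⟨(e 2 (by decide)).trans h.r2, (e 3 (by decide)).trans h.r3, (e 4 (by decide)).trans h.r4,
    (e 5 (by decide)).trans h.r5, (e 6 (by decide)).trans h.r6, (e 7 (by decide)).trans h.r7,
    (e 8 (by decide)).trans h.r8, (e 9 (by decide)).trans h.r9, (e 10 (by decide)).trans h.r10⟩

theorem HasParams.set {A : Cfg} {n d k t N : ℕ} {σ : ℝ} (h : HasParams A n d k t N σ) {a : ℕ}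
    (ha : a < 2 ∨ 10 < a) (v : ℝ) : HasParams (A.set a v) n d k t N σ := by
  constructor <;> rw [Cfg.set_reg, if_neg (by omega)]
  exacts [h.r2, h.r3, h.r4, h.r5, h.r6, h.r7, h.r8, h.r9, h.r10]

/-- Accumulate the inner product of the current point and a row of the random matrix. -/
def innerLoop : Cmd := .whileLT 16 3 (seqs [.load 18 1 13, .load 19 5 16, .binary .mul 18 18 19,
  .binary .add 17 17 18, .binary .add 13 13 8, .binary .add 16 16 8])

/-- Compute all coordinates of the projected point. -/
def projectLoop : Cmd := .whileLT 15 5 (seqs [.const 17 0, .const 16 0, innerLoop,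
  .binary .mul 17 17 7, .store 3 15 17, .binary .add 15 15 8])

/-- Accumulate the squared distance of the projected point and a center on the torus. -/
def distLoop : Cmd := .whileLT 15 5 (seqs [.load 18 3 15, .load 19 2 14, .binary .sub 18 18 19,
  .binary .add 19 18 9, .unary .floor 19 19, .binary .sub 18 18 19, .binary .mul 18 18 18,
  .binary .add 17 17 18, .binary .add 14 14 8, .binary .add 15 15 8])

/-- Find the last hit. -/
def trialLoop : Cmd := .whileLT 22 6 (seqs [.const 17 0, .const 15 0, distLoop,
  .binary .add 22 22 8, .ifLE 17 10 (.binary .mul 21 22 8) .skip])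

/-- Compute the hash value from its pieces. -/
def pieceLoop : Cmd := .whileLT 12 4 (seqs [.const 15 0, projectLoop, .const 21 0, .const 22 0,
  trialLoop, .binary .add 18 6 8, .binary .mul 11 11 18, .binary .add 11 11 21,
  .binary .add 12 12 8])

/-- Compute the hash value of the current point. -/
def hashCmd : Cmd := seqs [.const 11 0, .const 12 0, .const 13 0, .const 14 0, pieceLoop]

variable {A : Cfg} {n d k t N : ℕ} {σ : ℝ} {Q : ℕ → Cfg → Prop}

/-- The pointer in register `13` continues through the Gaussian samples from call to call, so
successive calls use successive rows of the matrix. -/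
theorem runs_innerLoop (hp : HasParams A n d k t N σ) {gp : ℕ} (h13 : A.reg 13 = gp)
    (h16 : A.reg 16 = 0) (h17 : A.reg 17 = 0)
    (hQ : ∀ T B, Frame innerLoop A B → T ≤ 15 * d + 1 → B.reg 13 = (gp + d : ℕ) →
      B.reg 17 = ∑ i ∈ Finset.range d, A.arr 1 (gp + i) * A.arr 5 i → Q T B) :
    Runs innerLoop A Q := by
  refine runs_for (n := d) (K := 14) (fun i B => B.reg 13 = (gp + i : ℕ) ∧
    B.reg 17 = ∑ i ∈ Finset.range i, A.arr 1 (gp + i) * A.arr 5 i) (by decide) h16 hp.r3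
    (by simp [h13, h17]) (fun i hi B hF h16 hI => ?_)
    (fun T B hF hT _ hI => hQ T B hF (by omega) hI.1 hI.2)
  have hp' := hp.frame hF (by decide)
  obtain ⟨h13, h17⟩ := hI
  refine runs_seq (runs_load _ h13 <| runs_seq <| runs_load i (by simpa using h16) <|
    runs_seq <| runs_binary <| runs_seq <| runs_binary <| runs_seq <| runs_binary <|
    runs_binary ?_)
  simp [BinOp.eval, h13, h16, h17, hp'.r8, hF.arr 1 (by decide), hF.arr 5 (by decide),
    Finset.sum_range_succ, add_assoc]

theorem runs_projectLoop (hp : HasParams A n d k t N σ) {row : ℕ}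
    (h13 : A.reg 13 = (row * d : ℕ)) (h15 : A.reg 15 = 0)
    (hQ : ∀ T B, Frame projectLoop A B → T ≤ t * (15 * d + 12) + 1 →
      B.reg 13 = ((row + t) * d : ℕ) →
      (∀ j < t, B.arr 3 j = projCoord d σ (A.arr 1) (A.arr 5) (row + j)) → Q T B) :
    Runs projectLoop A Q := by
  refine runs_for (n := t) (K := 15 * d + 11) (fun i B => B.reg 13 = ((row + i) * d : ℕ) ∧
    ∀ j < i, B.arr 3 j = projCoord d σ (A.arr 1) (A.arr 5) (row + j)) (by decide) h15 hp.r5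
    (by simp [h13]) (fun i hi B hF h15 hI => ?_)
    (fun T B hF hT _ hI => hQ T B hF hT hI.1 hI.2)
  have hp' := hp.frame hF (by decide)
  obtain ⟨h13, h3⟩ := hI
  refine runs_seq (runs_const <| runs_seq <| runs_const <| runs_seq <|
    runs_innerLoop ((hp'.set (by decide) _).set (by decide) _) (gp := (row + i) * d)
      (by simpa using h13) (by simp) (by simp) fun T D hF' hT h13 h17 => ?_)
  have hp'' := ((hp'.set (a := 17) (by decide) _).set (a := 16) (by decide) _).frame hF'
    (by decide)
  have h15' : D.reg 15 = i := by rw [hF'.reg 15 (by decide)]; simpa using h15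
  refine runs_seq (runs_binary <| runs_seq <| runs_store i (by simpa using h15') <|
    runs_binary ?_)
  refine ⟨by omega, by simp [BinOp.eval, h15', hp''.r8], ?_, fun j hj => ?_⟩
  · simp [h13]; ring
  · simp [BinOp.eval, Function.update_apply, hF'.arr 3 (by decide)]
    split_ifs with e
    · subst e
      rw [h17, hp''.r7, projCoord]
      simp [hF.arr 1 (by decide), hF.arr 5 (by decide)]
    · exact h3 j (by omega)

theorem runs_distLoop (hp : HasParams A n d k t N σ) {row : ℕ} (h14 : A.reg 14 = (row * t : ℕ))
    (h15 : A.reg 15 = 0) (h17 : A.reg 17 = 0)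
    (hQ : ∀ T B, Frame distLoop A B → T ≤ 19 * t + 1 → B.reg 14 = ((row + 1) * t : ℕ) →
      B.reg 17 = trialDist t (A.arr 3) (A.arr 2) row → Q T B) :
    Runs distLoop A Q := by
  refine runs_for (n := t) (K := 18) (fun i B => B.reg 14 = (row * t + i : ℕ) ∧
    B.reg 17 = ∑ j ∈ Finset.range i, wrap (A.arr 3 j - A.arr 2 (row * t + j)) ^ 2) (by decide)
    h15 hp.r5 (by simp [h14, h17]) (fun i hi B hF h15 hI => ?_)
    (fun T B hF hT _ hI => hQ T B hF (by omega) (by rw [hI.1]; congr 1; ring) hI.2)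
  have hp' := hp.frame hF (by decide)
  obtain ⟨h14, h17⟩ := hI
  refine runs_seq (runs_load i (by simpa using h15) <| runs_seq <|
    runs_load (row * t + i) (by simpa using h14) <|
    runs_seq <| runs_binary <| runs_seq <| runs_binary <| runs_seq <| runs_unary <|
    runs_seq <| runs_binary <| runs_seq <| runs_binary <| runs_seq <| runs_binary <|
    runs_seq <| runs_binary <| runs_binary ?_)
  simp [BinOp.eval, UnOp.eval, h14, h15, h17, hp'.r8, hp'.r9, hF.arr 3 (by decide),
    hF.arr 2 (by decide), Finset.sum_range_succ, add_assoc, wrap, sq]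

theorem runs_trialLoop (hp : HasParams A n d k t N σ) {row : ℕ}
    (h14 : A.reg 14 = (row * t : ℕ)) (h21 : A.reg 21 = 0) (h22 : A.reg 22 = 0)
    (hQ : ∀ T B, Frame trialLoop A B → T ≤ N * (19 * t + 7) + 1 →
      B.reg 14 = ((row + N) * t : ℕ) →
      B.reg 21 = lastHit (fun m => trialDist t (A.arr 3) (A.arr 2) (row + m)) N → Q T B) :
    Runs trialLoop A Q := by
  refine runs_for (n := N) (K := 19 * t + 6) (fun i B => B.reg 14 = ((row + i) * t : ℕ) ∧
    B.reg 21 = lastHit (fun m => trialDist t (A.arr 3) (A.arr 2) (row + m)) i) (by decide)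
    h22 hp.r6 (by simp [h14, h21, lastHit]) (fun i hi B hF h22 hI => ?_)
    (fun T B hF hT _ hI => hQ T B hF hT hI.1 hI.2)
  have hp' := hp.frame hF (by decide)
  obtain ⟨h14, h21⟩ := hI
  refine runs_seq (runs_const <| runs_seq <| runs_const <| runs_seq <|
    runs_distLoop ((hp'.set (by decide) _).set (by decide) _) (row := row + i)
      (by simpa using h14) (by simp) (by simp) fun T D hF' hT h14 h17 => ?_)
  have hp'' := ((hp'.set (a := 17) (by decide) _).set (a := 15) (by decide) _).frame hF'
    (by decide)
  have h22' : D.reg 22 = i := by rw [hF'.reg 22 (by decide)]; simpa using h22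
  have h21' : D.reg 21 = B.reg 21 := by rw [hF'.reg 21 (by decide)]; simp
  simp only [Cfg.set_arr, hF.arr 3 (by decide), hF.arr 2 (by decide)] at h17
  have h17' : D.reg 17 ≤ D.reg 10 ↔ trialDist t (A.arr 3) (A.arr 2) (row + i) ≤ 1 / 16 := by
    rw [h17, hp''.r10]
  -- The trial counter is incremented before the test, so a hit in trial `i` is recorded as `i + 1`,
  -- and `0` means that there is no hit.
  refine runs_seq (runs_binary <| runs_ifLE (fun hc => runs_binary ?_) fun hc => runs_skip ?_)
  · simp only [Cfg.set_reg] at hc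
    replace hc := h17'.mp (by simpa using hc)
    refine ⟨by omega, by simp [BinOp.eval, h22', hp''.r8], ?_, ?_⟩
    · simp [h14]; exact Or.inl (by ring)
    · simp [BinOp.eval, h22', hp''.r8, lastHit, if_pos (by simpa using hc)]
  · simp only [Cfg.set_reg] at hc
    replace hc := fun h => hc (by simpa using h17'.mpr h)
    refine ⟨by omega, by simp [BinOp.eval, h22', hp''.r8], ?_, ?_⟩
    · simp [h14]; exact Or.inl (by ring)
    · simp only [lastHit, if_neg hc, ← h21, ← h21']
      simp

theorem trialDist_congr {z z' u u' : ℕ → ℝ} {row : ℕ} (hz : ∀ j < t, z j = z' j)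
    (hu : ∀ j < t, u (row * t + j) = u' (row * t + j)) :
    trialDist t z u row = trialDist t z' u' row := by
  refine Finset.sum_congr rfl fun j hj => ?_
  rw [hz j (Finset.mem_range.mp hj), hu j (Finset.mem_range.mp hj)]

theorem lastHit_congr {D D' : ℕ → ℝ} {N : ℕ} (h : ∀ m < N, D m = D' m) :
    lastHit D N = lastHit D' N := by
  induction N with
  | zero => rfl
  | succ N ih => rw [lastHit, lastHit, h N (by omega), ih fun m hm => h m (by omega)]

/-- The sample pointers `13` and `14` are not reset between pieces; after `l` pieces they stand at
`l * t * d` and `l * N * t`, where the blocks of piece `l` begin. -/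
theorem runs_pieceLoop (hp : HasParams A n d k t N σ) (h11 : A.reg 11 = 0) (h12 : A.reg 12 = 0)
    (h13 : A.reg 13 = 0) (h14 : A.reg 14 = 0)
    (hQ : ∀ T B, Frame pieceLoop A B → T ≤ k * (t * (15 * d + 12) + N * (19 * t + 7) + 10) + 1 →
      B.reg 11 = hashCode d t N σ (A.arr 1) (A.arr 2) (A.arr 5) k → Q T B) :
    Runs pieceLoop A Q := by
  refine runs_for (n := k) (K := t * (15 * d + 12) + N * (19 * t + 7) + 9) (fun l B =>
    B.reg 13 = (l * t * d : ℕ) ∧ B.reg 14 = (l * N * t : ℕ) ∧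
    B.reg 11 = hashCode d t N σ (A.arr 1) (A.arr 2) (A.arr 5) l) (by decide)
    h12 hp.r4 (by simp [h11, h13, h14, hashCode]) (fun l hl B hF h12 hI => ?_)
    (fun T B hF hT _ hI => hQ T B hF hT hI.2.2)
  have hp' := hp.frame hF (by decide)
  obtain ⟨h13, h14, h11⟩ := hI
  have hp1 := hp'.set (a := 15) (by decide) 0
  refine runs_seq (runs_const <| runs_seq <| runs_projectLoop (by simpa using hp1) (row := l * t)
    (by simpa using h13) (by simp) fun T D hF' hT h13 h3 => ?_)
  have hp2 := hp1.frame (by simpa using hF') (c := projectLoop) (by decide)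
  refine runs_seq (runs_const <| runs_seq <| runs_const <| runs_seq <|
    runs_trialLoop ((hp2.set (by decide) _).set (by decide) _) (row := l * N)
      (by simpa [hF'.reg 14 (by decide)] using h14) (by simp) (by simp)
      fun T' E hF'' hT' h14 h21 => ?_)
  have hp3 := ((hp2.set (a := 21) (by decide) _).set (a := 22) (by decide) _).frame hF''
    (by decide)
  have h12' : E.reg 12 = l := by
    simpa [hF''.reg 12 (by decide), hF'.reg 12 (by decide)] using h12
  have h13' : E.reg 13 = ((l * t + t) * d : ℕ) := by
    simpa [hF''.reg 13 (by decide)] using h13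
  have h11' : E.reg 11 = hashCode d t N σ (A.arr 1) (A.arr 2) (A.arr 5) l := by
    simpa [hF''.reg 11 (by decide), hF'.reg 11 (by decide)] using h11
  have h21' : E.reg 21 = pieceIndex d t N σ (A.arr 1) (A.arr 2) (A.arr 5) l := by
    rw [h21, pieceIndex]
    congr 1
    refine lastHit_congr fun m _ => trialDist_congr (fun j hj => ?_) fun j _ => ?_
    · simp [h3 j hj, hF.arr 1 (by decide), hF.arr 5 (by decide)]
    · simp [hF'.arr 2 (by decide), hF.arr 2 (by decide)]
  refine runs_seq (runs_binary <| runs_seq <| runs_binary <| runs_seq <| runs_binary <|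
    runs_binary ?_)
  refine ⟨by omega, by simp [BinOp.eval, h12', hp3.r8], ?_, ?_, ?_⟩
  · simp [h13']; exact Or.inl (by ring)
  · simp [h14]; exact Or.inl (by ring)
  · simp [BinOp.eval, h11', h21', hp3.r6, hp3.r8, hashCode]

/-- The hash value of the current point is computed in time `O(d * (1 + k * t * N))`. -/
theorem runs_hashCmd (hp : HasParams A n d k t N σ)
    (hQ : ∀ T B, Frame hashCmd A B → T ≤ k * (t * (15 * d + 12) + N * (19 * t + 7) + 10) + 5 →
      B.reg 11 = hashCode d t N σ (A.arr 1) (A.arr 2) (A.arr 5) k → Q T B) :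
    Runs hashCmd A Q := by
  suffices h : Runs hashCmd A fun T B =>
      T ≤ k * (t * (15 * d + 12) + N * (19 * t + 7) + 10) + 5 ∧
      B.reg 11 = hashCode d t N σ (A.arr 1) (A.arr 2) (A.arr 5) k from
    h.mono fun T B hF h => hQ T B hF h.1 h.2
  have hp4 := (((hp.set (a := 11) (by decide) 0).set (a := 12) (by decide) 0).set
    (a := 13) (by decide) 0).set (a := 14) (by decide) 0
  refine runs_seq (runs_const <| runs_seq <| runs_const <| runs_seq <| runs_const <| runs_seq <|
    runs_const <| runs_pieceLoop (by simpa using hp4) (by simp) (by simp) (by simp) (by simp)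
    fun T B _ hT h11 => ⟨by omega, by simpa using h11⟩)

end RealRAM

/-! ### The bucket table -/

theorem mul_add_lt_mul {a b A B : ℕ} (ha : a < A) (hb : b < B) : a * B + b < A * B :=
  calc a * B + b < a * B + B := by omega
    _ = (a + 1) * B := by ring
    _ ≤ A * B := Nat.mul_le_mul_right _ ha

/-- The hash value depends only on the samples that it uses. -/
theorem hashCode_congr {d t N : ℕ} {σ : ℝ} {g g' u u' x x' : ℕ → ℝ} {k : ℕ}
    (hg : ∀ m < k * t * d, g m = g' m) (hu : ∀ m < k * N * t, u m = u' m)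
    (hx : ∀ i < d, x i = x' i) :
    hashCode d t N σ g u x k = hashCode d t N σ g' u' x' k := by
  have key : ∀ l ≤ k, hashCode d t N σ g u x l = hashCode d t N σ g' u' x' l := by
    intro l
    induction l with
    | zero => exact fun _ => rfl
    | succ l ih =>
      intro hl
      rw [hashCode, hashCode, ih (by omega)]
      congr 1
      refine RealRAM.lastHit_congr fun m hm => RealRAM.trialDist_congr (fun j hj => ?_) fun j hj => ?_
      · simp only [projCoord]
        congr 1
        refine Finset.sum_congr rfl fun i hi => ?_
        rw [Finset.mem_range] at hi
        rw [hx i hi, hg]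
        exact mul_add_lt_mul (mul_add_lt_mul hl hj) hi
      · exact hu _ (mul_add_lt_mul (mul_add_lt_mul hl hm) hj)
  exact key k le_rfl

/-- The indices below `p` with key `v`. -/
def bucketList (key : ℕ → ℕ) (p v : ℕ) : List ℕ := (List.range p).filter fun i => key i = v

theorem bucketList_succ (key : ℕ → ℕ) (p v : ℕ) :
    bucketList key (p + 1) v = bucketList key p v ++ if key p = v then [p] else [] := by
  simp [bucketList, List.range_succ, List.filter_singleton]

theorem length_bucketList_le (key : ℕ → ℕ) (p v : ℕ) : (bucketList key p v).length ≤ p := by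
  simpa [bucketList] using List.length_filter_le (fun i => decide (key i = v)) (List.range p)

/-- The array `T` stores all buckets: the bucket with key `v` begins at address `v * (n + 1)`,
with its size. -/
structure IsBucketTable (n : ℕ) (key : ℕ → ℕ) (p : ℕ) (T : ℕ → ℝ) : Prop where
  size : ∀ v, T (v * (n + 1)) = (bucketList key p v).length
  entry : ∀ v j i : ℕ, (bucketList key p v)[j]? = some i → T (v * (n + 1) + (j + 1)) = i + 1

theorem isBucketTable_zero (n : ℕ) (key : ℕ → ℕ) : IsBucketTable n key 0 fun _ => 0 :=
  ⟨fun v => by simp [bucketList], fun v j i h => by simp [bucketList] at h⟩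

theorem IsBucketTable.insert {n : ℕ} {key : ℕ → ℕ} {p : ℕ} {T : ℕ → ℝ}
    (h : IsBucketTable n key p T) (hp : p < n) {c : ℕ}
    (hc : c = (bucketList key p (key p)).length) :
    IsBucketTable n key (p + 1) (Function.update (Function.update T (key p * (n + 1)) (c + 1))
      (key p * (n + 1) + (c + 1)) (p + 1)) := by
  -- Every key owns `n + 1` cells: offset `0` for the size and at most `n` entries. Bounded offsets
  -- make the addresses unique.
  have hinj : ∀ {v r v' r' : ℕ}, r < n + 1 → r' < n + 1 →
      (v * (n + 1) + r = v' * (n + 1) + r' ↔ v = v' ∧ r = r') := fun hr hr' =>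
    ⟨mul_add_inj_of_lt hr hr', by rintro ⟨rfl, rfl⟩; rfl⟩
  have hinj0 : ∀ {v v' : ℕ}, v * (n + 1) = v' * (n + 1) ↔ v = v' := fun {v v'} =>
    ⟨fun h => Nat.eq_of_mul_eq_mul_right (by omega) h, by rintro rfl; rfl⟩
  have hcp := length_bucketList_le key p (key p)
  constructor
  · intro v
    have h1 : ¬ v * (n + 1) = key p * (n + 1) + (c + 1) := fun e => by
      have := (hinj (r := 0) (by omega) (by omega)).mp e
      omega
    rw [Function.update_apply, if_neg h1, Function.update_apply, bucketList_succ]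
    simp only [hinj0]
    by_cases e : key p = v
    · subst e; simp [hc]
    · simp [e, Ne.symm e, h.size]
  · intro v j i hji
    have hj : j < p + 1 := (List.getElem?_eq_some_iff.mp hji).1.trans_le (length_bucketList_le _ _ _)
    have h1 : ¬ v * (n + 1) + (j + 1) = key p * (n + 1) := fun e => by
      have := (hinj (r' := 0) (by omega) (by omega)).mp e
      omega
    rw [Function.update_apply, Function.update_apply, if_neg h1]
    simp only [hinj (show j + 1 < n + 1 by omega) (show c + 1 < n + 1 by omega)]
    rw [bucketList_succ] at hji
    by_cases e : key p = v
    · subst e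
      rw [if_pos rfl, List.getElem?_append] at hji
      split_ifs at hji with h2
      · rw [if_neg (by omega)]
        exact h.entry _ _ _ hji
      -- Beyond the old list there is only the new element, at position `c`.
      · have h3 : j = c := by
          have := (List.getElem?_eq_some_iff.mp hji).1
          simp at this
          omega
        subst h3
        simp [hc] at hji
        simp [hji]
    · rw [if_neg (by tauto)]
      rw [if_neg e, List.append_nil] at hji
      exact h.entry _ _ _ hji

namespace RealRAM

/-! ### Preprocessing -/

/-- Read the parameters and compute the derived ones. -/
def paramCmd : Cmd := seqs [.const 18 0, .input 2 18, .const 18 1, .input 3 18, .const 18 2,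
  .input 7 18, .const 8 1, .const 9 2, .binary .div 9 8 9, .const 10 16, .binary .div 10 8 10,
  .unary .sqrt 18 7, .unary .sqrt 18 18, .unary .floor 18 18, .binary .mul 4 18 18,
  .binary .mul 4 4 4, .binary .mul 4 4 18, .const 5 8192, .binary .mul 5 5 4, .unary .log 6 5,
  .binary .mul 6 5 6, .unary .exp 6 6, .const 18 3, .input 7 18, .const 19 2,
  .binary .mul 19 19 4, .binary .div 7 7 19, .unary .sqrt 7 7, .binary .div 7 7 5]

/-- Store the Gaussian samples. -/
def gaussLoop : Cmd := .whileLT 16 24 (seqs [.gauss 18, .store 1 16 18, .binary .add 16 16 8])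

/-- Store the uniform samples. -/
def uniformLoop : Cmd :=
  .whileLT 16 25 (seqs [.uniform 18, .store 2 16 18, .binary .add 16 16 8])

/-- Read a data point. -/
def readLoop : Cmd := .whileLT 16 3 (seqs [.input 18 27, .store 5 16 18, .store 0 28 18,
  .binary .add 27 27 8, .binary .add 28 28 8, .binary .add 16 16 8])

/-- Insert all data points into the bucket table. -/
def insertLoop : Cmd := .whileLT 26 2 (seqs [.const 16 0, readLoop, hashCmd, .binary .add 29 2 8,
  .binary .mul 29 11 29, .load 18 4 29, .binary .add 18 18 8, .store 4 29 18,
  .binary .add 18 29 18, .binary .add 26 26 8, .store 4 18 26])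

/-- The preprocessing program. -/
def preCmd : Cmd := seqs [paramCmd, .binary .mul 23 4 5, .binary .mul 24 23 3, .const 16 0,
  gaussLoop, .binary .mul 25 4 6, .binary .mul 25 25 5, .const 16 0, uniformLoop, .const 26 0,
  .const 27 4, .const 28 0, insertLoop]

variable {A : Cfg} {n d k t N : ℕ} {σ : ℝ} {Q : ℕ → Cfg → Prop}

/-- Exact real arithmetic obtains the number of trials from one logarithm and one exponential. The
conventions `log 0 = 0` and `0 ^ 0 = 1` agree for `t = 0`. -/
theorem exp_mul_log_natCast (t : ℕ) : Real.exp (t * Real.log t) = ((t ^ t : ℕ) : ℝ) := by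
  rcases Nat.eq_zero_or_pos t with rfl | ht
  · simp
  · rw [Real.exp_nat_mul, Real.exp_log (by exact_mod_cast ht)]; push_cast; rfl

theorem runs_paramCmd {R β : ℝ} (h0 : A.input 0 = n) (h1 : A.input 1 = d)
    (h2 : A.input 2 = R) (h3 : A.input 3 = β)
    (hQ : ∀ T B, Frame paramCmd A B → T ≤ 40 →
      HasParams B n d (numPieces R) (numDims R) (numTrials R) (projScale R β) → Q T B) :
    Runs paramCmd A Q := by
  have hq : ((⌊Real.sqrt (Real.sqrt R)⌋ : ℤ) : ℝ) = rootParam R :=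
    (natCast_floor_eq_intCast_floor (Real.sqrt_nonneg _)).symm
  have hk : (rootParam R : ℝ) * rootParam R * (rootParam R * rootParam R) * rootParam R =
      (numPieces R : ℝ) := by rw [numPieces]; push_cast; ring
  have ht : 8192 * (numPieces R : ℝ) = numDims R := by rw [numDims, numPieces]; push_cast; ring
  suffices h : Runs paramCmd A fun T B => T ≤ 40 ∧
      HasParams B n d (numPieces R) (numDims R) (numTrials R) (projScale R β) from
    h.mono fun T B hF h => hQ T B hF h.1 h.2
  refine runs_seq (runs_const <| runs_seq <| runs_input 0 (by simp) <|
    runs_seq <| runs_const <| runs_seq <| runs_input 1 (by simp) <|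
    runs_seq <| runs_const <| runs_seq <| runs_input 2 (by simp) <| ?_)
  -- These instructions set the constants in registers `8` to `10` and compute the root parameter,
  -- its fifth power, the dimension and the number of trials.
  iterate 16 first
    | refine runs_seq (runs_const ?_)
    | refine runs_seq (runs_unary ?_)
    | refine runs_seq (runs_binary ?_)
  refine runs_seq (runs_const <| runs_seq <| runs_input 3 (by simp) <| runs_seq <| runs_const <|
    runs_seq <| runs_binary <| runs_seq <| runs_binary <| runs_seq <| runs_unary <|
    runs_binary ?_)
  refine ⟨by omega, ?_⟩
  constructor <;> simp [BinOp.eval, UnOp.eval, h0, h1, h2, h3, hq, hk, ht, exp_mul_log_natCast,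
    numTrials, projScale]

theorem runs_gaussLoop {m : ℕ} (h8 : A.reg 8 = 1) (h16 : A.reg 16 = 0) (h24 : A.reg 24 = m)
    (hQ : ∀ T B, Frame gaussLoop A B → T ≤ m * 8 + 1 → (∀ j < m, B.arr 1 j = A.tape.2 j) →
      B.tape.1 = A.tape.1 → Q T B) : Runs gaussLoop A Q := by
  refine runs_for (n := m) (K := 7) (fun i B => (∀ j < i, B.arr 1 j = A.tape.2 j) ∧
    B.tape.1 = A.tape.1 ∧ B.tape.2 = fun j => A.tape.2 (j + i)) (by decide) h16 h24
    (by simp) (fun i hi B hF h16 hI => ?_) (fun T B hF hT _ hI => hQ T B hF hT hI.1 hI.2.1)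
  have h8' : B.reg 8 = 1 := by rw [hF.reg 8 (by decide), h8]
  obtain ⟨h1, ht1, ht2⟩ := hI
  refine runs_seq (runs_gauss <| runs_seq <| runs_store i (by simpa using h16) <| runs_binary ?_)
  refine ⟨by omega, by simp [BinOp.eval, h16, h8'], fun j hj => ?_, by simp [ht1], ?_⟩
  · rcases Nat.lt_succ_iff_lt_or_eq.mp hj with h | rfl
    · simp [h.ne, h1 j h]
    · simp [ht2]
  · funext j
    change B.tape.2 (j + 1) = _
    rw [ht2]
    exact congrArg A.tape.2 (by omega)

theorem runs_uniformLoop {m : ℕ} (h8 : A.reg 8 = 1) (h16 : A.reg 16 = 0) (h25 : A.reg 25 = m)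
    (hQ : ∀ T B, Frame uniformLoop A B → T ≤ m * 8 + 1 → (∀ j < m, B.arr 2 j = A.tape.1 j) →
      Q T B) : Runs uniformLoop A Q := by
  refine runs_for (n := m) (K := 7) (fun i B => (∀ j < i, B.arr 2 j = A.tape.1 j) ∧
    B.tape.1 = fun j => A.tape.1 (j + i)) (by decide) h16 h25
    (by simp) (fun i hi B hF h16 hI => ?_) (fun T B hF hT _ hI => hQ T B hF hT hI.1)
  have h8' : B.reg 8 = 1 := by rw [hF.reg 8 (by decide), h8]
  obtain ⟨h1, ht1⟩ := hI
  refine runs_seq (runs_uniform <| runs_seq <| runs_store i (by simpa using h16) <| runs_binary ?_)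
  refine ⟨by omega, by simp [BinOp.eval, h16, h8'], fun j hj => ?_, ?_⟩
  · rcases Nat.lt_succ_iff_lt_or_eq.mp hj with h | rfl
    · simp [h.ne, h1 j h]
    · simp [ht1]
  · funext j
    change B.tape.1 (j + 1) = _
    rw [ht1]
    exact congrArg A.tape.1 (by omega)

theorem runs_readLoop {ip pp : ℕ} (h3 : A.reg 3 = d) (h8 : A.reg 8 = 1) (h16 : A.reg 16 = 0)
    (h27 : A.reg 27 = ip) (h28 : A.reg 28 = pp)
    (hQ : ∀ T B, Frame readLoop A B → T ≤ d * 15 + 1 → B.reg 27 = (ip + d : ℕ) →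
      B.reg 28 = (pp + d : ℕ) → (∀ j < d, B.arr 5 j = A.input (ip + j)) →
      (∀ j < d, B.arr 0 (pp + j) = A.input (ip + j)) → (∀ m < pp, B.arr 0 m = A.arr 0 m) →
      Q T B) : Runs readLoop A Q := by
  refine runs_for (n := d) (K := 14) (fun i B => B.reg 27 = (ip + i : ℕ) ∧
    B.reg 28 = (pp + i : ℕ) ∧ (∀ j < i, B.arr 5 j = A.input (ip + j)) ∧
    (∀ j < i, B.arr 0 (pp + j) = A.input (ip + j)) ∧ (∀ m < pp, B.arr 0 m = A.arr 0 m))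
    (by decide) h16 h3 (by simp [h27, h28]) (fun i hi B hF h16 hI => ?_)
    (fun T B hF hT _ ⟨h1, h2, h3, h4, h5⟩ => hQ T B hF hT h1 h2 h3 h4 h5)
  have h8' : B.reg 8 = 1 := by rw [hF.reg 8 (by decide), h8]
  obtain ⟨h27, h28, h5, h0, h0'⟩ := hI
  refine runs_seq (runs_input _ h27 <| runs_seq <| runs_store i (by simpa using h16) <|
    runs_seq <| runs_store (pp + i) (by simpa using h28) <| runs_seq <| runs_binary <|
    runs_seq <| runs_binary <| runs_binary ?_)
  refine ⟨by omega, by simp [BinOp.eval, h16, h8'], by simp [BinOp.eval, h27, h8', add_assoc],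
    by simp [BinOp.eval, h28, h8', add_assoc], fun j hj => ?_, fun j hj => ?_, fun m hm => ?_⟩
  · rcases Nat.lt_succ_iff_lt_or_eq.mp hj with h | rfl
    · simp [h.ne, h5 j h]
    · simp [hF.input]
  · rcases Nat.lt_succ_iff_lt_or_eq.mp hj with h | rfl
    · simp [h.ne, h0 j h]
    · simp [hF.input]
  · simp [show m ≠ pp + i by omega, h0' m hm]

/-- The key of data point number `p`, which is stored from position `4 + p * d` of the input. -/
def inputKey (d k t N : ℕ) (σ : ℝ) (g u input : ℕ → ℝ) (p : ℕ) : ℕ :=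
  hashCode d t N σ g u (fun j => input (4 + p * d + j)) k

/-- Untouched memory is zero, which already encodes the table with all buckets empty. So the huge
range of keys need not be initialized and costs no time. -/
theorem runs_insertLoop (hp : HasParams A n d k t N σ) (h26 : A.reg 26 = 0) (h27 : A.reg 27 = 4)
    (h28 : A.reg 28 = 0) (h4 : A.arr 4 = fun _ => 0)
    (hQ : ∀ T B, Frame insertLoop A B →
      T ≤ n * (d * 15 + k * (t * (15 * d + 12) + N * (19 * t + 7) + 10) + 29) + 1 →
      (∀ m < n * d, B.arr 0 m = A.input (4 + m)) →
      IsBucketTable n (inputKey d k t N σ (A.arr 1) (A.arr 2) A.input) n (B.arr 4) → Q T B) :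
    Runs insertLoop A Q := by
  set key := inputKey d k t N σ (A.arr 1) (A.arr 2) A.input with hkey
  refine runs_for (n := n)
    (K := d * 15 + k * (t * (15 * d + 12) + N * (19 * t + 7) + 10) + 28) (fun p B =>
    B.reg 27 = (4 + p * d : ℕ) ∧ B.reg 28 = (p * d : ℕ) ∧
    (∀ m < p * d, B.arr 0 m = A.input (4 + m)) ∧ IsBucketTable n key p (B.arr 4))
    (by decide) h26 hp.r2 (by simp [h27, h28, h4, isBucketTable_zero]) (fun p hpn B hF h26 hI => ?_)
    (fun T B hF hT _ hI => hQ T B hF hT hI.2.2.1 hI.2.2.2)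
  have hp' := hp.frame hF (by decide)
  obtain ⟨h27, h28, h0, htab⟩ := hI
  have hp1 := hp'.set (a := 16) (by decide) 0
  refine runs_seq (runs_const <| runs_seq <| runs_readLoop (ip := 4 + p * d) (pp := p * d)
    (by simpa using hp1.r3) (by simpa using hp1.r8) (by simp) (by simpa using h27)
    (by simpa using h28) fun T D hF' hT h27 h28 h5 h0n h0o => ?_)
  have hp2 := hp1.frame (by simpa using hF') (c := readLoop) (by decide)
  refine runs_seq (runs_hashCmd hp2 fun T' E hF'' hT' h11 => ?_)
  have hp3 := hp2.frame hF'' (by decide)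
  replace h11 : E.reg 11 = key p := by
    rw [h11]
    congr 1
    refine hashCode_congr (fun m _ => ?_) (fun m _ => ?_) fun i hi => ?_
    · rw [hF'.arr 1 (by decide), Cfg.set_arr, hF.arr 1 (by decide)]
    · rw [hF'.arr 2 (by decide), Cfg.set_arr, hF.arr 2 (by decide)]
    · rw [h5 i hi, Cfg.set_input, hF.input]
  have hE4 : E.arr 4 = B.arr 4 := by
    rw [hF''.arr 4 (by decide), hF'.arr 4 (by decide), Cfg.set_arr]
  have hE0 : E.arr 0 = D.arr 0 := hF''.arr 0 (by decide)
  have hE26 : E.reg 26 = p := by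
    rw [hF''.reg 26 (by decide), hF'.reg 26 (by decide)]; simpa using h26
  have hE27 : E.reg 27 = D.reg 27 := hF''.reg 27 (by decide)
  have hE28 : E.reg 28 = D.reg 28 := hF''.reg 28 (by decide)
  set c := (bucketList key p (key p)).length with hc
  have hsize : B.arr 4 (key p * (n + 1)) = c := htab.size (key p)
  refine runs_seq (runs_binary <| runs_seq <| runs_binary <| runs_seq <|
    runs_load (key p * (n + 1)) (by simp [BinOp.eval, h11, hp3.r2, hp3.r8]) <|
    runs_seq <| runs_binary <| runs_seq <|
    runs_store (key p * (n + 1)) (by simp [BinOp.eval, h11, hp3.r2, hp3.r8]) <|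
    runs_seq <| runs_binary <| runs_seq <| runs_binary <|
    -- The point counter has already been incremented, so the stored value is `p + 1`, the code of
    -- index `p`.
    runs_store (key p * (n + 1) + (c + 1))
      (by simp [BinOp.eval, h11, hp3.r2, hp3.r8, hE4, hsize]) ?_)
  refine ⟨by omega, by simp [BinOp.eval, hE26, hp3.r8], ?_, ?_, fun m hm => ?_, ?_⟩
  · simp [hE27, h27]; ring
  · simp [hE28, h28]; ring
  · simp only [Cfg.setArr_arr, Cfg.set_arr, hE0]
    rw [if_neg (by decide), if_neg (by decide)]
    rcases Nat.lt_or_ge m (p * d) with h | h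
    · rw [h0o m h, Cfg.set_arr, h0 m h]
    · obtain ⟨j, rfl⟩ := Nat.exists_eq_add_of_le h
      rw [h0n j (by rw [add_mul] at hm; omega), Cfg.set_input, hF.input]
      congr 1; ring
  · have := htab.insert hpn hc
    simpa [BinOp.eval, hE4, hsize, hE26, hp3.r8] using this

/-- The preprocessing stores the data points, the hash function and the buckets. -/
theorem runs_preCmd {R β : ℝ} (h0 : A.input 0 = n) (h1 : A.input 1 = d)
    (h2 : A.input 2 = R) (h3 : A.input 3 = β) (h4 : A.arr 4 = fun _ => 0)
    (hk : k = numPieces R) (ht : t = numDims R) (hN : N = numTrials R) (hσ : σ = projScale R β) :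
    Runs preCmd A fun T B =>
      T ≤ k * t * d * 8 + k * N * t * 8 +
        n * (d * 15 + k * (t * (15 * d + 12) + N * (19 * t + 7) + 10) + 29) + 60 ∧
      HasParams B n d k t N σ ∧ (∀ m < n * d, B.arr 0 m = A.input (4 + m)) ∧
      (∀ j < k * t * d, B.arr 1 j = A.tape.2 j) ∧ (∀ j < k * N * t, B.arr 2 j = A.tape.1 j) ∧
      IsBucketTable n (inputKey d k t N σ A.tape.2 A.tape.1 A.input) n (B.arr 4) := by
  refine runs_seq (runs_paramCmd h0 h1 h2 h3 fun T₁ B hF hT₁ hp => ?_)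
  rw [← hk, ← ht, ← hN, ← hσ] at hp
  refine runs_seq (runs_binary <| runs_seq <| runs_binary <| runs_seq <| runs_const <|
    runs_seq <| runs_gaussLoop (m := k * t * d) (by simp [hp.r8]) (by simp)
    (by simp [BinOp.eval, hp.r3, hp.r4, hp.r5]) fun T₂ D hF' hT₂ hg htape => ?_)
  have hp1 := (((hp.set (a := 23) (by decide) _).set (a := 24) (by decide) _).set
    (a := 16) (by decide) _).frame hF' (by decide)
  refine runs_seq (runs_binary <| runs_seq <| runs_binary <| runs_seq <| runs_const <|
    runs_seq <| runs_uniformLoop (m := k * N * t) (by simp [hp1.r8]) (by simp)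
    (by simp [BinOp.eval, hp1.r6, hp1.r4, hp1.r5]) fun T₃ E hF'' hT₃ hu => ?_)
  have hp2 := (((hp1.set (a := 25) (by decide) _).set (a := 25) (by decide) _).set
    (a := 16) (by decide) _).frame hF'' (by decide)
  have hE4 : E.arr 4 = fun _ => 0 := by
    rw [hF''.arr 4 (by decide), Cfg.set_arr, Cfg.set_arr, Cfg.set_arr, hF'.arr 4 (by decide),
      Cfg.set_arr, Cfg.set_arr, Cfg.set_arr, hF.arr 4 (by decide), h4]
  have hEi : E.input = A.input := by
    rw [hF''.input, Cfg.set_input, Cfg.set_input, Cfg.set_input, hF'.input, Cfg.set_input,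
      Cfg.set_input, Cfg.set_input, hF.input]
  have hE1 : ∀ j < k * t * d, E.arr 1 j = A.tape.2 j := by
    intro j hj
    rw [hF''.arr 1 (by decide), Cfg.set_arr, Cfg.set_arr, Cfg.set_arr, hg j hj, Cfg.set_tape,
      Cfg.set_tape, Cfg.set_tape, hF.tape (by decide)]
  have hE2 : ∀ j < k * N * t, E.arr 2 j = A.tape.1 j := by
    intro j hj
    rw [hu j hj, Cfg.set_tape, Cfg.set_tape, Cfg.set_tape, htape, Cfg.set_tape,
      Cfg.set_tape, Cfg.set_tape, hF.tape (by decide)]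
  refine runs_seq (runs_const <| runs_seq <| runs_const <| runs_seq <| runs_const <|
    runs_insertLoop (((hp2.set (by decide) _).set (by decide) _).set (by decide) _)
    (by simp) (by simp) (by simp) (by simpa using hE4) fun T₄ G hF3 hT₄ h0' htab => ?_)
  have hp3 := (((hp2.set (a := 26) (by decide) _).set (a := 27) (by decide) _).set
    (a := 28) (by decide) _).frame hF3 (by decide)
  refine ⟨by omega, hp3, fun m hm => ?_, fun j hj => ?_, fun j hj => ?_, ?_⟩
  · rw [h0' m hm, Cfg.set_input, Cfg.set_input, Cfg.set_input, hEi]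
  · rw [hF3.arr 1 (by decide), Cfg.set_arr, Cfg.set_arr, Cfg.set_arr, hE1 j hj]
  · rw [hF3.arr 2 (by decide), Cfg.set_arr, Cfg.set_arr, Cfg.set_arr, hE2 j hj]
  -- The table was built from the stored samples. They agree with the tape on the finite part that
  -- the hash values use.
  · convert htab using 1
    funext p
    exact hashCode_congr (fun m hm => (hE1 m hm).symm) (fun m hm => (hE2 m hm).symm)
      fun i _ => by simp [hEi]

end RealRAM

namespace RealRAM

/-! ### Queries -/

/-- Read the query point. -/
def queryLoop : Cmd :=
  .whileLT 16 3 (seqs [.input 18 16, .store 5 16 18, .binary .add 16 16 8])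

/-- Accumulate the squared distance of the query point and a data point. -/
def sqDistLoop : Cmd := .whileLT 16 3 (seqs [.load 18 5 16, .load 19 0 25,
  .binary .sub 18 18 19, .binary .mul 18 18 18, .binary .add 17 17 18, .binary .add 25 25 8,
  .binary .add 16 16 8])

/-- Sample an element of the bucket and evaluate the kernel. -/
def sampleCmd : Cmd := seqs [.uniform 18, .binary .mul 18 18 23, .unary .floor 18 18,
  .binary .add 18 18 29, .binary .add 18 18 8, .load 0 4 18, .binary .sub 25 0 8,
  .binary .mul 25 25 3, .const 16 0, .const 17 0, sqDistLoop, .const 1 0, .binary .sub 17 1 17,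
  .unary .exp 17 17, .binary .mul 17 17 23, .binary .div 1 17 2]

/-- The query program. -/
def queryCmd : Cmd := seqs [.const 16 0, queryLoop, hashCmd, .binary .add 29 2 8,
  .binary .mul 29 11 29, .load 23 4 29, .const 24 0,
  .ifLE 23 24 (seqs [.const 0 0, .const 1 0]) sampleCmd]

variable {A : Cfg} {n d k t N : ℕ} {σ : ℝ} {Q : ℕ → Cfg → Prop}

theorem runs_queryLoop (h3 : A.reg 3 = d) (h8 : A.reg 8 = 1) (h16 : A.reg 16 = 0)
    (hQ : ∀ T B, Frame queryLoop A B → T ≤ d * 8 + 1 → (∀ j < d, B.arr 5 j = A.input j) →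
      Q T B) : Runs queryLoop A Q := by
  refine runs_for (n := d) (K := 7) (fun i B => ∀ j < i, B.arr 5 j = A.input j)
    (by decide) h16 h3 (by simp) (fun i hi B hF h16 hI => ?_)
    (fun T B hF hT _ hI => hQ T B hF hT hI)
  have h8' : B.reg 8 = 1 := by rw [hF.reg 8 (by decide), h8]
  refine runs_seq (runs_input _ h16 <| runs_seq <| runs_store i (by simpa using h16) <|
    runs_binary ?_)
  refine ⟨by omega, by simp [BinOp.eval, h16, h8'], fun j hj => ?_⟩
  rcases Nat.lt_succ_iff_lt_or_eq.mp hj with h | rfl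
  · simp [h.ne, hI j h]
  · simp [hF.input]

theorem runs_sqDistLoop {pp : ℕ} (h3 : A.reg 3 = d) (h8 : A.reg 8 = 1) (h16 : A.reg 16 = 0)
    (h17 : A.reg 17 = 0) (h25 : A.reg 25 = pp)
    (hQ : ∀ T B, Frame sqDistLoop A B → T ≤ d * 16 + 1 →
      B.reg 17 = ∑ j ∈ Finset.range d, (A.arr 5 j - A.arr 0 (pp + j)) ^ 2 → Q T B) :
    Runs sqDistLoop A Q := by
  refine runs_for (n := d) (K := 15) (fun i B => B.reg 25 = (pp + i : ℕ) ∧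
    B.reg 17 = ∑ j ∈ Finset.range i, (A.arr 5 j - A.arr 0 (pp + j)) ^ 2)
    (by decide) h16 h3 (by simp [h17, h25]) (fun i hi B hF h16 hI => ?_)
    (fun T B hF hT _ hI => hQ T B hF hT hI.2)
  have h8' : B.reg 8 = 1 := by rw [hF.reg 8 (by decide), h8]
  obtain ⟨h25, h17⟩ := hI
  refine runs_seq (runs_load i h16 <| runs_seq <| runs_load (pp + i) (by simpa using h25) <|
    runs_seq <| runs_binary <| runs_seq <| runs_binary <| runs_seq <| runs_binary <| runs_seq <|
    runs_binary <| runs_binary ?_)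
  simp [BinOp.eval, h16, h17, h25, h8', hF.arr 5 (by decide), hF.arr 0 (by decide),
    Finset.sum_range_succ, sq, add_assoc]

/-- The element of a list selected by a number in `[0,1)`. -/
def selected (L : List ℕ) (u : ℝ) : Option ℕ := L[⌊u * L.length⌋₊]?

/-- The selected position is the floor of a uniform number times the bucket size; adding the bucket
address and `1` skips the size cell. -/
theorem runs_sampleCmd {key : ℕ → ℕ} {v : ℕ} (hp : HasParams A n d k t N σ)
    (htab : IsBucketTable n key n (A.arr 4)) (h23 : A.reg 23 = (bucketList key n v).length)
    (h29 : A.reg 29 = (v * (n + 1) : ℕ)) (hu : 0 ≤ A.tape.1 0) {i : ℕ}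
    (hi : selected (bucketList key n v) (A.tape.1 0) = some i) :
    Runs sampleCmd A fun T B => T ≤ d * 16 + 21 ∧ B.reg 0 = i + 1 ∧
      B.reg 1 = Real.exp (-∑ j ∈ Finset.range d, (A.arr 5 j - A.arr 0 (i * d + j)) ^ 2) *
        (bucketList key n v).length / n := by
  set L := bucketList key n v with hL
  set jj := ⌊A.tape.1 0 * L.length⌋₊ with hjj
  have hfl : ((⌊A.tape.1 0 * L.length⌋ : ℤ) : ℝ) = jj :=
    (natCast_floor_eq_intCast_floor (mul_nonneg hu (Nat.cast_nonneg _))).symm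
  have hent := htab.entry v jj i hi
  have hp1 := (((hp.set (a := 18) (by decide) (jj + (v * (n + 1) : ℕ) + 1)).set
    (a := 0) (by decide) (i + 1)).set (a := 25) (by decide) (i * d)).set (a := 16) (by decide) 0
  refine runs_seq (runs_uniform <| runs_seq <| runs_binary <| runs_seq <| runs_unary <|
    runs_seq <| runs_binary <| runs_seq <| runs_binary <| runs_seq <|
    runs_load (v * (n + 1) + (jj + 1))
      (by simp [BinOp.eval, UnOp.eval, h23, h29, hfl, hp.r8]; ring) <|
    runs_seq <| runs_binary <| runs_seq <| runs_binary <| runs_seq <| runs_const <|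
    runs_seq <| runs_const <| runs_seq <| runs_sqDistLoop (d := d) (pp := i * d)
      (by simp [hp.r3]) (by simp [hp.r8]) (by simp) (by simp)
      (by simp [BinOp.eval, hp.r3, hp.r8, hent]) fun T B hF hT h17 => ?_)
  simp only [Cfg.set_arr, Cfg.dropUniform_arr] at h17
  have e23 : B.reg 23 = L.length := by
    rw [hF.reg 23 (by decide)]; simpa using h23
  have e2 : B.reg 2 = n := by
    rw [hF.reg 2 (by decide)]; simpa using hp.r2
  have e0 : B.reg 0 = i + 1 := by
    rw [hF.reg 0 (by decide)]; simpa using hent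
  refine runs_seq (runs_const <| runs_seq <| runs_binary <| runs_seq <| runs_unary <|
    runs_seq <| runs_binary <| runs_binary ?_)
  exact ⟨by omega, by simpa using e0, by simp [BinOp.eval, UnOp.eval, h17, e23, e2]⟩

/-- The query program returns the selected element of the bucket and the value of the
estimator. -/
theorem runs_queryCmd {key : ℕ → ℕ} {v : ℕ} (hp : HasParams A n d k t N σ)
    (htab : IsBucketTable n key n (A.arr 4))
    (hv : v = hashCode d t N σ (A.arr 1) (A.arr 2) A.input k)
    (hu : 0 ≤ A.tape.1 0) (hu' : A.tape.1 0 < 1) :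
    Runs queryCmd A fun T B =>
      T ≤ k * (t * (15 * d + 12) + N * (19 * t + 7) + 10) + d * 24 + 50 ∧
      (selected (bucketList key n v) (A.tape.1 0) = none → B.reg 0 = 0 ∧ B.reg 1 = 0) ∧
      ∀ i, selected (bucketList key n v) (A.tape.1 0) = some i → B.reg 0 = i + 1 ∧
      B.reg 1 = Real.exp (-∑ j ∈ Finset.range d, (A.input j - A.arr 0 (i * d + j)) ^ 2) *
        (bucketList key n v).length / n := by
  set L := bucketList key n v with hL
  have hp1 := hp.set (a := 16) (by decide) 0
  refine runs_seq (runs_const <| runs_seq <| runs_queryLoop (d := d) (by simp [hp.r3])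
    (by simp [hp.r8]) (by simp) fun T B hF hT h5 => ?_)
  have hp2 := hp1.frame (by simpa using hF) (c := queryLoop) (by decide)
  refine runs_seq (runs_hashCmd hp2 fun T' D hF' hT' h11 => ?_)
  have hp3 := hp2.frame hF' (by decide)
  have h11' : D.reg 11 = v := by
    rw [h11, hv]
    congr 1
    refine hashCode_congr (fun m _ => ?_) (fun m _ => ?_) fun i hi => ?_
    · rw [hF.arr 1 (by decide), Cfg.set_arr]
    · rw [hF.arr 2 (by decide), Cfg.set_arr]
    · rw [h5 i hi, Cfg.set_input]
  have hD4 : D.arr 4 = A.arr 4 := by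
    rw [hF'.arr 4 (by decide), hF.arr 4 (by decide), Cfg.set_arr]
  have hD0 : D.arr 0 = A.arr 0 := by
    rw [hF'.arr 0 (by decide), hF.arr 0 (by decide), Cfg.set_arr]
  have hD5 : ∀ j < d, D.arr 5 j = A.input j := by
    intro j hj
    rw [hF'.arr 5 (by decide), h5 j hj, Cfg.set_input]
  have hDt : D.tape = A.tape := by
    rw [hF'.tape (by decide), hF.tape (by decide), Cfg.set_tape]
  have hsize := htab.size v
  have hmul : D.reg 11 * (D.reg 2 + D.reg 8) = (v * (n + 1) : ℕ) := by
    rw [h11', hp3.r2, hp3.r8]; push_cast; ring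
  refine runs_seq (runs_binary <| runs_seq <| runs_binary <| runs_seq <|
    runs_load (v * (n + 1)) (by simpa [BinOp.eval] using hmul) <| runs_seq <| runs_const <|
    -- An empty bucket returns `0` for `⊥` and the estimate `0` without drawing a sample.
    runs_ifLE (fun hc => runs_seq <| runs_const <| runs_const ?_) fun hc => ?_)
  · have hlen : L.length = 0 := by
      simpa [hD4, hsize, ← hL] using hc
    have hnone : selected L (A.tape.1 0) = none := by
      rw [List.length_eq_zero_iff.mp hlen]; rfl
    refine ⟨by omega, fun _ => by simp, fun i hi => ?_⟩
    rw [hnone] at hi; cases hi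
  · have hlen : 0 < L.length := by
      simpa [hD4, hsize, ← hL, Nat.pos_iff_ne_zero] using hc
    have hlt : ⌊A.tape.1 0 * L.length⌋₊ < L.length := by
      rw [Nat.floor_lt (mul_nonneg hu (Nat.cast_nonneg _))]
      have : (0 : ℝ) < L.length := by exact_mod_cast hlen
      nlinarith
    have hsel : selected L (A.tape.1 0) = some L[⌊A.tape.1 0 * L.length⌋₊] :=
      List.getElem?_eq_getElem hlt
    refine (runs_sampleCmd (key := key) (v := v) ((((hp3.set (by decide) _).set (by decide) _).set
      (by decide) _).set (by decide) _) (by simpa [hD4] using htab) (by simp [hD4, hsize])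
      (by simpa [BinOp.eval] using hmul) (by simpa [hDt] using hu)
      (by simpa [hDt] using hsel)).mono fun T B _ h => ?_
    refine ⟨by omega, fun h' => absurd (hsel.symm.trans h') (by simp), fun i hi => ?_⟩
    obtain rfl := Option.some.inj (hsel.symm.trans hi)
    refine ⟨h.2.1, h.2.2.trans ?_⟩
    simp only [Cfg.set_arr, hD0]
    congr 4
    exact Finset.sum_congr rfl fun j hj => by rw [hD5 j (Finset.mem_range.mp hj)]

end RealRAM

/-! ### The law of the sample -/

theorem measurePreserving_tape_head :
    MeasurePreserving (fun τ : Tape => τ.1 0) tapeMeasure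
      ((volume : Measure ℝ).restrict (Set.Icc 0 1)) :=
  (measurePreserving_eval_infinitePi
    (fun _ : ℕ => (volume : Measure ℝ).restrict (Set.Icc 0 1)) 0).comp measurePreserving_fst

/-- The endpoint `1` would select a position past the end of the bucket; excluding it is the only
use of an almost sure statement for queries. -/
theorem ae_tape_head_mem : ∀ᵐ τ ∂tapeMeasure, τ.1 0 ∈ Set.Ico (0 : ℝ) 1 := by
  refine measurePreserving_tape_head.quasiMeasurePreserving.ae
    (p := fun u => u ∈ Set.Ico (0 : ℝ) 1) ?_
  rw [← Measure.restrict_congr_set Ico_ae_eq_Icc]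
  exact ae_restrict_mem measurableSet_Ico

/-- Up to the endpoint, the event is an interval of length `1 / c`. -/
theorem tapeMeasure_floor_eq {c j : ℕ} (hj : j < c) :
    tapeMeasure.real {τ : Tape | ⌊τ.1 0 * c⌋₊ = j} = 1 / c := by
  have hc : (0 : ℝ) < c := by exact_mod_cast (by omega : 0 < c)
  have hm : MeasurableSet {u : ℝ | ⌊u * c⌋₊ = j} :=
    (Nat.measurable_floor.comp (measurable_id.mul_const _)) (measurableSet_singleton j)
  have h1 := measurePreserving_tape_head.measureReal_preimage hm.nullMeasurableSet
  have hset : {u : ℝ | ⌊u * c⌋₊ = j} ∩ Set.Ico 0 1 = Set.Ico ((j : ℝ) / c) ((j + 1) / c) := by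
    ext u
    simp only [Set.mem_inter_iff, Set.mem_ofPred_eq, Set.mem_Ico, div_le_iff₀ hc, lt_div_iff₀ hc]
    constructor
    · rintro ⟨h2, h3, -⟩
      exact (Nat.floor_eq_iff (mul_nonneg h3 hc.le)).mp h2
    · rintro ⟨h2, h3⟩
      have h4 : 0 ≤ u * c := (Nat.cast_nonneg j).trans h2
      refine ⟨(Nat.floor_eq_iff h4).mpr ⟨h2, h3⟩, nonneg_of_mul_nonneg_left h4 hc, ?_⟩
      have : (j : ℝ) + 1 ≤ c := by exact_mod_cast hj
      nlinarith
  change tapeMeasure.real ((fun τ : Tape => τ.1 0) ⁻¹' {u : ℝ | ⌊u * c⌋₊ = j}) = _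
  rw [h1, ← Measure.restrict_congr_set Ico_ae_eq_Icc, measureReal_restrict_apply hm, hset,
    Real.volume_real_Ico_of_le (by gcongr; linarith)]
  ring

/-- The sampled index. -/
def sampleIndex (n : ℕ) (L : List ℕ) (τ : Tape) : Option (Fin n) :=
  (RealRAM.selected L (τ.1 0)).bind fun i => if h : i < n then some ⟨i, h⟩ else none

theorem sampleIndex_eq_some_iff {n : ℕ} {L : List ℕ} {τ : Tape} {i : Fin n} :
    sampleIndex n L τ = some i ↔ RealRAM.selected L (τ.1 0) = some (i : ℕ) := by
  rw [sampleIndex, Option.bind_eq_some_iff]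
  constructor
  · rintro ⟨m, hm, h⟩
    split_ifs at h with h1
    rw [hm, ← Option.some.inj h]
  · exact fun h => ⟨i, h, by simp⟩

theorem sampleIndex_eq_none {n : ℕ} {L : List ℕ} (hlt : ∀ i ∈ L, i < n) {τ : Tape}
    (h : sampleIndex n L τ = none) : RealRAM.selected L (τ.1 0) = none := by
  rw [sampleIndex, Option.bind_eq_none_iff] at h
  by_contra h'
  obtain ⟨m, hm⟩ := Option.ne_none_iff_exists'.mp h'
  have := h m hm
  rw [dif_pos (hlt m (List.mem_of_getElem? hm))] at this
  cases this

/-- As the list has no repetitions, each element of the bucket corresponds to exactly one position,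
and positions are uniform. Measurability holds because the sample factors through a natural number.
-/
theorem isUniformSample_sampleIndex {n : ℕ} {B : Finset (Fin n)} {L : List ℕ} (hL : L.Nodup)
    (hB : ∀ i : Fin n, i ∈ B ↔ (i : ℕ) ∈ L) (hcard : B.card = L.length) :
    IsUniformSample B (sampleIndex n L) := by
  refine ⟨fun o => ?_, fun h => ?_, fun i hi => ?_⟩
  · have hm : Measurable fun τ : Tape => ⌊τ.1 0 * L.length⌋₊ :=
      Nat.measurable_floor.comp (measurePreserving_tape_head.measurable.mul_const _)
    exact hm (MeasurableSet.of_discrete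
      (s := {j | (L[j]?.bind fun i => if h : i < n then some ⟨i, h⟩ else none) = o}))
  · have h1 : L = [] := List.length_eq_zero_iff.mp (by rw [← hcard, h]; rfl)
    subst h1
    exact Filter.Eventually.of_forall fun τ => rfl
  · obtain ⟨j, hj, hji⟩ := List.mem_iff_getElem.mp ((hB i).mp hi)
    rw [hcard, ← tapeMeasure_floor_eq hj]
    congr 1
    ext τ
    simp only [Set.mem_ofPred_eq, sampleIndex_eq_some_iff, RealRAM.selected]
    constructor
    · intro h
      obtain ⟨h1, h2⟩ := List.getElem?_eq_some_iff.mp h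
      exact (hL.getElem_inj_iff).mp (h2.trans hji.symm)
    · intro h
      rw [h, List.getElem?_eq_getElem hj, hji]

/-! ### The complexity -/

theorem datasetInput_point {d n : ℕ} (R β : ℝ) (P : Fin n → Pt d) (i : Fin n) {j : ℕ}
    (hj : j < d) : datasetInput R β P (4 + (i * d + j)) = queryInput (P i) j := by
  have h1 : (4 + (i * d + j) - 4) / d = i := by
    rw [Nat.add_sub_cancel_left, mul_comm, Nat.mul_add_div (by omega), Nat.div_eq_of_lt hj,
      add_zero]
  have h2 : (4 + (i * d + j) - 4) % d = j := by
    rw [Nat.add_sub_cancel_left, mul_comm, Nat.mul_add_mod, Nat.mod_eq_of_lt hj]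
  rw [datasetInput, if_neg (by omega), if_neg (by omega), if_neg (by omega), if_neg (by omega),
    dif_pos (by rw [h1, h2]; exact ⟨i.2, hj⟩), queryInput, dif_pos hj]
  simp only [h1, h2]

theorem gaussianKernel_eq {d : ℕ} (x y : Pt d) :
    gaussianKernel x y =
      Real.exp (-∑ j ∈ Finset.range d, (queryInput x j - queryInput y j) ^ 2) := by
  rw [gaussianKernel, EuclideanSpace.real_norm_sq_eq, Finset.sum_range]
  simp [queryInput]

theorem wellFormed_preCmd : RealRAM.preCmd.WellFormed := by
  simp [RealRAM.preCmd, RealRAM.paramCmd, RealRAM.gaussLoop, RealRAM.uniformLoop,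
    RealRAM.insertLoop, RealRAM.readLoop, RealRAM.hashCmd, RealRAM.pieceLoop, RealRAM.projectLoop,
    RealRAM.innerLoop, RealRAM.trialLoop, RealRAM.distLoop, RealRAM.seqs, RealRAM.Cmd.WellFormed]

theorem wellFormed_queryCmd : RealRAM.queryCmd.WellFormed := by
  simp [RealRAM.queryCmd, RealRAM.queryLoop, RealRAM.sampleCmd, RealRAM.sqDistLoop,
    RealRAM.hashCmd, RealRAM.pieceLoop, RealRAM.projectLoop,
    RealRAM.innerLoop, RealRAM.trialLoop, RealRAM.distLoop, RealRAM.seqs, RealRAM.Cmd.WellFormed]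

theorem card_bucket_ballCarving {d n k t N : ℕ} {σ : ℝ} (P : Fin n → Pt d) (ω : Tape) (x : Pt d)
    {key : ℕ → ℕ} (hkey : ∀ i : Fin n, key i = (ballCarving d k t N σ).hash ω (P i)) :
    ((ballCarving d k t N σ).bucket P ω x).card =
      (bucketList key n ((ballCarving d k t N σ).hash ω x)).length := by
  have hnd : (bucketList key n ((ballCarving d k t N σ).hash ω x)).Nodup :=
    List.nodup_range.filter _
  rw [← List.toFinset_card_of_nodup hnd, ← Finset.card_map Fin.valEmbedding]
  congr 1
  ext m
  simp only [Finset.mem_map, HashFamily.bucket, Finset.mem_filter, Finset.mem_univ, true_and,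
    Fin.valEmbedding_apply, List.mem_toFinset, bucketList, List.mem_filter, List.mem_range,
    decide_eq_true_eq]
  constructor
  · rintro ⟨i, hi, rfl⟩
    exact ⟨i.2, (hkey i).trans hi⟩
  · rintro ⟨h1, h2⟩
    exact ⟨⟨m, h1⟩, (hkey ⟨m, h1⟩).symm.trans h2, rfl⟩

/-- The number of steps for evaluating the hash function. -/
def hashCost (d k t N : ℕ) : ℕ := k * (t * (15 * d + 12) + N * (19 * t + 7) + 10)

theorem gaussianHash_hasComplexity {n d : ℕ} {R β T : ℝ} {k t N : ℕ}
    (hk : k = numPieces R) (ht : t = numDims R) (hN : N = numTrials R)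
    (hpre : ((k * t * d * 8 + k * N * t * 8 + n * (d * 15 + hashCost d k t N + 29) + 60 : ℕ) : ℝ) ≤
      T * n)
    (hquery : ((hashCost d k t N + d * 24 + 50 : ℕ) : ℝ) ≤ T) :
    (gaussianHash d R β).HasComplexity RealRAM.preCmd.compile RealRAM.queryCmd.compile
      gaussianKernel n R β T := by
  intro P _
  -- Preprocessing succeeds for every tape; no null set is needed here.
  refine Filter.Eventually.of_forall fun ω => ?_
  set σ := projScale R β with hσ
  have hF : gaussianHash d R β = ballCarving d k t N σ := by rw [gaussianHash, hk, ht, hN]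
  rw [hF]
  obtain ⟨T₁, B, hexec, hT₁, hp, hB0, hB1, hB2, htab⟩ := RealRAM.runs_preCmd
    (A := ⟨fun _ => 0, fun _ _ => 0, datasetInput R β P, ω⟩) (n := n) (d := d) (R := R) (β := β)
    (by simp [datasetInput]) (by simp [datasetInput]) (by simp [datasetInput])
    (by simp [datasetInput]) rfl hk ht hN hσ
  obtain ⟨s, hs, hrep⟩ := hexec.compile wellFormed_preCmd
    ⟨fun _ => 0, datasetInput R β P, ω⟩ ⟨fun _ _ => rfl, fun _ _ _ => rfl, rfl, rfl⟩
  have hT₁' : (T₁ : ℝ) ≤ T * n := le_trans (by exact_mod_cast hT₁) hpre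
  -- Memory starts with all cells zero, so the number of nonzero cells is at most the number of
  -- steps, and the space bound follows from the time bound.
  have hsupp := hs.support (by simp)
  refine ⟨T₁, s, hs, hT₁', hsupp.1, le_trans ?_ hT₁', fun x _ => ?_⟩
  · have := hsupp.2
    simp only [Function.support_fun_zero, Set.ncard_empty, zero_add] at this
    exact_mod_cast this
  set key := RealRAM.inputKey d k t N σ ω.2 ω.1 (datasetInput R β P) with hkeydef
  have hkey : ∀ i : Fin n, key i = (ballCarving d k t N σ).hash ω (P i) := fun i =>
    hashCode_congr (fun _ _ => rfl) (fun _ _ => rfl) fun j hj => by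
      rw [add_assoc, datasetInput_point R β P i hj]
  set v : ℕ := (ballCarving d k t N σ).hash ω x with hv
  have hv' : v = hashCode d t N σ (B.arr 1) (B.arr 2) (queryInput x) k :=
    hashCode_congr (fun j hj => (hB1 j hj).symm) (fun j hj => (hB2 j hj).symm) fun _ _ => rfl
  set L := bucketList key n v with hL
  have hcard := card_bucket_ballCarving P ω x hkey
  have hlt : ∀ i ∈ L, i < n := fun i hi => by
    simpa using (List.mem_filter.mp hi).1
  refine ⟨sampleIndex n L, isUniformSample_sampleIndex (List.nodup_range.filter _)
    (fun i => ?_) hcard, ?_⟩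
  · simp only [HashFamily.bucket, Finset.mem_filter, Finset.mem_univ, true_and, hL, bucketList,
      List.mem_filter, List.mem_range, Fin.is_lt, decide_eq_true_eq, hkey]
    exact Iff.rfl
  filter_upwards [ae_tape_head_mem] with τ hτ
  -- The query inherits registers and arrays from preprocessing, with the input and the tape
  -- replaced.
  obtain ⟨T₂, D, hexec', hT₂, hnone, hsome⟩ := RealRAM.runs_queryCmd
    (A := ⟨B.reg, B.arr, queryInput x, τ⟩) (key := key) (v := v)
    ⟨hp.r2, hp.r3, hp.r4, hp.r5, hp.r6, hp.r7, hp.r8, hp.r9, hp.r10⟩ htab hv' hτ.1 hτ.2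
  obtain ⟨s', hs', hrep'⟩ := hexec'.compile wellFormed_queryCmd
    ⟨s.mem, queryInput x, τ⟩ ⟨hrep.reg, hrep.arr, rfl, rfl⟩
  refine ⟨T₂, s', hs', le_trans (by exact_mod_cast hT₂) hquery, ?_, ?_⟩
  · rw [hrep'.reg 0 (by norm_num)]
    rcases hI : sampleIndex n L τ with _ | i
    · exact (hnone (sampleIndex_eq_none hlt hI)).1
    · exact (hsome i (sampleIndex_eq_some_iff.mp hI)).1
  · rw [hrep'.reg 1 (by norm_num)]
    rcases hI : sampleIndex n L τ with _ | i
    · rw [(hnone (sampleIndex_eq_none hlt hI)).2]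
      simp [HashFamily.estimate, sampleWeight]
    · rw [(hsome i (sampleIndex_eq_some_iff.mp hI)).2, HashFamily.estimate, hcard, sampleWeight,
        gaussianKernel_eq]
      have hsum : ∑ j ∈ Finset.range d, (queryInput x j - B.arr 0 (i * d + j)) ^ 2 =
          ∑ j ∈ Finset.range d, (queryInput x j - queryInput (P i) j) ^ 2 := by
        refine Finset.sum_congr rfl fun j hj => ?_
        rw [Finset.mem_range] at hj
        rw [hB0 _ (mul_add_lt_mul i.2 hj)]
        exact congrArg (fun y => (queryInput x j - y) ^ 2) (datasetInput_point R β P i hj)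
      simp only [hsum]
      ring

/-- The constant is `27 + 26 + 10`, from the projections, the distances and the remaining work of
each piece. -/
theorem hashCost_le {d k t N : ℕ} (hd : 1 ≤ d) (hkt : k ≠ 0 → 1 ≤ t) (hN : 1 ≤ N) :
    hashCost d k t N ≤ 63 * (d * (k * t * N)) := by
  rcases Nat.eq_zero_or_pos k with rfl | hk
  · simp [hashCost]
  have ht := hkt hk.ne'
  have h1 : t * (15 * d + 12) ≤ 27 * (d * (t * N)) := by
    calc t * (15 * d + 12) ≤ t * (27 * d) := Nat.mul_le_mul_left _ (by omega)
      _ = 27 * (d * t) := by ring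
      _ ≤ 27 * (d * (t * N)) := by gcongr; exact Nat.le_mul_of_pos_right _ hN
  have h2 : N * (19 * t + 7) ≤ 26 * (d * (t * N)) := by
    calc N * (19 * t + 7) ≤ N * (26 * t) := Nat.mul_le_mul_left _ (by omega)
      _ = 26 * (1 * (t * N)) := by ring
      _ ≤ _ := by gcongr
  have h3 : 1 ≤ d * (t * N) := Nat.mul_pos hd (Nat.mul_pos ht hN)
  calc hashCost d k t N ≤ k * (63 * (d * (t * N))) := Nat.mul_le_mul_left _ (by omega)
    _ = _ := by ring

/-- The size of the hash function is at most `exp (O(R^(4/3)))`. -/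
theorem one_add_size_le {R : ℝ} (hR : 0 < R) :
    104 * (1 + ((numPieces R * numDims R * numTrials R : ℕ) : ℝ)) ≤
      Real.exp (10 ^ 6 * max R 1 ^ (4 / 3 : ℝ)) := by
  have hmax : 1 ≤ max R 1 ^ (4 / 3 : ℝ) := Real.one_le_rpow (le_max_right _ _) (by norm_num)
  have hRmax : R ^ (4 / 3 : ℝ) ≤ max R 1 ^ (4 / 3 : ℝ) :=
    Real.rpow_le_rpow hR.le (le_max_left _ _) (by norm_num)
  have h208 : (208 : ℝ) ≤ Real.exp 207 := by
    have := Real.add_one_le_exp (207 : ℝ)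
    linarith
  -- Without pieces the product vanishes and only the constant `104` has to be covered.
  rcases Nat.eq_zero_or_pos (rootParam R) with h | h
  · have h0 : numPieces R = 0 := by rw [numPieces, h]; rfl
    rw [h0]
    have : Real.exp 207 ≤ Real.exp (10 ^ 6 * max R 1 ^ (4 / 3 : ℝ)) :=
      Real.exp_le_exp.mpr (by linarith)
    simp only [zero_mul, Nat.cast_zero]
    linarith
  · have hk1 : 1 ≤ numPieces R := Nat.one_le_pow _ _ h
    have hkt : numDims R = 8192 * numPieces R := rfl
    have ht1 : (1 : ℝ) ≤ numDims R := by
      exact_mod_cast (by omega : 1 ≤ numDims R)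
    have hS : ((numPieces R * numDims R * numTrials R : ℕ) : ℝ) ≤
        (numDims R : ℝ) ^ (3 * numDims R) := by
      calc ((numPieces R * numDims R * numTrials R : ℕ) : ℝ) ≤
            ((numDims R * numDims R * numTrials R : ℕ) : ℝ) := by
            gcongr; exact_mod_cast (by omega : numPieces R ≤ numDims R)
        _ = (numDims R : ℝ) ^ (numDims R + 2) := by
            rw [numTrials]; push_cast; ring
        _ ≤ _ := pow_le_pow_right₀ ht1 (by omega)
    have h1 : (1 : ℝ) ≤ (numDims R : ℝ) ^ (3 * numDims R) := one_le_pow₀ ht1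
    have hlog := log_numDims_le h
    have hq5 : ((numDims R : ℕ) : ℝ) = 8192 * (rootParam R : ℝ) ^ 5 := by
      rw [numDims]; push_cast; ring
    -- `688128 = 3 * 8192 * 28`: the exponent `3 * t` with `t = 8192 * q ^ 5`, times the bound `28 *
    -- q ^ (1/3)` for `log t`.
    have hle : (3 * numDims R : ℕ) * Real.log (numDims R) ≤ 688128 * R ^ (4 / 3 : ℝ) := by
      have h2 := rootParam_rpow_le hR.le
      calc _ ≤ ((3 * numDims R : ℕ) : ℝ) * (28 * (rootParam R : ℝ) ^ (1 / 3 : ℝ)) := by gcongr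
        _ = 688128 * ((rootParam R : ℝ) ^ 5 * (rootParam R : ℝ) ^ (1 / 3 : ℝ)) := by
            push_cast; rw [hq5]; ring
        _ ≤ _ := by gcongr
    have hpow : (numDims R : ℝ) ^ (3 * numDims R) ≤ Real.exp (688128 * R ^ (4 / 3 : ℝ)) := by
      refine le_trans (le_of_eq ?_) (Real.exp_le_exp.mpr hle)
      rw [Real.exp_nat_mul, Real.exp_log (by linarith)]
    calc 104 * (1 + ((numPieces R * numDims R * numTrials R : ℕ) : ℝ)) ≤
          208 * (numDims R : ℝ) ^ (3 * numDims R) := by linarith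
      _ ≤ Real.exp 207 * Real.exp (688128 * R ^ (4 / 3 : ℝ)) := by gcongr
      _ = Real.exp (207 + 688128 * R ^ (4 / 3 : ℝ)) := (Real.exp_add _ _).symm
      _ ≤ _ := Real.exp_le_exp.mpr (by linarith)

/-- Every summand is a multiple of `n * d` or of `n * d * S`. The constant `104 = 44 + 60` is the
coefficient of `n * d` in the preprocessing time, the largest one that occurs. -/
theorem time_bounds {n d : ℕ} {E : ℝ} {k t N : ℕ} (hn : 1 ≤ n) (hd : 1 ≤ d)
    (hkt : k ≠ 0 → 1 ≤ t) (hN : 1 ≤ N) (hE : 104 * (1 + ((k * t * N : ℕ) : ℝ)) ≤ E) :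
    ((k * t * d * 8 + k * N * t * 8 + n * (d * 15 + hashCost d k t N + 29) + 60 : ℕ) : ℝ) ≤
      d * E * n ∧ ((hashCost d k t N + d * 24 + 50 : ℕ) : ℝ) ≤ d * E := by
  have hcost := hashCost_le hd hkt hN
  set S := k * t * N with hS
  have hS' : k * N * t = S := by rw [hS]; ring
  have hktS : k * t ≤ S := Nat.le_mul_of_pos_right _ hN
  have key : d * (104 * (1 + ((S : ℕ) : ℝ))) ≤ d * E := by gcongr
  constructor
  · refine le_trans ?_ (mul_le_mul_of_nonneg_right key (Nat.cast_nonneg n))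
    have h1 : k * t * d ≤ n * (d * S) := by
      calc k * t * d ≤ S * d := Nat.mul_le_mul_right _ hktS
        _ = 1 * (d * S) := by ring
        _ ≤ _ := Nat.mul_le_mul_right _ hn
    have h2 : k * N * t ≤ n * (d * S) := by
      rw [hS']
      calc S = 1 * (1 * S) := by ring
        _ ≤ _ := by gcongr
    have h3 : n * (d * 15 + hashCost d k t N + 29) ≤ n * (44 * d + 63 * (d * S)) :=
      Nat.mul_le_mul_left _ (by omega)
    have h4 : 1 ≤ n * d := Nat.mul_pos hn hd
    have h5 : k * t * d * 8 + k * N * t * 8 + n * (d * 15 + hashCost d k t N + 29) + 60 ≤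
        d * (104 * (1 + S)) * n := by
      have h6 : n * (44 * d + 63 * (d * S)) = 44 * (n * d) + 63 * (n * (d * S)) := by ring
      have h7 : d * (104 * (1 + S)) * n = 104 * (n * d) + 104 * (n * (d * S)) := by ring
      omega
    exact_mod_cast h5
  · refine le_trans ?_ key
    have h5 : hashCost d k t N + d * 24 + 50 ≤ d * (104 * (1 + S)) := by
      have h7 : d * (104 * (1 + S)) = 104 * d + 104 * (d * S) := by ring
      omega
    exact_mod_cast h5

end

/-! ### The theorem: choice of the constant. -/

theorem theorem6p1 :
    ∃ (pre query : RealRAM.Prog) (C : ℝ), 0 < C ∧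
      ∀ (n d : ℕ) (R β : ℝ), 3 ≤ n → 1 ≤ d → 0 < R → β ∈ Set.Ioc (0 : ℝ) 1 →
        ∃ F : HashFamily d,
          F.IsScaleFree gaussianKernel n R β
            (Real.exp (C * R ^ (4 / 3 : ℝ) * Real.log (Real.log n))) ∧
          F.HasComplexity pre query gaussianKernel n R β
            (d * Real.exp (C * max R 1 ^ (4 / 3 : ℝ) * Real.log (Real.log n))) := by
  have hL : 0 < Real.log (Real.log 3) := by
    simpa using (le_log_log (n := 3) le_rfl).1
  -- Dividing by `log log 3` makes `C * log log n` at least `10 ^ 6` for all `n ≥ 3`, so the bounds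
  -- that do not depend on `n` suffice.
  refine ⟨RealRAM.preCmd.compile, RealRAM.queryCmd.compile, 10 ^ 6 / Real.log (Real.log 3),
    by positivity, fun n d R β hn hd hR hβ => ⟨gaussianHash d R β, ?_, ?_⟩⟩
  · refine gaussianHash_isScaleFree ?_ hn hR hβ
    rw [div_mul_cancel₀ _ hL.ne']
    norm_num
  · have hkt : numPieces R ≠ 0 → 1 ≤ numDims R := fun h => by
      have : numDims R = 8192 * numPieces R := rfl
      omega
    have hN : 1 ≤ numTrials R := by
      rw [numTrials]
      rcases Nat.eq_zero_or_pos (numDims R) with h | h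
      · rw [h]; norm_num
      · exact Nat.one_le_pow _ _ h
    have hE : 104 * (1 + ((numPieces R * numDims R * numTrials R : ℕ) : ℝ)) ≤
        Real.exp (10 ^ 6 / Real.log (Real.log 3) * max R 1 ^ (4 / 3 : ℝ) *
          Real.log (Real.log n)) := by
      refine (one_add_size_le hR).trans (Real.exp_le_exp.mpr ?_)
      calc 10 ^ 6 * max R 1 ^ (4 / 3 : ℝ) = 10 ^ 6 / Real.log (Real.log 3) *
            max R 1 ^ (4 / 3 : ℝ) * Real.log (Real.log 3) := by field_simp
        _ ≤ _ := mul_le_mul_of_nonneg_left (le_log_log hn).2 (by positivity)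
    obtain ⟨h1, h2⟩ := time_bounds (by omega : 1 ≤ n) hd hkt hN hE
    exact gaussianHash_hasComplexity rfl rfl rfl h1 h2
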